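/- Let $\mathcal X,\mathcal U$ be finite non-empty sets (states, controls), $p^u_{i,\cdot}$ a probability vector on $\mathcal X$ for each $(i,u)$, $0<\gamma<1$, and $N\ge 2$ the number of agents. Let $c_n(i,u)$ be a real random variable (one-stage cost of agent $n$). For a stationary policy $\pi:\mathcal X\to\mathcal U$ let $\{x^\pi_t\}$ be the Markov chain with transition probabilities $p^{\pi(i)}_{i,j}$, and put $$V^\pi_i=\limsup_{T\to\infty}\mathbb E\Big[\tfrac1N\sum_{n=1}^N\sum_{t=0}^T\gamma^t c_n(x^\pi_t,\pi(x^\pi_t))\,\Big|\,x^\pi_0=i\Big],\qquad V^*_i=\inf_\pi V^\pi_i .$$ On a probability space with filtration $\{\mathcal F_t\}_{t\ge0}$ let $\{\mathbf x_t\}$, $\{\mathbf u_t\}$ be $\mathcal X$- and $\mathcal U$-valued processes, let $c_n(\mathbf x_t,\mathbf u_t)$ denote the cost incurred by agent $n$ at time $t$, and let $G_t$ be random undirected simple graphs on the agents, with Laplacians $L_t$ and neighbourhoods $\Omega_n(t)$. Assume: (M.1) $\mathbf x_t,\mathbf u_t$ are $\mathcal F_t$-measurable and $c_n(\mathbf x_t,\mathbf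 u_t)$ is $\mathcal F_{t+1}$-measurable; $\mathbb P(\mathbf x_{t+1}=j\mid\mathcal F_t)=p^{\mathbf u_t}_{\mathbf x_t,j}$; for each $n$, on $\{\mathbf x_t=i,\mathbf u_t=u\}$ the conditional law of $c_n(\mathbf x_t,\mathbf u_t)$ given $\mathcal F_t$ is the law of $c_n(i,u)$; and for some $\varepsilon_1>0$, $\mathbb E|c_n(i,u)|^{2+\varepsilon_1}<\infty$ for all $n,i,u$. (M.2) $\{L_t\}$ is i.i.d., $L_t$ is $\mathcal F_{t+1}$-measurable and independent of $\mathcal F_t$, and $\lambda_2(\mathbb E[L_t])>0$, where $\lambda_2$ is the second smallest eigenvalue. (M.3) For each $t$ and $n$, $L_t$ and $c_n(\mathbf x_t,\mathbf u_t)$ are conditionally independent given $(\mathbf x_t,\mathbf u_t)$. (M.4) For all $(i,u)$ and $k\ge0$, the time $T_{i,u}(k)=\inf\{t\ge0:\sum_{s=0}^t\mathbb I_{(\mathbf x_s,\mathbf u_s)=(i,u)}=k+1\}$ of the $(k+1)$-th visit to $(i,u)$ is a.s. finite. (M.5) $1/2<\tau_1\le1$ and $0<\tau_2<\tau_1-1/(2+\varepsilon_1)$.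 Let $a,b>0$. Set $\alpha_{i,u}(t)=a/(k+1)^{\tau_1}$ and $\beta_{i,u}(t)=b/(k+1)^{\tau_2}$ if $t=T_{i,u}(k)$ for some $k\ge 0$, and $\alpha_{i,u}(t)=\beta_{i,u}(t)=0$ otherwise. Starting from arbitrary $\mathcal F_0$-measurable $\mathbf Q^n_0\in\mathbb R^{\mathcal X\times\mathcal U}$, the $\mathcal{QD}$-learning iterates are $$Q^n_{i,u}(t+1)=Q^n_{i,u}(t)-\beta_{i,u}(t)\sum_{l\in\Omega_n(t)}\big(Q^n_{i,u}(t)-Q^l_{i,u}(t)\big)+\alpha_{i,u}(t)\Big(c_n(\mathbf x_t,\mathbf u_t)+\gamma\min_{v\in\mathcal U}Q^n_{\mathbf x_{t+1},v}(t)-Q^n_{i,u}(t)\Big),$$ and $V^n_i(t)=\min_{u\in\mathcal U}Q^n_{i,u}(t)$. Then there is a deterministic $\mathbf Q^*\in\mathbb R^{\mathcal X\times\mathcal U}$ such that $\mathbf Q^n_t\to\mathbf Q^*$ a.s. as $t\to\infty$ for every agent $n$; moreover $\min_{u}Q^*_{i,u}=V^*_i$ for every $i\in\mathcal X$, and hence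 $\mathbf V^n_t\to\mathbf V^*$ a.s. for every $n$. -/

import Mathlib

open MeasureTheory ProbabilityTheory Filter Topology

noncomputable section

/-! ### The Markov decision problem -/

section MDP

variable {X U : Type*} [Fintype X] [MeasurableSpace X] [DiscreteMeasurableSpace X]

/-- One-step transition kernel of the state process under the stationary policy `π`. -/
def policyKernel (p : X → U → PMF X) (π : X → U) : Kernel X X :=
  Kernel.ofFunOfCountable fun i => (p i (π i)).toMeasure

instance policyKernel_isMarkov (p : X → U → PMF X) (π : X → U) :
    IsMarkovKernel (policyKernel p π) :=
  ⟨fun i => by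
    change IsProbabilityMeasure (p i (π i)).toMeasure
    infer_instance⟩

/-- Law, on the space of state trajectories, of the homogeneous Markov chain started at `i` and
controlled by the stationary policy `π` (Ionescu-Tulcea). -/
def chainLaw (p : X → U → PMF X) (π : X → U) (i : X) : Measure (ℕ → X) :=
  Kernel.traj (X := fun _ : ℕ => X)
    (fun t => (policyKernel p π).comap
      (fun h : (∀ _ : Finset.Iic t, X) => h ⟨t, Finset.mem_Iic.2 le_rfl⟩)
      (measurable_pi_apply _)) 0 (fun _ => i)

/-- Infinite horizon discounted network-averaged cost of the stationary policy `π` from state `i`.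
Given the trajectory `s`, the cost of agent `n` at time `t` has law
`costLaw n (s t) (π (s t))`, so its expectation is the double integral below. -/
def policyCost {N : ℕ} (p : X → U → PMF X) (costLaw : Fin N → X → U → ProbabilityMeasure ℝ)
    (γ : ℝ) (π : X → U) (i : X) : ℝ :=
  limsup (fun T : ℕ =>
    ∫ s, (1 / (N : ℝ)) * ∑ n : Fin N, ∑ t ∈ Finset.range (T + 1),
      γ ^ t * ∫ c, c ∂(costLaw n (s t) (π (s t)) : Measure ℝ) ∂(chainLaw p π i)) atTop

/-- Optimal infinite horizon discounted cost, over all stationary policies. -/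
def optimalCost {N : ℕ} (p : X → U → PMF X) (costLaw : Fin N → X → U → ProbabilityMeasure ℝ)
    (γ : ℝ) (i : X) : ℝ :=
  ⨅ π : X → U, policyCost p costLaw γ π i

end MDP

/-- Minimum over the (finite) set of controls. -/
def minControl {U : Type*} [Fintype U] [Nonempty U] (q : U → ℝ) : ℝ :=
  Finset.univ.inf' Finset.univ_nonempty q

/-! ### Random communication graphs and their Laplacians -/

section Network

variable {N : ℕ} {Ω : Type*}

open Classical in
/-- The entries of the graph Laplacian (degree matrix minus adjacency matrix). -/
def laplacian (G : SimpleGraph (Fin N)) : Fin N → Fin N → ℝ :=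
  fun n l => G.lapMatrix ℝ n l

/-- The mean Laplacian of a random graph. -/
def meanLaplacian [MeasurableSpace Ω] (μ : Measure Ω) (G : Ω → SimpleGraph (Fin N)) :
    Matrix (Fin N) (Fin N) ℝ :=
  Matrix.of fun n l => ∫ ω, laplacian (G ω) n l ∂μ

theorem meanLaplacian_isHermitian [MeasurableSpace Ω] (μ : Measure Ω)
    (G : Ω → SimpleGraph (Fin N)) : (meanLaplacian μ G).IsHermitian := by
  classical
  ext n l
  simp only [meanLaplacian, Matrix.conjTranspose_apply, Matrix.of_apply, star_trivial]
  congr 1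
  funext ω
  exact ((G ω).isSymm_lapMatrix (R := ℝ)).apply n l

/-- The second smallest eigenvalue `λ₂` of a real symmetric `N × N` matrix, `N ≥ 2`
(`eigenvalues₀` lists the eigenvalues, with multiplicity, in decreasing order). -/
def secondEigenvalue {A : Matrix (Fin N) (Fin N) ℝ} (hA : A.IsHermitian) (hN : 2 ≤ N) : ℝ :=
  hA.eigenvalues₀ ⟨N - 2, by rw [Fintype.card_fin]; omega⟩

end Network

/-! ### Sampling instants, weights and the iteration -/

section Algorithm

variable {X U Ω : Type*} {N : ℕ}

open Classical in
/-- The `(k+1)`-th sampling instant of the state-action pair `(i, v)` (`⊤` if there is none). -/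
def visitTime (x : ℕ → Ω → X) (u : ℕ → Ω → U) (i : X) (v : U) (k : ℕ) (ω : Ω) : ℕ∞ :=
  sInf ((fun t : ℕ => (t : ℕ∞)) ''
    {t : ℕ | ∑ s ∈ Finset.range (t + 1), (if (x s ω, u s ω) = (i, v) then 1 else 0) = k + 1})

open Classical in
/-- The weight `c / (k+1)^τ` if `t` is the `(k+1)`-th sampling instant of `(i, v)` for some `k`
(which is then unique), and `0` otherwise. -/
def weight (x : ℕ → Ω → X) (u : ℕ → Ω → U) (c τ : ℝ) (i : X) (v : U) (t : ℕ) (ω : Ω) : ℝ :=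
  if h : ∃ k : ℕ, (t : ℕ∞) = visitTime x u i v k ω then
    c / ((Nat.find h : ℝ) + 1) ^ τ
  else 0

open Classical in
/-- The distributed `Q`-learning iterates: `qdIterate … Q₀ t ω n i v` is the `(i, v)` entry of the
iterate of agent `n` at time `t`. Here `cost t ω n` is the cost incurred by agent `n` at time `t`,
`a, τ₁` are the parameters of the innovation weights and `b, τ₂` those of the consensus weights. -/
def qdIterate [Fintype U] [Nonempty U] (γ a b τ₁ τ₂ : ℝ)
    (x : ℕ → Ω → X) (u : ℕ → Ω → U) (cost : ℕ → Ω → Fin N → ℝ)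
    (G : ℕ → Ω → SimpleGraph (Fin N)) (Q₀ : Ω → Fin N → X → U → ℝ) :
    ℕ → Ω → Fin N → X → U → ℝ
  | 0 => Q₀
  | t + 1 => fun ω n i v =>
      let Q := qdIterate γ a b τ₁ τ₂ x u cost G Q₀ t ω
      Q n i v
        - weight x u b τ₂ i v t ω *
            ∑ l ∈ Finset.univ.filter (fun l => (G t ω).Adj n l), (Q n i v - Q l i v)
        + weight x u a τ₁ i v t ω *
            (cost t ω n + γ * minControl (fun w => Q n (x (t + 1) ω) w) - Q n i v)

end Algorithm

/-! ### The assumptions -/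

section Assumptions

variable {X U Ω : Type*} [Fintype X] [MeasurableSpace X] [DiscreteMeasurableSpace X]
  [Fintype U] [MeasurableSpace U] [DiscreteMeasurableSpace U] {N : ℕ} {mΩ : MeasurableSpace Ω}

/-- The state, control and cost processes are consistent with the decision problem relative to the
filtration, and the one-stage costs have moments of order `2 + ε`. -/
structure MarkovConsistent (μ : Measure Ω) (F : Filtration ℕ mΩ)
    (p : X → U → PMF X) (costLaw : Fin N → X → U → ProbabilityMeasure ℝ) (ε : ℝ)
    (x : ℕ → Ω → X) (u : ℕ → Ω → U) (cost : ℕ → Ω → Fin N → ℝ) : Prop where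
  state_adapted : ∀ t, Measurable[F t] (x t)
  control_adapted : ∀ t, Measurable[F t] (u t)
  cost_adapted : ∀ t n, Measurable[F (t + 1)] (fun ω => cost t ω n)
  /-- Conditional law of the next state given the past. -/
  transition : ∀ t j, μ⟦x (t + 1) ⁻¹' {j} | F t⟧ =ᵐ[μ] fun ω => (p (x t ω) (u t ω) j).toReal
  /-- Given the past, the cost of agent `n` has the law of `c_n(i, v)` where `(i, v)` is the current
  state-action pair. -/
  cost_law : ∀ t n, ∀ B : Set ℝ, MeasurableSet B →
    μ⟦(fun ω => cost t ω n) ⁻¹' B | F t⟧ =ᵐ[μ]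
      fun ω => (costLaw n (x t ω) (u t ω) : Measure ℝ).real B
  eps_pos : 0 < ε
  moment : ∀ n i v, Integrable (fun c : ℝ => |c| ^ (2 + ε)) (costLaw n i v : Measure ℝ)

/-- The Laplacians are i.i.d., adapted with one step delay and independent of the past, and the
graph is connected on average. -/
structure RandomNetwork (hN : 2 ≤ N) (μ : Measure Ω) (F : Filtration ℕ mΩ)
    (G : ℕ → Ω → SimpleGraph (Fin N)) : Prop where
  adapted : ∀ t, Measurable[F (t + 1)] (fun ω => laplacian (G t ω))
  indep_past : ∀ t,
    Indep (MeasurableSpace.comap (fun ω => laplacian (G t ω)) inferInstance) (F t) μ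
  iIndep : iIndepFun (fun t ω => laplacian (G t ω)) μ
  identDistrib : ∀ t,
    IdentDistrib (fun ω => laplacian (G t ω)) (fun ω => laplacian (G 0 ω)) μ μ
  connected_on_average : 0 < secondEigenvalue (meanLaplacian_isHermitian μ (G 0)) hN

/-- At each time the Laplacian and the instantaneous cost of each agent are conditionally
independent given the current state-action pair. -/
def NetworkCostCondIndep (μ : Measure Ω) (x : ℕ → Ω → X) (u : ℕ → Ω → U)
    (cost : ℕ → Ω → Fin N → ℝ) (G : ℕ → Ω → SimpleGraph (Fin N)) : Prop :=
  ∀ t n i v, IndepFun (fun ω => laplacian (G t ω)) (fun ω => cost t ω n)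
    (ProbabilityTheory.cond μ {ω | x t ω = i ∧ u t ω = v})

/-- All sampling instants of all state-action pairs are almost surely finite. -/
def VisitedInfinitelyOften (μ : Measure Ω) (x : ℕ → Ω → X) (u : ℕ → Ω → U) : Prop :=
  ∀ i v k, ∀ᵐ ω ∂μ, visitTime x u i v k ω < ⊤

/-- Conditions on the exponents of the weight sequences. -/
structure StepExponents (ε τ₁ τ₂ : ℝ) : Prop where
  one_half_lt : 1 / 2 < τ₁
  le_one : τ₁ ≤ 1
  pos : 0 < τ₂
  lt : τ₂ < τ₁ - 1 / (2 + ε)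

end Assumptions

end

set_option linter.unusedSectionVars false

/-! ### Graph Laplacians and the consensus step -/

section Laplacian

variable {N : ℕ}

/-! Fix a state-action pair with weights `α` and `β`. Split the innovation of each agent into its
conditional mean `f` (`drift`) and the remainder `w` (`innovationNoise`). The vector of the agents'
iterates then takes a damped consensus step `(1 - α) y - β L y`, driven by `α (f + w)`. The step is
linear, so noise and disagreement can be isolated in auxiliary processes started at zero
(`drivenSequence`), and each of these vanishes by a Robbins-Siegmund argument.

Noise: under martingale differences with bounded conditional variance the squared norm contracts in
mean by `1 - α`, up to an error of order `α ^ 2`. Along the visits `∑ α = ∞` because `τ₁ ≤ 1`, and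
`∑ α ^ 2 < ∞` because `τ₁ > 1 / 2`.

Stability: the conditional variance of `w` is bounded only after division by the running maximum `g`
of the iterates. The process `W` driven by `w / g` vanishes. The difference `Q - g W` sees no noise
except `W` times the increments of `g`; since `γ < 1`, it stays below a constant plus a multiple
less than one of `g`. Hence `g` is bounded (`exists_bound_of_scaled_noise`), and along almost every
trajectory truncation at a high enough level of `g` changes nothing.

Consensus: the disagreement part of the truncated drift is bounded and sums to zero. On such vectors
the mean Laplacian contracts the energy at rate `β`, while the input has relative size `α / β`. For
the power `k + 1` of the energy the error is `β (α / β) ^ (2 k + 2)`, which is summable for large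
`k` as soon as `τ₂ < τ₁` (`AdaptedWeights.tendsto_drivenSequence_of_sum_eq_zero`).

Limit: the Laplacian leaves the network mean alone. Once the noise is removed, the mean performs
asynchronous value iteration for the averaged costs, up to a vanishing error, so the `γ`-contraction
drives it to the fixed point of `bellman` (`tendsto_of_noise_and_disagreement`). Policy evaluation
identifies the minimum of that fixed point with the optimal cost (`minControl_eq_optimalCost`). -/

theorem sum_laplacian_mul (G : SimpleGraph (Fin N)) (y : Fin N → ℝ) (n : Fin N) :
    ∑ l, laplacian G n l * y l
      = ∑ l, open Classical in if G.Adj n l then y n - y l else 0 := by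
  classical
  have h := G.lapMatrix_mulVec_apply (R := ℝ) n y
  simp only [Matrix.mulVec, dotProduct] at h
  have h2 : ∑ l, laplacian G n l * y l = ∑ l, G.lapMatrix ℝ n l * y l := by
    unfold laplacian
    refine Finset.sum_congr rfl fun l _ => ?_
    congr!
  rw [h2, h, ← Finset.sum_filter, Finset.sum_sub_distrib, Finset.sum_const, nsmul_eq_mul,
    ← SimpleGraph.neighborFinset_eq_filter, SimpleGraph.card_neighborFinset_eq_degree]

theorem sum_laplacian_mul_eq_sum_filter (G : SimpleGraph (Fin N)) (y : Fin N → ℝ) (n : Fin N) :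
    ∑ l, laplacian G n l * y l
      = ∑ l ∈ open Classical in Finset.univ.filter (fun l => G.Adj n l), (y n - y l) := by
  rw [sum_laplacian_mul, Finset.sum_filter]

theorem laplacian_comm (G : SimpleGraph (Fin N)) (n l : Fin N) :
    laplacian G n l = laplacian G l n := by
  classical
  exact ((G.isSymm_lapMatrix (R := ℝ)).apply n l).symm

theorem sum_laplacian_right (G : SimpleGraph (Fin N)) (n : Fin N) :
    ∑ l, laplacian G n l = 0 := by
  have := sum_laplacian_mul G (fun _ => 1) n
  simpa using this

theorem sum_laplacian_left (G : SimpleGraph (Fin N)) (l : Fin N) :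
    ∑ n, laplacian G n l = 0 := by
  simp_rw [laplacian_comm G _ l]
  exact sum_laplacian_right G l

theorem abs_laplacian_le (G : SimpleGraph (Fin N)) (n l : Fin N) : |laplacian G n l| ≤ N := by
  classical
  have h := sum_laplacian_mul G (Pi.single l 1) n
  simp only [Pi.single_apply, mul_ite, mul_one, mul_zero, Finset.sum_ite_eq', Finset.mem_univ,
    if_true] at h
  rw [h]
  refine (Finset.abs_sum_le_sum_abs _ _).trans ?_
  calc _ ≤ ∑ _l : Fin N, (1 : ℝ) := by
        refine Finset.sum_le_sum fun k _ => ?_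
        split_ifs <;> norm_num
    _ = N := by simp

/-- The quadratic form of the Laplacian. -/
noncomputable def lapForm (G : SimpleGraph (Fin N)) (y : Fin N → ℝ) : ℝ :=
  ∑ n, ∑ l, laplacian G n l * (y n * y l)

theorem lapForm_eq_sum_mul (G : SimpleGraph (Fin N)) (y : Fin N → ℝ) :
    lapForm G y = ∑ n, y n * ∑ l, laplacian G n l * y l := by
  unfold lapForm
  refine Finset.sum_congr rfl fun n _ => ?_
  rw [Finset.mul_sum]
  exact Finset.sum_congr rfl fun l _ => by ring

open Classical in
theorem two_mul_lapForm (G : SimpleGraph (Fin N)) (y : Fin N → ℝ) :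
    2 * lapForm G y = ∑ n, ∑ l, if G.Adj n l then (y n - y l) ^ 2 else 0 := by
  have h1 : lapForm G y = ∑ n, ∑ l, if G.Adj n l then y n * (y n - y l) else 0 := by
    rw [lapForm_eq_sum_mul]
    refine Finset.sum_congr rfl fun n _ => ?_
    rw [sum_laplacian_mul, Finset.mul_sum]
    exact Finset.sum_congr rfl fun l _ => by split_ifs <;> simp
  have h2 : lapForm G y = ∑ n, ∑ l, if G.Adj n l then y l * (y l - y n) else 0 := by
    rw [h1, Finset.sum_comm]
    simp_rw [G.adj_comm]
  rw [two_mul]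
  nth_rewrite 1 [h1]
  rw [h2, ← Finset.sum_add_distrib]
  refine Finset.sum_congr rfl fun n _ => ?_
  rw [← Finset.sum_add_distrib]
  refine Finset.sum_congr rfl fun l _ => ?_
  split_ifs <;> ring

theorem lapForm_nonneg (G : SimpleGraph (Fin N)) (y : Fin N → ℝ) : 0 ≤ lapForm G y := by
  classical
  have h := two_mul_lapForm G y
  have : 0 ≤ ∑ n, ∑ l, if G.Adj n l then (y n - y l) ^ 2 else 0 :=
    Finset.sum_nonneg fun n _ => Finset.sum_nonneg fun l _ => by split_ifs <;> positivity
  linarith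

/-- Cauchy-Schwarz in each row, i.e. `L ^ 2 ≤ 2 N L` as quadratic forms. This lets the first-order
dissipation `β L` absorb the second-order term `β ^ 2 L ^ 2` when `N β` is small. -/
theorem sum_sq_laplacian_mul_le (G : SimpleGraph (Fin N)) (y : Fin N → ℝ) :
    ∑ n, (∑ l, laplacian G n l * y l) ^ 2 ≤ 2 * N * lapForm G y := by
  classical
  have : 2 * (N : ℝ) * lapForm G y
      = ∑ n : Fin N, N * ∑ l, if G.Adj n l then (y n - y l) ^ 2 else 0 := by
    rw [← Finset.mul_sum, ← two_mul_lapForm]; ring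
  rw [this]
  refine Finset.sum_le_sum fun n _ => ?_
  rw [sum_laplacian_mul]
  refine (sq_sum_le_card_mul_sum_sq).trans ?_
  simp only [Finset.card_univ, Fintype.card_fin]
  gcongr with l _
  split_ifs <;> simp

/-- One consensus step with a damping term. -/
noncomputable def consensusStep (α β : ℝ) (G : SimpleGraph (Fin N)) (y : Fin N → ℝ) (n : Fin N) :
    ℝ :=
  (1 - α) * y n - β * ∑ l, laplacian G n l * y l

/-- The coefficients of the step are nonnegative when `α + N β ≤ 1`, and they sum to `1 - α`. This
sup-norm contraction holds for every graph and needs no connectivity. -/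
theorem abs_consensusStep_le {α β : ℝ} (hβ : 0 ≤ β) (hαβ : α + N * β ≤ 1)
    (G : SimpleGraph (Fin N)) {y : Fin N → ℝ} {B : ℝ} (hy : ∀ n, |y n| ≤ B) (n : Fin N) :
    |consensusStep α β G y n| ≤ (1 - α) * B := by
  classical
  have key : consensusStep α β G y n
      = (1 - α - ∑ l, if G.Adj n l then β else 0) * y n
        + ∑ l, if G.Adj n l then β * y l else 0 := by
    unfold consensusStep
    have hsplit : β * ∑ l, (if G.Adj n l then y n - y l else 0)
        = (∑ l, if G.Adj n l then β else 0) * y n - ∑ l, if G.Adj n l then β * y l else 0 := by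
      rw [Finset.mul_sum, Finset.sum_mul, ← Finset.sum_sub_distrib]
      refine Finset.sum_congr rfl fun l _ => ?_
      split_ifs <;> ring
    rw [sum_laplacian_mul, hsplit]
    ring
  have hs : ∑ l, (if G.Adj n l then β else 0) ≤ N * β := by
    calc _ ≤ ∑ _l : Fin N, β := Finset.sum_le_sum fun l _ => by split_ifs <;> simp [hβ]
      _ = N * β := by simp
  have h2 : |∑ l, if G.Adj n l then β * y l else 0| ≤ (∑ l, if G.Adj n l then β else 0) * B := by
    rw [Finset.sum_mul]
    refine (Finset.abs_sum_le_sum_abs _ _).trans (Finset.sum_le_sum fun l _ => ?_)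
    split_ifs
    · rw [abs_mul, abs_of_nonneg hβ]; exact mul_le_mul_of_nonneg_left (hy l) hβ
    · simp
  rw [key]
  refine (abs_add_le _ _).trans ?_
  rw [abs_mul, abs_of_nonneg (a := 1 - α - _) (by linarith)]
  have := mul_le_mul_of_nonneg_left (hy n)
    (show 0 ≤ 1 - α - ∑ l, (if G.Adj n l then β else 0) by linarith)
  linarith

theorem consensusStep_sub (α β : ℝ) (G : SimpleGraph (Fin N)) (y z : Fin N → ℝ) (n : Fin N) :
    consensusStep α β G (fun k => y k - z k) n
      = consensusStep α β G y n - consensusStep α β G z n := by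
  simp only [consensusStep, mul_sub, Finset.sum_sub_distrib]
  ring

theorem consensusStep_mul (α β c : ℝ) (G : SimpleGraph (Fin N)) (y : Fin N → ℝ) (n : Fin N) :
    consensusStep α β G (fun k => c * y k) n = c * consensusStep α β G y n := by
  simp only [consensusStep, mul_left_comm _ c, ← Finset.mul_sum]
  ring

theorem sum_consensusStep (α β : ℝ) (G : SimpleGraph (Fin N)) (y : Fin N → ℝ) :
    ∑ n, consensusStep α β G y n = (1 - α) * ∑ n, y n := by
  simp only [consensusStep, Finset.sum_sub_distrib, ← Finset.mul_sum]
  rw [Finset.sum_comm]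
  simp [← Finset.sum_mul, sum_laplacian_left]

theorem consensusStep_const (α β c : ℝ) (G : SimpleGraph (Fin N)) (n : Fin N) :
    consensusStep α β G (fun _ => c) n = (1 - α) * c := by
  simp [consensusStep, ← Finset.sum_mul, sum_laplacian_right]

theorem sum_sq_consensusStep (α β : ℝ) (G : SimpleGraph (Fin N)) (y : Fin N → ℝ) :
    ∑ n, consensusStep α β G y n ^ 2 = (1 - α) ^ 2 * ∑ n, y n ^ 2
      - 2 * (1 - α) * β * lapForm G y + β ^ 2 * ∑ n, (∑ l, laplacian G n l * y l) ^ 2 := by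
  rw [lapForm_eq_sum_mul]
  simp only [Finset.mul_sum (s := Finset.univ) (f := fun n : Fin N => _ ^ 2),
    Finset.mul_sum (s := Finset.univ) (f := fun n : Fin N => y n * _), ← Finset.sum_sub_distrib,
    ← Finset.sum_add_distrib]
  refine Finset.sum_congr rfl fun n _ => ?_
  rw [consensusStep]
  ring

/-- Energy decay of a consensus step. -/
theorem sum_sq_consensusStep_le {α β : ℝ} (hα : 0 ≤ α) (hα' : α ≤ 1 / 4) (hβ : 0 ≤ β)
    (hβ' : N * β ≤ 1 / 4) (G : SimpleGraph (Fin N)) (y : Fin N → ℝ) :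
    ∑ n, consensusStep α β G y n ^ 2 ≤ ∑ n, y n ^ 2 - β * lapForm G y := by
  rw [sum_sq_consensusStep]
  have h1 := sum_sq_laplacian_mul_le G y
  have h2 := lapForm_nonneg G y
  have h3 : 0 ≤ ∑ n, y n ^ 2 := Finset.sum_nonneg fun n _ => sq_nonneg _
  have h4 : (1 - α) ^ 2 ≤ 1 := by nlinarith
  have h5 := mul_le_mul_of_nonneg_right h4 h3
  have h6 := mul_le_mul_of_nonneg_left h1 (sq_nonneg β)
  have h7 : 0 ≤ β * lapForm G y * (2 * (1 - α) - 2 * (N * β) - 1) :=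
    mul_nonneg (mul_nonneg hβ h2) (by linarith)
  nlinarith

/-- Energy of a consensus step perturbed by noise; the cross term between the noise and the random
graph is absorbed by the dissipation. -/
theorem sum_sq_consensusStep_add_le {α β : ℝ} (hα' : α ≤ 1 / 4) (hβ : 0 ≤ β)
    (hβ' : N * β ≤ 1 / 4) (G : SimpleGraph (Fin N)) (y w : Fin N → ℝ) :
    ∑ n, (consensusStep α β G y n + α * w n) ^ 2 ≤ (1 - α) ^ 2 * ∑ n, y n ^ 2
      + 2 * (1 - α) * α * ∑ n, y n * w n + 2 * α ^ 2 * ∑ n, w n ^ 2 := by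
  have h1 := sum_sq_laplacian_mul_le G y
  have h2 := lapForm_nonneg G y
  have key : ∑ n, (consensusStep α β G y n + α * w n) ^ 2 ≤
      ∑ n, (consensusStep α β G y n ^ 2 + 2 * (1 - α) * α * (y n * w n) + 2 * α ^ 2 * w n ^ 2
        + β ^ 2 * (∑ l, laplacian G n l * y l) ^ 2) := by
    refine Finset.sum_le_sum fun n _ => ?_
    -- Completing the square bounds the cross term `-2 α β w (L y)` by `(α w) ^ 2 + (β L y) ^ 2`;
    -- hence the factor `2` in front of `α ^ 2`.
    have := sq_nonneg (α * w n + β * ∑ l, laplacian G n l * y l)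
    have e : consensusStep α β G y n = (1 - α) * y n - β * ∑ l, laplacian G n l * y l := rfl
    have e' : 2 * α * w n * consensusStep α β G y n = 2 * (1 - α) * α * (y n * w n)
        - 2 * (α * w n) * (β * ∑ l, laplacian G n l * y l) := by rw [e]; ring
    nlinarith
  refine key.trans ?_
  simp only [Finset.sum_add_distrib, ← Finset.mul_sum]
  rw [sum_sq_consensusStep]
  have h6 := mul_le_mul_of_nonneg_left h1 (sq_nonneg β)
  -- Two copies of `β ^ 2 |L y| ^ 2` cost `4 N β ^ 2` times the form, and `4 N β ≤ 1 ≤ 2 (1 - α)`.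
  have h7 : 0 ≤ β * lapForm G y * (2 * (1 - α) - 4 * (N * β)) :=
    mul_nonneg (mul_nonneg hβ h2) (by linarith)
  nlinarith

end Laplacian

/-! ### Spectral gap on the disagreement subspace -/

section Spectral

open Matrix

/-- Expand in an eigenbasis. The constant vector lies in the kernel, hence is orthogonal to every
eigenvector with positive eigenvalue; as `λ₂ > 0`, it is carried by the last one alone. A vector
with zero sum therefore has no component there, and all other eigenvalues are at least `λ₂`. -/
theorem secondEigenvalue_mul_sum_sq_le {N : ℕ} (hN : 2 ≤ N) {A : Matrix (Fin N) (Fin N) ℝ}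
    (hA : A.IsHermitian) (hker : A *ᵥ (fun _ => 1) = 0) (hpos : 0 < secondEigenvalue hA hN)
    (y : Fin N → ℝ) (hy : ∑ n, y n = 0) :
    secondEigenvalue hA hN * ∑ n, y n ^ 2 ≤ y ⬝ᵥ (A *ᵥ y) := by
  set b := hA.eigenvectorBasis with hb
  set lam := hA.eigenvalues with hlam
  let toE : (Fin N → ℝ) → EuclideanSpace ℝ (Fin N) := WithLp.toLp 2
  have hin : ∀ v w : Fin N → ℝ, inner ℝ (toE v) (toE w) = v ⬝ᵥ w := by
    intro v w
    simp [toE, EuclideanSpace.inner_eq_star_dotProduct, dotProduct_comm]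
  have hbA : ∀ j v, inner ℝ (b j) (toE (A *ᵥ v)) = lam j * inner ℝ (b j) (toE v) := by
    intro j v
    have e : b j = toE (b j).ofLp := rfl
    rw [e, hin, hin, dotProduct_mulVec, ← mulVec_transpose]
    have : Aᵀ = A := by simpa [Matrix.IsHermitian, conjTranspose_eq_transpose_of_trivial] using hA
    rw [this, hA.mulVec_eigenvectorBasis j, smul_dotProduct, smul_eq_mul]
  have hform : y ⬝ᵥ (A *ᵥ y) = ∑ j, lam j * (inner ℝ (b j) (toE y)) ^ 2 := by
    rw [← hin, ← b.sum_inner_mul_inner]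
    refine Finset.sum_congr rfl fun j _ => ?_
    rw [hbA, real_inner_comm]; ring
  have hnorm : ∑ n, y n ^ 2 = ∑ j, (inner ℝ (b j) (toE y)) ^ 2 := by
    have : ∑ n, y n ^ 2 = y ⬝ᵥ y := by simp [dotProduct, sq]
    rw [this, ← hin, ← b.sum_inner_mul_inner]
    refine Finset.sum_congr rfl fun j _ => ?_
    rw [real_inner_comm]; ring
  let e : Fin (Fintype.card (Fin N)) ≃ Fin N := Fintype.equivOfCardEq (Fintype.card_fin _)
  have hcard : Fintype.card (Fin N) = N := Fintype.card_fin N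
  -- `eigenvalues₀` is decreasing: index `N - 1` carries the smallest eigenvalue, and `N - 2` the
  -- second smallest.
  let last : Fin N := e ⟨N - 1, by omega⟩
  have hge : ∀ j, j ≠ last → secondEigenvalue hA hN ≤ lam j := by
    intro j hj
    change _ ≤ hA.eigenvalues₀ (e.symm j)
    refine hA.eigenvalues₀_antitone ?_
    have h1 : e.symm j ≠ ⟨N - 1, by omega⟩ := fun h => hj (by simp [last, ← h])
    have h2 : ((e.symm j : Fin _) : ℕ) ≠ N - 1 := fun h => h1 (Fin.ext h)
    have h3 := (e.symm j).2
    rw [Fin.le_def]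
    simp only
    omega
  have hone : ∀ j, j ≠ last → inner ℝ (b j) (toE fun _ => 1) = 0 := by
    intro j hj
    have h := hbA j (fun _ => 1)
    rw [hker] at h
    have h0 : inner ℝ (b j) (toE 0) = 0 := by
      have : toE 0 = 0 := rfl
      rw [this, inner_zero_right]
    rw [h0] at h
    have := (hpos.trans_le (hge j hj)).ne'
    exact (mul_eq_zero.1 h.symm).resolve_left this
  have hlast : inner ℝ (b last) (toE y) = 0 := by
    have h1 : inner ℝ (toE fun _ => 1) (toE y) = 0 := by
      rw [hin]; simpa [dotProduct] using hy
    rw [← b.sum_inner_mul_inner, Finset.sum_eq_single last] at h1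
    -- If the last component of the constant vector vanished as well, that vector would be zero,
    -- which `2 ≤ N` excludes.
    · refine (mul_eq_zero.1 h1).resolve_left fun h => ?_
      have h2 : inner ℝ (toE fun _ => 1) (toE fun _ => 1) = 0 := by
        rw [← b.sum_inner_mul_inner]
        refine Finset.sum_eq_zero fun j _ => ?_
        by_cases hj : j = last
        · rw [hj, h, zero_mul]
        · rw [hone j hj, mul_zero]
      rw [hin] at h2
      simp [dotProduct] at h2
      omega
    · intro j _ hj
      rw [real_inner_comm, hone j hj, zero_mul]
    · simp
  rw [hform, hnorm, Finset.mul_sum]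
  refine Finset.sum_le_sum fun j _ => ?_
  by_cases hj : j = last
  · rw [hj, hlast]; simp
  · exact mul_le_mul_of_nonneg_right (hge j hj) (sq_nonneg _)

end Spectral

/-! ### Almost supermartingales -/

section Deterministic

/-- The partial sums of `c v` increase and stay bounded, so they converge, and hence so does `v`. A
positive limit of `v` would make those sums diverge along with `∑ c`. -/
theorem tendsto_zero_of_tendsto_add_sum {v c : ℕ → ℝ} (hv : ∀ t, 0 ≤ v t) (hc : ∀ t, 0 ≤ c t)
    (hdiv : Tendsto (fun T => ∑ t ∈ Finset.range T, c t) atTop atTop) {l : ℝ}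
    (h : Tendsto (fun T => v T + ∑ t ∈ Finset.range T, c t * v t) atTop (𝓝 l)) :
    Tendsto v atTop (𝓝 0) := by
  set S : ℕ → ℝ := fun T => ∑ t ∈ Finset.range T, c t * v t with hS
  have hmono : Monotone S := monotone_nat_of_le_succ fun T => by
    simp only [hS, Finset.sum_range_succ]
    linarith [mul_nonneg (hc T) (hv T)]
  obtain ⟨B, hB⟩ := h.bddAbove_range
  have hSB : BddAbove (Set.range S) := ⟨B, by
    rintro _ ⟨T, rfl⟩
    have := hB ⟨T, rfl⟩
    simp only at this
    linarith [hv T]⟩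
  have hSl := tendsto_atTop_ciSup hmono hSB
  have hvl : Tendsto v atTop (𝓝 (l - ⨆ T, S T)) := by
    refine (h.sub hSl).congr fun T => ?_
    simp [hS]
  have hnn : 0 ≤ l - ⨆ T, S T := ge_of_tendsto' hvl hv
  rcases hnn.eq_or_lt with h0 | h0
  · rwa [← h0] at hvl
  exfalso
  set d := l - ⨆ T, S T
  obtain ⟨t₀, ht₀⟩ := eventually_atTop.1 (hvl.eventually (lt_mem_nhds (half_lt_self h0)))
  have hbig : Tendsto (fun T => S t₀ + d / 2 * (∑ t ∈ Finset.range T, c t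
      - ∑ t ∈ Finset.range t₀, c t)) atTop atTop :=
    tendsto_atTop_add_const_left _ _
      ((tendsto_atTop_add_const_right _ _ hdiv).const_mul_atTop (by positivity))
  have hle : ∀ T ≥ t₀, S t₀ + d / 2 * (∑ t ∈ Finset.range T, c t
      - ∑ t ∈ Finset.range t₀, c t) ≤ S T := by
    intro T hT
    induction T, hT using Nat.le_induction with
    | base => simp
    | succ T hT ih =>
      simp only [hS, Finset.sum_range_succ] at ih ⊢
      have := mul_le_mul_of_nonneg_left (ht₀ T hT).le (hc T)
      linarith
  have : Tendsto S atTop atTop := tendsto_atTop_mono' _ (eventually_atTop.2 ⟨t₀, hle⟩) hbig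
  exact not_tendsto_nhds_of_tendsto_atTop this _ hSl

end Deterministic

section RobbinsSiegmund

variable {Ω : Type*} {mΩ : MeasurableSpace Ω} {μ : Measure Ω} [IsProbabilityMeasure μ]
  {F : Filtration ℕ mΩ}

/-- A version of the Robbins-Siegmund theorem. -/
theorem tendsto_zero_of_almost_supermartingale {V c b : ℕ → Ω → ℝ} {B : ℝ}
    (hV : ∀ t, StronglyMeasurable[F t] (V t)) (hVi : ∀ t, Integrable (V t) μ)
    (hV0 : ∀ t ω, 0 ≤ V t ω)
    (hc : ∀ t, StronglyMeasurable[F t] (c t)) (hc0 : ∀ t ω, 0 ≤ c t ω) (hc1 : ∀ t ω, c t ω ≤ 1)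
    (hb : ∀ t, StronglyMeasurable[F t] (b t)) (hb0 : ∀ t ω, 0 ≤ b t ω)
    (hB : ∀ T ω, ∑ t ∈ Finset.range T, b t ω ≤ B)
    (hstep : ∀ t, μ[V (t + 1) | F t] ≤ᵐ[μ] fun ω => (1 - c t ω) * V t ω + b t ω)
    (hdiv : ∀ᵐ ω ∂μ, Tendsto (fun T => ∑ t ∈ Finset.range T, c t ω) atTop atTop) :
    ∀ᵐ ω ∂μ, Tendsto (fun t => V t ω) atTop (𝓝 0) := by
  have hbi : ∀ t, Integrable (b t) μ := fun t =>
    Integrable.of_bound ((hb t).mono (F.le t)).aestronglyMeasurable B (ae_of_all _ fun ω => by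
      rw [Real.norm_of_nonneg (hb0 t ω)]
      have := hB (t + 1) ω
      rw [Finset.sum_range_succ] at this
      linarith [Finset.sum_nonneg fun s (_ : s ∈ Finset.range t) => hb0 s ω])
  have hcVi : ∀ t, Integrable (fun ω => c t ω * V t ω) μ := fun t =>
    (hVi t).bdd_mul (c := 1) ((hc t).mono (F.le t)).aestronglyMeasurable (ae_of_all _ fun ω => by
      rw [Real.norm_of_nonneg (hc0 t ω)]; exact hc1 t ω)
  -- Adding the accumulated decrease and subtracting the accumulated error turns `V` into a
  -- supermartingale bounded below by `-B`.
  let M : ℕ → Ω → ℝ := fun t ω => V t ω + (∑ s ∈ Finset.range t, c s ω * V s ω)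
    - ∑ s ∈ Finset.range t, b s ω
  have hMmeas : StronglyAdapted F M := fun t => by
    refine ((hV t).add (Finset.stronglyMeasurable_fun_sum _ fun s hs => ?_)).sub
      (Finset.stronglyMeasurable_fun_sum _ fun s hs => ?_)
    · have hst := F.mono (Finset.mem_range.1 hs).le
      exact ((hc s).mono hst).mul ((hV s).mono hst)
    · exact (hb s).mono (F.mono (Finset.mem_range.1 hs).le)
  have hMi : ∀ t, Integrable (M t) μ := fun t =>
    ((hVi t).add (integrable_finsetSum _ fun s _ => hcVi s)).sub
      (integrable_finsetSum _ fun s _ => hbi s)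
  have hsuper : Supermartingale M F μ := by
    refine supermartingale_nat hMmeas hMi fun t => ?_
    have hrest : StronglyMeasurable[F t] (fun ω => (∑ s ∈ Finset.range (t + 1), c s ω * V s ω)
        - ∑ s ∈ Finset.range (t + 1), b s ω) := by
      refine (Finset.stronglyMeasurable_fun_sum _ fun s hs => ?_).sub
        (Finset.stronglyMeasurable_fun_sum _ fun s hs => ?_)
      · have hst := F.mono (Nat.lt_succ_iff.1 (Finset.mem_range.1 hs))
        exact ((hc s).mono hst).mul ((hV s).mono hst)
      · exact (hb s).mono (F.mono (Nat.lt_succ_iff.1 (Finset.mem_range.1 hs)))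
    have hresti : Integrable (fun ω => (∑ s ∈ Finset.range (t + 1), c s ω * V s ω)
        - ∑ s ∈ Finset.range (t + 1), b s ω) μ :=
      (integrable_finsetSum _ fun s _ => hcVi s).sub (integrable_finsetSum _ fun s _ => hbi s)
    have he : M (t + 1) = V (t + 1) + fun ω => (∑ s ∈ Finset.range (t + 1), c s ω * V s ω)
        - ∑ s ∈ Finset.range (t + 1), b s ω := by
      funext ω; simp only [M, Pi.add_apply]; ring
    rw [he]
    filter_upwards [condExp_add (hVi (t + 1)) hresti (F t), hstep t] with ω h1 h2
    rw [h1, Pi.add_apply, condExp_of_stronglyMeasurable (F.le t) hrest hresti]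
    simp only [M, Finset.sum_range_succ]
    linarith
  have hMlow : ∀ t ω, -B ≤ M t ω := fun t ω => by
    have := Finset.sum_nonneg fun s (_ : s ∈ Finset.range t) => mul_nonneg (hc0 s ω) (hV0 s ω)
    simp only [M]
    linarith [hB t ω, hV0 t ω]
  have hB0 : ∀ ω : Ω, 0 ≤ B := fun ω => by simpa using hB 0 ω
  have hint : ∀ t, ∫ ω, |M t ω| ∂μ ≤ ∫ ω, M 0 ω ∂μ + 2 * B := by
    intro t
    -- From `M ≥ -B` follows `|M| ≤ M + 2 B`, so decreasing expectations give an `L¹` bound.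
    have h1 : ∫ ω, |M t ω| ∂μ ≤ ∫ ω, (M t ω + 2 * B) ∂μ := by
      refine integral_mono (hMi t).abs ((hMi t).add (integrable_const _)) fun ω => ?_
      have := hMlow t ω
      have := hB0 ω
      simp only
      rw [abs_le]
      constructor <;> linarith
    rw [integral_add (hMi t) (integrable_const _)] at h1
    have h2 := hsuper.setIntegral_le (Nat.zero_le t) (s := Set.univ) MeasurableSet.univ
    simp only [Measure.restrict_univ] at h2
    simp only [integral_const, probReal_univ, one_smul] at h1
    linarith
  have hconv := (hsuper.neg).exists_ae_tendsto_of_bdd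
    (R := (∫ ω, M 0 ω ∂μ + 2 * B).toNNReal) fun t => by
      rw [eLpNorm_one_eq_lintegral_enorm]
      have : ∫⁻ ω, ‖(-M) t ω‖ₑ ∂μ = ENNReal.ofReal (∫ ω, |M t ω| ∂μ) := by
        rw [ofReal_integral_eq_lintegral_ofReal (hMi t).abs (ae_of_all _ fun ω => abs_nonneg _)]
        refine lintegral_congr fun ω => ?_
        simp [Real.enorm_eq_ofReal_abs]
      rw [this]
      exact ENNReal.ofReal_le_ofReal (hint t)
  filter_upwards [hconv, hdiv] with ω ⟨l, hω⟩ hdω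
  have hbm : Monotone fun T => ∑ t ∈ Finset.range T, b t ω := monotone_nat_of_le_succ fun T => by
    rw [Finset.sum_range_succ]; linarith [hb0 T ω]
  have hbl := tendsto_atTop_ciSup hbm ⟨B, by rintro _ ⟨T, rfl⟩; exact hB T ω⟩
  refine tendsto_zero_of_tendsto_add_sum (fun t => hV0 t ω) (fun t => hc0 t ω) hdω
    ((hω.neg.add hbl).congr fun T => ?_)
  simp [M]

end RobbinsSiegmund

/-! ### Damped consensus driven by martingale differences -/

section DrivenSequence

variable {Ω : Type*} {mΩ : MeasurableSpace Ω} {μ : Measure Ω} [IsProbabilityMeasure μ]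
  {F : Filtration ℕ mΩ} {N : ℕ}

/-- Finite sums of a known factor times a fresh variable cover every conditional expectation
computed below: both energy estimates and the centring of the noise. -/
theorem condExp_add_sum_mul {ι : Type*} [Fintype ι] {m : MeasurableSpace Ω} (hm : m ≤ mΩ)
    {A : Ω → ℝ} {f g : ι → Ω → ℝ} (hA : StronglyMeasurable[m] A) (hAi : Integrable A μ)
    (hf : ∀ i, StronglyMeasurable[m] (f i)) (hg : ∀ i, Integrable (g i) μ)
    (hfg : ∀ i, Integrable (fun ω => f i ω * g i ω) μ) :
    μ[fun ω => A ω + ∑ i, f i ω * g i ω | m]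
      =ᵐ[μ] fun ω => A ω + ∑ i, f i ω * (μ[g i | m]) ω := by
  have he : (fun ω => A ω + ∑ i, f i ω * g i ω) = A + ∑ i, f i * g i := by
    funext ω; simp
  have h3 : ∀ᵐ ω ∂μ, ∀ i, (μ[f i * g i | m]) ω = f i ω * (μ[g i | m]) ω :=
    ae_all_iff.2 fun i => condExp_mul_of_stronglyMeasurable_left (hf i) (hfg i) (hg i)
  rw [he]
  have hsum : Integrable (∑ i, f i * g i) μ := integrable_finsetSum' _ fun i _ => hfg i
  filter_upwards [condExp_add hAi hsum m,
    condExp_finsetSum (s := Finset.univ) (f := fun i => f i * g i) (fun i _ => hfg i) m, h3]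
    with ω h1 h2 h3
  rw [h1, Pi.add_apply, h2, condExp_of_stronglyMeasurable hm hA hAi, Finset.sum_apply]
  simp [h3]

/-- The process started from zero, driven by `φ` through damped consensus steps. -/
noncomputable def drivenSequence (α β : ℕ → Ω → ℝ) (G : ℕ → Ω → SimpleGraph (Fin N))
    (φ : ℕ → Ω → Fin N → ℝ) : ℕ → Ω → Fin N → ℝ
  | 0 => fun _ _ => 0
  | t + 1 => fun ω n =>
      consensusStep (α t ω) (β t ω) (G t ω) (drivenSequence α β G φ t ω) n + α t ω * φ t ω n

/-- Adapted small weights and adapted graphs. -/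
structure AdaptedWeights (F : Filtration ℕ mΩ) (α β : ℕ → Ω → ℝ)
    (G : ℕ → Ω → SimpleGraph (Fin N)) : Prop where
  meas_innovation : ∀ t, Measurable[F t] (α t)
  meas_consensus : ∀ t, Measurable[F t] (β t)
  nonneg_innovation : ∀ t ω, 0 ≤ α t ω
  nonneg_consensus : ∀ t ω, 0 ≤ β t ω
  innovation_le : ∀ t ω, α t ω ≤ 1 / 4
  consensus_le : ∀ t ω, N * β t ω ≤ 1 / 4
  meas_graph : ∀ t n l, Measurable[F (t + 1)] (fun ω => laplacian (G t ω) n l)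

variable {α β : ℕ → Ω → ℝ} {G : ℕ → Ω → SimpleGraph (Fin N)} {φ : ℕ → Ω → Fin N → ℝ}

theorem measurable_consensusStep {m : MeasurableSpace Ω} {a b : Ω → ℝ}
    {H : Ω → SimpleGraph (Fin N)} {y : Ω → Fin N → ℝ} (ha : Measurable a) (hb : Measurable b)
    (hH : ∀ n l, Measurable (fun ω => laplacian (H ω) n l)) (hy : ∀ n, Measurable fun ω => y ω n)
    (n : Fin N) : Measurable fun ω => consensusStep (a ω) (b ω) (H ω) (y ω) n :=
  ((measurable_const.sub ha).mul (hy n)).sub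
    (hb.mul (Finset.measurable_fun_sum _ fun l _ => (hH n l).mul (hy l)))

theorem AdaptedWeights.measurable_drivenSequence (h : AdaptedWeights F α β G)
    (hφ : ∀ t n, Measurable[F (t + 1)] (fun ω => φ t ω n)) (t : ℕ) (n : Fin N) :
    Measurable[F t] (fun ω => drivenSequence α β G φ t ω n) := by
  induction t generalizing n with
  | zero => exact measurable_const
  | succ t ih =>
    have hα : Measurable[F (t + 1)] (α t) := (h.meas_innovation t).mono (F.mono t.le_succ) le_rfl
    have hβ : Measurable[F (t + 1)] (β t) := (h.meas_consensus t).mono (F.mono t.le_succ) le_rfl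
    exact (measurable_consensusStep hα hβ (h.meas_graph t)
      (fun k => (ih k).mono (F.mono t.le_succ) le_rfl) n).add (hα.mul (hφ t n))

theorem AdaptedWeights.abs_drivenSequence_le (h : AdaptedWeights F α β G) {ρ : ℝ} (hρ : 0 ≤ ρ)
    (hφ : ∀ t ω n, |φ t ω n| ≤ ρ) (t : ℕ) (ω : Ω) (n : Fin N) :
    |drivenSequence α β G φ t ω n| ≤ ρ := by
  induction t generalizing n with
  | zero => simpa [drivenSequence] using hρ
  | succ t ih =>
    have h1 := abs_consensusStep_le (h.nonneg_consensus t ω)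
      (by linarith [h.innovation_le t ω, h.consensus_le t ω] :
        α t ω + N * β t ω ≤ 1) (G t ω) ih n
    have h2 : |α t ω * φ t ω n| ≤ α t ω * ρ := by
      rw [abs_mul, abs_of_nonneg (h.nonneg_innovation t ω)]
      exact mul_le_mul_of_nonneg_left (hφ t ω n) (h.nonneg_innovation t ω)
    exact (abs_add_le _ _).trans (by linarith)

theorem sum_drivenSequence_eq_zero (hφ : ∀ t ω, ∑ n, φ t ω n = 0) (t : ℕ) (ω : Ω) :
    ∑ n, drivenSequence α β G φ t ω n = 0 := by
  induction t with
  | zero => simp [drivenSequence]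
  | succ t ih =>
    simp only [drivenSequence, Finset.sum_add_distrib, sum_consensusStep, ih, ← Finset.mul_sum, hφ]
    simp

/-- The consensus process driven by square integrable martingale differences vanishes
asymptotically. -/
theorem AdaptedWeights.tendsto_drivenSequence_of_martingale_difference
    (h : AdaptedWeights F α β G) {B C : ℝ} (hB : ∀ T ω, ∑ t ∈ Finset.range T, α t ω ^ 2 ≤ B)
    (hdiv : ∀ᵐ ω ∂μ, Tendsto (fun T => ∑ t ∈ Finset.range T, α t ω) atTop atTop)
    (hφ : ∀ t n, Measurable[F (t + 1)] (fun ω => φ t ω n))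
    (hφi : ∀ t n, Integrable (fun ω => φ t ω n ^ 2) μ)
    (hmean : ∀ t n, μ[fun ω => φ t ω n | F t] =ᵐ[μ] 0) (hC : 0 ≤ C)
    (hvar : ∀ t n, μ[fun ω => φ t ω n ^ 2 | F t] ≤ᵐ[μ] fun _ => C) :
    ∀ᵐ ω ∂μ, ∀ n, Tendsto (fun t => drivenSequence α β G φ t ω n) atTop (𝓝 0) := by
  set Y := drivenSequence α β G φ with hY
  set V : ℕ → Ω → ℝ := fun t ω => ∑ n, Y t ω n ^ 2 with hV
  have hYm : ∀ t n, Measurable[F t] (fun ω => Y t ω n) := h.measurable_drivenSequence hφ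
  have hVm : ∀ t, StronglyMeasurable[F t] (V t) := fun t =>
    (Finset.measurable_fun_sum _ fun n _ => (hYm t n).pow_const 2).stronglyMeasurable
  have hV0 : ∀ t ω, 0 ≤ V t ω := fun t ω => Finset.sum_nonneg fun n _ => sq_nonneg _
  have hα1 : ∀ t ω, α t ω ^ 2 ≤ 1 := fun t ω => by
    nlinarith [h.nonneg_innovation t ω, h.innovation_le t ω]
  have hstep : ∀ t ω, V (t + 1) ω ≤ (1 - α t ω) ^ 2 * V t ω
      + 2 * (1 - α t ω) * α t ω * ∑ n, Y t ω n * φ t ω n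
      + 2 * α t ω ^ 2 * ∑ n, φ t ω n ^ 2 := fun t ω =>
    sum_sq_consensusStep_add_le (h.innovation_le t ω) (h.nonneg_consensus t ω)
      (h.consensus_le t ω) (G t ω) (Y t ω) (φ t ω)
  -- Square integrability propagates by induction through the pathwise energy inequality, with crude
  -- constants.
  have hYsq : ∀ t n, Integrable (fun ω => Y t ω n ^ 2) μ := by
    intro t
    induction t with
    | zero => intro n; simp [hY, drivenSequence]
    | succ t ih =>
      intro n
      have hi : Integrable (fun ω => 2 * ∑ k, Y t ω k ^ 2 + 3 * ∑ k, φ t ω k ^ 2) μ :=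
        ((integrable_finsetSum _ fun k _ => ih k).const_mul 2).add
          ((integrable_finsetSum _ fun k _ => hφi t k).const_mul 3)
      refine hi.mono' (((hYm (t + 1) n).pow_const 2).mono (F.le _) le_rfl).aestronglyMeasurable
        (ae_of_all _ fun ω => ?_)
      rw [Real.norm_of_nonneg (sq_nonneg _)]
      refine (Finset.single_le_sum (f := fun n => Y (t + 1) ω n ^ 2) (fun n _ => sq_nonneg _)
        (Finset.mem_univ n)).trans ((hstep t ω).trans ?_)
      have hα0 := h.nonneg_innovation t ω
      have hα4 := h.innovation_le t ω
      have h1 : 2 * (1 - α t ω) * α t ω * ∑ n, Y t ω n * φ t ω n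
          ≤ ∑ k, Y t ω k ^ 2 + ∑ k, φ t ω k ^ 2 := by
        rw [Finset.mul_sum, ← Finset.sum_add_distrib]
        refine Finset.sum_le_sum fun k _ => ?_
        have hc0 : 0 ≤ (1 - α t ω) * α t ω := mul_nonneg (by linarith) hα0
        have hc1 : (1 - α t ω) * α t ω ≤ 1 := by nlinarith
        nlinarith [sq_nonneg (Y t ω k - φ t ω k), sq_nonneg (Y t ω k), sq_nonneg (φ t ω k),
          mul_nonneg hc0 (sq_nonneg (Y t ω k - φ t ω k)),
          mul_nonneg (sub_nonneg.2 hc1) (add_nonneg (sq_nonneg (Y t ω k)) (sq_nonneg (φ t ω k)))]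
      have h2 : (1 - α t ω) ^ 2 * V t ω ≤ 1 * V t ω :=
        mul_le_mul_of_nonneg_right (by nlinarith) (hV0 t ω)
      have h3 : α t ω ^ 2 * ∑ k, φ t ω k ^ 2 ≤ 1 * ∑ k, φ t ω k ^ 2 :=
        mul_le_mul_of_nonneg_right (hα1 t ω) (Finset.sum_nonneg fun _ _ => sq_nonneg _)
      simp only [hV] at h2 ⊢
      linarith
  have hVi : ∀ t, Integrable (V t) μ := fun t => integrable_finsetSum _ fun n _ => hYsq t n
  have hφ' : ∀ t n, AEStronglyMeasurable (fun ω => φ t ω n) μ := fun t n =>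
    ((hφ t n).mono (F.le _) le_rfl).aestronglyMeasurable
  have hY' : ∀ t n, AEStronglyMeasurable (fun ω => Y t ω n) μ := fun t n =>
    ((hYm t n).mono (F.le _) le_rfl).aestronglyMeasurable
  have hα' : ∀ t, Measurable (α t) := fun t => (h.meas_innovation t).mono (F.le _) le_rfl
  have hφ1 : ∀ t n, Integrable (fun ω => φ t ω n) μ := fun t n =>
    ((memLp_two_iff_integrable_sq (hφ' t n)).2 (hφi t n)).integrable one_le_two
  have hYφ : ∀ t n, Integrable (fun ω => Y t ω n * φ t ω n) μ := fun t n =>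
    ((memLp_two_iff_integrable_sq (hY' t n)).2 (hYsq t n)).integrable_mul
      ((memLp_two_iff_integrable_sq (hφ' t n)).2 (hφi t n))
  have hVzero := tendsto_zero_of_almost_supermartingale (μ := μ) (F := F) (V := V) (c := α)
    (b := fun t ω => 2 * N * C * α t ω ^ 2) (B := 2 * N * C * B) hVm hVi hV0
    (fun t => (h.meas_innovation t).stronglyMeasurable) h.nonneg_innovation
    (fun t ω => (h.innovation_le t ω).trans (by norm_num))
    (fun t => (((h.meas_innovation t).pow_const 2).const_mul _).stronglyMeasurable)
    (fun t ω => by positivity)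
    (fun T ω => by
      rw [← Finset.mul_sum]
      exact mul_le_mul_of_nonneg_left (hB T ω) (by positivity)) (fun t => ?_) hdiv
  · filter_upwards [hVzero] with ω hω n
    have h1 : Tendsto (fun t => Y t ω n ^ 2) atTop (𝓝 0) :=
      squeeze_zero (fun t => sq_nonneg _) (fun t => Finset.single_le_sum
        (f := fun n => Y t ω n ^ 2) (fun n _ => sq_nonneg _) (Finset.mem_univ n)) hω
    have h2 := h1.sqrt
    simp only [Real.sqrt_sq_eq_abs, Real.sqrt_zero] at h2
    exact (tendsto_zero_iff_abs_tendsto_zero _).2 h2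
  -- The left summand indexes the terms linear in the noise, which have conditional mean zero; the
  -- right one indexes the quadratic terms, bounded by `C`.
  · let f : Fin N ⊕ Fin N → Ω → ℝ := Sum.elim
      (fun n ω => 2 * (1 - α t ω) * α t ω * Y t ω n) (fun _ ω => 2 * α t ω ^ 2)
    let g : Fin N ⊕ Fin N → Ω → ℝ := Sum.elim (fun n ω => φ t ω n) (fun n ω => φ t ω n ^ 2)
    have hαt := h.meas_innovation t
    have hcoef : Measurable[F t] fun ω => 2 * (1 - α t ω) * α t ω :=
      ((measurable_const.sub hαt).const_mul 2).mul hαt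
    have hbd1 : ∀ ω, ‖2 * (1 - α t ω) * α t ω‖ ≤ 2 := fun ω => by
      have := h.nonneg_innovation t ω
      have := h.innovation_le t ω
      rw [Real.norm_eq_abs, abs_le]
      constructor <;> nlinarith
    have hbd2 : ∀ ω, ‖2 * α t ω ^ 2‖ ≤ 2 := fun ω => by
      rw [Real.norm_of_nonneg (by positivity)]; linarith [hα1 t ω]
    have hfg : ∀ i, Integrable (fun ω => f i ω * g i ω) μ := by
      rintro (n | n)
      · refine ((hYφ t n).bdd_mul (c := 2)
          (hcoef.mono (F.le t) le_rfl).aestronglyMeasurable (ae_of_all _ hbd1)).congr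
          (ae_of_all _ fun ω => ?_)
        simp only [f, g, Sum.elim_inl]; ring
      · exact (hφi t n).bdd_mul (c := 2)
          (((hα' t).pow_const 2).const_mul 2).aestronglyMeasurable (ae_of_all _ hbd2)
    have hf : ∀ i, StronglyMeasurable[F t] (f i) := by
      rintro (n | n)
      · exact (hcoef.mul (hYm t n)).stronglyMeasurable
      · exact ((hαt.pow_const 2).const_mul 2).stronglyMeasurable
    have hg : ∀ i, Integrable (g i) μ := by
      rintro (n | n)
      · exact hφ1 t n
      · exact hφi t n
    have hA : StronglyMeasurable[F t] fun ω => (1 - α t ω) ^ 2 * V t ω :=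
      (((measurable_const.sub hαt).pow_const 2).mul (hVm t).measurable).stronglyMeasurable
    have hAi : Integrable (fun ω => (1 - α t ω) ^ 2 * V t ω) μ :=
      (hVi t).bdd_mul (c := 1) ((measurable_const.sub (hα' t)).pow_const 2).aestronglyMeasurable
        (ae_of_all _ fun ω => by
          have := h.nonneg_innovation t ω
          have := h.innovation_le t ω
          rw [Real.norm_of_nonneg (sq_nonneg _)]
          nlinarith)
    have hmono : μ[V (t + 1) | F t]
        ≤ᵐ[μ] μ[fun ω => (1 - α t ω) ^ 2 * V t ω + ∑ i, f i ω * g i ω | F t] := by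
      refine condExp_mono (hVi _) (hAi.add (integrable_finsetSum _ fun i _ => hfg i))
        (ae_of_all _ fun ω => (hstep t ω).trans (le_of_eq ?_))
      simp only [f, g, Fintype.sum_sum_type, Sum.elim_inl, Sum.elim_inr, Finset.mul_sum]
      rw [add_assoc]
      congr 2
      exact Finset.sum_congr rfl fun n _ => by ring
    have hm := ae_all_iff.2 (hmean t)
    have hv := ae_all_iff.2 (hvar t)
    filter_upwards [hmono, condExp_add_sum_mul (F.le t) hA hAi hf hg hfg, hm, hv]
      with ω h1 h2 h3 h4
    rw [h2] at h1
    refine h1.trans ?_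
    simp only [Fintype.sum_sum_type, Sum.elim_inl, Sum.elim_inr, f, g]
    have h5 : ∀ n, (μ[fun ω => φ t ω n | F t]) ω = 0 := h3
    simp only [h5, mul_zero, Finset.sum_const_zero, zero_add]
    have h6 : ∑ n, 2 * α t ω ^ 2 * (μ[fun ω => φ t ω n ^ 2 | F t]) ω
        ≤ ∑ _n : Fin N, 2 * α t ω ^ 2 * C :=
      Finset.sum_le_sum fun n _ => mul_le_mul_of_nonneg_left (h4 n) (by positivity)
    simp only [Finset.sum_const, Finset.card_univ, Fintype.card_fin, nsmul_eq_mul] at h6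
    -- Half of the available contraction is given up: `(1 - α) ^ 2 ≤ 1 - α`.
    have h7 : (1 - α t ω) ^ 2 * V t ω ≤ (1 - α t ω) * V t ω := by
      refine mul_le_mul_of_nonneg_right ?_ (hV0 t ω)
      nlinarith [h.nonneg_innovation t ω, h.innovation_le t ω]
    linarith

end DrivenSequence

/-! ### Weighted power inequalities -/

section PowerInequalities

/-- Convexity of the power at `x + y = (1 - θ) (x / (1 - θ)) + θ (y / θ)`. -/
theorem add_pow_succ_le_div_add_div {x y θ : ℝ} (hx : 0 ≤ x) (hy : 0 ≤ y) (hθ0 : 0 < θ)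
    (hθ1 : θ < 1) (k : ℕ) :
    (x + y) ^ (k + 1) ≤ x ^ (k + 1) / (1 - θ) ^ k + y ^ (k + 1) / θ ^ k := by
  have h1 : 0 < 1 - θ := by linarith
  have h := (convexOn_pow (𝕜 := ℝ) (k + 1)).2 (Set.mem_Ici.2 (div_nonneg hx h1.le))
    (Set.mem_Ici.2 (div_nonneg hy hθ0.le)) h1.le hθ0.le (by ring)
  simp only [smul_eq_mul] at h
  rw [mul_div_cancel₀ _ h1.ne', mul_div_cancel₀ _ hθ0.ne'] at h
  refine h.trans (le_of_eq ?_)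
  rw [div_pow, div_pow, pow_succ (1 - θ), pow_succ θ]
  field_simp

/-- The splitting is used twice with the same `θ`: on each square, then on the power `k + 1` of the
sum. The exponents add up to `(k + 1) + k`. -/
theorem sum_add_mul_sq_pow_le {N : ℕ} (s φ : Fin N → ℝ) {α ρ θ : ℝ} (hφ : ∀ n, |φ n| ≤ ρ)
    (hθ0 : 0 < θ) (hθ1 : θ < 1) (k : ℕ) :
    (∑ n, (s n + α * φ n) ^ 2) ^ (k + 1) ≤ (∑ n, s n ^ 2) ^ (k + 1) / (1 - θ) ^ (2 * k + 1)
      + (α ^ 2 * (N * ρ ^ 2)) ^ (k + 1) / θ ^ (2 * k + 1) := by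
  have h1 : 0 < 1 - θ := by linarith
  have hs : ∑ n, (s n + α * φ n) ^ 2 ≤ (∑ n, s n ^ 2) / (1 - θ) + α ^ 2 * (N * ρ ^ 2) / θ := by
    have : α ^ 2 * (N * ρ ^ 2) / θ = ∑ _n : Fin N, α ^ 2 * ρ ^ 2 / θ := by
      simp only [Finset.sum_const, Finset.card_univ, Fintype.card_fin, nsmul_eq_mul]; ring
    rw [this, Finset.sum_div, ← Finset.sum_add_distrib]
    refine Finset.sum_le_sum fun n _ => ?_
    have h2 := add_pow_succ_le_div_add_div (abs_nonneg (s n)) (abs_nonneg (α * φ n)) hθ0 hθ1 1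
    simp only [Nat.reduceAdd, pow_one, sq_abs] at h2
    have h3 : (s n + α * φ n) ^ 2 ≤ (|s n| + |α * φ n|) ^ 2 := by
      rw [← sq_abs (s n + α * φ n)]
      exact pow_le_pow_left₀ (abs_nonneg _) (abs_add_le _ _) 2
    refine h3.trans (h2.trans ?_)
    gcongr
    rw [mul_pow]
    exact mul_le_mul_of_nonneg_left (sq_le_sq.2 ((hφ n).trans (le_abs_self ρ))) (sq_nonneg _)
  have h0 : 0 ≤ ∑ n, s n ^ 2 := Finset.sum_nonneg fun n _ => sq_nonneg _
  have hq : 0 ≤ α ^ 2 * (N * ρ ^ 2) := by positivity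
  refine (pow_le_pow_left₀ (Finset.sum_nonneg fun n _ => sq_nonneg _) hs _).trans
    ((add_pow_succ_le_div_add_div (div_nonneg h0 h1.le) (div_nonneg hq hθ0.le)
      hθ0 hθ1 k).trans (le_of_eq ?_))
  rw [div_pow, div_pow, div_div, div_div, ← pow_add, ← pow_add]
  congr 3 <;> ring

end PowerInequalities

/-! ### Decay of disagreement under bounded inputs -/

section Consensus

variable {Ω : Type*} {mΩ : MeasurableSpace Ω} {μ : Measure Ω} [IsProbabilityMeasure μ]
  {F : Filtration ℕ mΩ} {N : ℕ}
  {α β : ℕ → Ω → ℝ} {G : ℕ → Ω → SimpleGraph (Fin N)} {φ : ℕ → Ω → Fin N → ℝ}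

/-- Taking `θ = c b` makes the loss `(1 - c b) ^ (2 k + 1)` comparable with the dissipation and
turns the input into `b (a / b) ^ (2 k + 2)`. Only one factor of the energy is improved by the
Laplacian form; the other `k` are merely nonincreasing. The bound thus stays linear in the random
graph and can be averaged. -/
theorem consensusStep_add_energy_pow_le {a b : ℝ} (ha : 0 ≤ a) (ha' : a ≤ 1 / 4) (hb : 0 ≤ b)
    (hb' : N * b ≤ 1 / 4) (hab : b = 0 → a = 0) (H : SimpleGraph (Fin N)) (y w : Fin N → ℝ)
    {ρ c : ℝ} (hw : ∀ n, |w n| ≤ ρ) (hc : 0 < c) (hcb : c * b < 1) (k : ℕ) :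
    (∑ n, (consensusStep a b H y n + a * w n) ^ 2) ^ (k + 1)
      ≤ ((∑ n, y n ^ 2) ^ (k + 1) - b * (∑ n, y n ^ 2) ^ k * lapForm H y)
          / (1 - c * b) ^ (2 * k + 1)
        + (N * ρ ^ 2) ^ (k + 1) / c ^ (2 * k + 1) * (b * (a / b) ^ (2 * k + 2)) := by
  have hy0 : 0 ≤ ∑ n, y n ^ 2 := Finset.sum_nonneg fun n _ => sq_nonneg _
  rcases hb.eq_or_lt with h0 | h0
  · obtain rfl := h0.symm
    obtain rfl := hab rfl
    simp [consensusStep]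
  have hθ : 0 < c * b := mul_pos hc h0
  refine (sum_add_mul_sq_pow_le _ w hw hθ hcb k).trans (add_le_add ?_ (le_of_eq ?_))
  · have h1 : 0 ≤ 1 - c * b := by linarith
    gcongr
    have hle := sum_sq_consensusStep_le ha ha' hb hb' H y
    have hz0 : 0 ≤ ∑ n, consensusStep a b H y n ^ 2 := Finset.sum_nonneg fun n _ => sq_nonneg _
    have hle' : ∑ n, consensusStep a b H y n ^ 2 ≤ ∑ n, y n ^ 2 :=
      hle.trans (by linarith [mul_nonneg hb (lapForm_nonneg H y)])
    calc (∑ n, consensusStep a b H y n ^ 2) ^ (k + 1)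
        = (∑ n, consensusStep a b H y n ^ 2) ^ k * ∑ n, consensusStep a b H y n ^ 2 := pow_succ _ _
      _ ≤ (∑ n, y n ^ 2) ^ k * (∑ n, y n ^ 2 - b * lapForm H y) :=
          mul_le_mul (pow_le_pow_left₀ hz0 hle' k) hle hz0 (pow_nonneg hy0 k)
      _ = _ := by ring
  · rw [mul_pow, mul_pow c b, div_pow, ← pow_mul]
    field_simp
    ring

/-- Processes in the disagreement subspace, driven by bounded inputs, vanish asymptotically when
the innovation weights are small compared with the consensus weights. -/
theorem AdaptedWeights.tendsto_drivenSequence_of_sum_eq_zero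
    (h : AdaptedWeights F α β G) (hαβ : ∀ t ω, β t ω = 0 → α t ω = 0) {B κ ρ : ℝ} (k : ℕ)
    (hB : ∀ T ω, ∑ t ∈ Finset.range T, β t ω * (α t ω / β t ω) ^ (2 * k + 2) ≤ B)
    (hdiv : ∀ᵐ ω ∂μ, Tendsto (fun T => ∑ t ∈ Finset.range T, β t ω) atTop atTop)
    (hN : 0 < N) (hκ0 : 0 < κ) (hκ1 : κ ≤ 1) {Lbar : Fin N → Fin N → ℝ}
    (hL : ∀ t n l, μ[fun ω => laplacian (G t ω) n l | F t] =ᵐ[μ] fun _ => Lbar n l)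
    (hgap : ∀ y : Fin N → ℝ, ∑ n, y n = 0 →
      κ * ∑ n, y n ^ 2 ≤ ∑ n, ∑ l, Lbar n l * (y n * y l))
    (hρ : 0 ≤ ρ) (hφ : ∀ t n, Measurable[F t] (fun ω => φ t ω n))
    (hφρ : ∀ t ω n, |φ t ω n| ≤ ρ) (hφ0 : ∀ t ω, ∑ n, φ t ω n = 0) :
    ∀ᵐ ω ∂μ, ∀ n, Tendsto (fun t => drivenSequence α β G φ t ω n) atTop (𝓝 0) := by
  set Y := drivenSequence α β G φ with hY
  have hYm : ∀ t n, Measurable[F t] (fun ω => Y t ω n) :=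
    h.measurable_drivenSequence fun t n => (hφ t n).mono (F.mono t.le_succ) le_rfl
  have hYb : ∀ t ω n, |Y t ω n| ≤ ρ := h.abs_drivenSequence_le hρ hφρ
  have hY0 : ∀ t ω, ∑ n, Y t ω n = 0 := sum_drivenSequence_eq_zero hφ0
  set S : ℕ → Ω → ℝ := fun t ω => ∑ n, Y t ω n ^ 2 with hS
  have hSm : ∀ t, Measurable[F t] (S t) := fun t =>
    Finset.measurable_fun_sum _ fun n _ => (hYm t n).pow_const 2
  have hS0 : ∀ t ω, 0 ≤ S t ω := fun t ω => Finset.sum_nonneg fun n _ => sq_nonneg _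
  have hSb : ∀ t ω, S t ω ≤ N * ρ ^ 2 := fun t ω => by
    calc S t ω ≤ ∑ _n : Fin N, ρ ^ 2 := Finset.sum_le_sum fun n _ =>
          sq_le_sq.2 ((hYb t ω n).trans (le_abs_self ρ))
      _ = N * ρ ^ 2 := by simp
  have hβ4 : ∀ t ω, β t ω ≤ 1 / 4 := fun t ω => by
    have h1 : (1 : ℝ) ≤ N := by exact_mod_cast hN
    nlinarith [h.consensus_le t ω, h.nonneg_consensus t ω]
  -- With this `c`, Bernoulli gives `1 - κ β ≤ (1 - c β) ^ (2 k + 2)`. Dividing by the loss `(1 - c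
  -- β) ^ (2 k + 1)` leaves a net contraction `1 - c β`.
  set c : ℝ := κ / (2 * k + 2) with hc
  have hk0 : (0 : ℝ) < 2 * k + 2 := by positivity
  have hc0 : 0 < c := by positivity
  have hcκ : (2 * k + 2) * c = κ := by rw [hc]; field_simp
  have hc1 : c ≤ 1 / 2 := by
    rw [hc, div_le_iff₀ hk0]
    have : (0 : ℝ) ≤ k := Nat.cast_nonneg k
    linarith
  have hcβ : ∀ t ω, c * β t ω ≤ 1 / 2 := fun t ω => by
    nlinarith [hβ4 t ω, h.nonneg_consensus t ω]
  set K : ℝ := (N * ρ ^ 2) ^ (k + 1) / c ^ (2 * k + 1) with hK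
  have hK0 : 0 ≤ K := by positivity
  have hcαdiv : ∀ᵐ ω ∂μ, Tendsto (fun T => ∑ t ∈ Finset.range T, c * β t ω) atTop atTop := by
    filter_upwards [hdiv] with ω hω
    simp_rw [← Finset.mul_sum]
    exact hω.const_mul_atTop hc0
  have hVi : ∀ t, Integrable (fun ω => S t ω ^ (k + 1)) μ := fun t =>
    Integrable.of_bound (((hSm t).pow_const _).mono (F.le t) le_rfl).aestronglyMeasurable
      ((N * ρ ^ 2) ^ (k + 1)) (ae_of_all _ fun ω => by
        rw [Real.norm_of_nonneg (pow_nonneg (hS0 t ω) _)]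
        exact pow_le_pow_left₀ (hS0 t ω) (hSb t ω) _)
  have hVzero := tendsto_zero_of_almost_supermartingale (μ := μ) (F := F)
    (V := fun t ω => S t ω ^ (k + 1)) (c := fun t ω => c * β t ω)
    (b := fun t ω => K * (β t ω * (α t ω / β t ω) ^ (2 * k + 2))) (B := K * B)
    (fun t => ((hSm t).pow_const _).stronglyMeasurable) hVi
    (fun t ω => pow_nonneg (hS0 t ω) _)
    (fun t => ((h.meas_consensus t).const_mul c).stronglyMeasurable)
    (fun t ω => mul_nonneg hc0.le (h.nonneg_consensus t ω))
    (fun t ω => (hcβ t ω).trans (by norm_num))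
    (fun t => (((h.meas_consensus t).mul
      (((h.meas_innovation t).div (h.meas_consensus t)).pow_const _)).const_mul
        K).stronglyMeasurable)
    (fun t ω => by
      have := h.nonneg_consensus t ω
      have := h.nonneg_innovation t ω
      positivity)
    (fun T ω => by
      rw [← Finset.mul_sum]
      exact mul_le_mul_of_nonneg_left (hB T ω) hK0) (fun t => ?_) hcαdiv
  · filter_upwards [hVzero] with ω hω n
    have h1 : Tendsto (fun t => |Y t ω n| ^ (2 * (k + 1))) atTop (𝓝 0) := by
      refine squeeze_zero (fun t => by positivity) (fun t => ?_) hω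
      rw [pow_mul, sq_abs]
      exact pow_le_pow_left₀ (sq_nonneg _) (Finset.single_le_sum (f := fun n => Y t ω n ^ 2)
        (fun n _ => sq_nonneg _) (Finset.mem_univ n)) _
    refine (tendsto_zero_iff_abs_tendsto_zero _).2 ?_
    have h2 := h1.rpow_const (p := ((2 * (k + 1) : ℕ) : ℝ)⁻¹) (Or.inr (by positivity))
    rw [Real.zero_rpow (by positivity)] at h2
    refine h2.congr fun t => ?_
    exact Real.pow_rpow_inv_natCast (abs_nonneg _) (by omega)
  · have hβm := h.meas_consensus t
    have hαm := h.meas_innovation t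
    let D : Ω → ℝ := fun ω => ((1 - c * β t ω) ^ (2 * k + 1))⁻¹
    have hDm : Measurable[F t] D :=
      ((measurable_const.sub (hβm.const_mul c)).pow_const _).inv
    have hD0 : ∀ ω, 0 ≤ D ω := fun ω => by
      have := hcβ t ω
      exact inv_nonneg.2 (pow_nonneg (by linarith) _)
    have hDb : ∀ ω, D ω ≤ ((1 / 2 : ℝ) ^ (2 * k + 1))⁻¹ := fun ω => by
      have := hcβ t ω
      exact inv_anti₀ (by positivity) (pow_le_pow_left₀ (by norm_num) (by linarith) _)
    let R : Ω → ℝ := fun ω => K * (β t ω * (α t ω / β t ω) ^ (2 * k + 2))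
    let A : Ω → ℝ := fun ω => D ω * S t ω ^ (k + 1) + R ω
    have hRm : Measurable[F t] R := (hβm.mul ((hαm.div hβm).pow_const _)).const_mul K
    have hR0 : ∀ t ω, 0 ≤ β t ω * (α t ω / β t ω) ^ (2 * k + 2) := fun t ω => by
      have := h.nonneg_consensus t ω
      have := h.nonneg_innovation t ω
      positivity
    have hRi : Integrable R μ := by
      refine (Integrable.of_bound (((hβm.mul ((hαm.div hβm).pow_const (2 * k + 2))).mono (F.le t)
        le_rfl).aestronglyMeasurable) B (ae_of_all _ fun ω => ?_)).const_mul K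
      simp only [Pi.mul_apply, Pi.div_apply]
      rw [Real.norm_of_nonneg (hR0 t ω)]
      have := hB (t + 1) ω
      rw [Finset.sum_range_succ] at this
      linarith [Finset.sum_nonneg fun s (_ : s ∈ Finset.range t) => hR0 s ω]
    have hAm : StronglyMeasurable[F t] A :=
      ((hDm.mul ((hSm t).pow_const _)).add hRm).stronglyMeasurable
    have hDi : Integrable (fun ω => D ω * S t ω ^ (k + 1)) μ :=
      (hVi t).bdd_mul (c := ((1 / 2 : ℝ) ^ (2 * k + 1))⁻¹)
        (hDm.mono (F.le t) le_rfl).aestronglyMeasurable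
        (ae_of_all _ fun ω => by rw [Real.norm_of_nonneg (hD0 ω)]; exact hDb ω)
    have hAi : Integrable A μ := hDi.add hRi
    -- The dissipation is a combination of Laplacian entries with coefficients known at time `t`, so
    -- conditioning replaces each entry by `Lbar`.
    let f : Fin N × Fin N → Ω → ℝ := fun nl ω =>
      -(D ω * (β t ω * S t ω ^ k)) * (Y t ω nl.1 * Y t ω nl.2)
    let g : Fin N × Fin N → Ω → ℝ := fun nl ω => laplacian (G t ω) nl.1 nl.2
    have hfm : ∀ i, Measurable[F t] (f i) := fun i =>
      ((hDm.mul (hβm.mul ((hSm t).pow_const k))).neg).mul ((hYm t i.1).mul (hYm t i.2))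
    have hfb : ∀ i ω, ‖f i ω‖ ≤ ((1 / 2 : ℝ) ^ (2 * k + 1))⁻¹ * (1 / 4 * (N * ρ ^ 2) ^ k)
        * (ρ * ρ) := fun i ω => by
      simp only [f, norm_mul, norm_neg, Real.norm_eq_abs, abs_of_nonneg (hD0 ω),
        abs_of_nonneg (h.nonneg_consensus t ω), abs_of_nonneg (pow_nonneg (hS0 t ω) k)]
      have := h.nonneg_consensus t ω
      have := pow_nonneg (hS0 t ω) k
      gcongr
      · exact hDb ω
      · exact hβ4 t ω
      · exact hSb t ω
      · exact hYb t ω _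
      · exact hYb t ω _
    have hgi : ∀ i, Integrable (g i) μ := fun i =>
      Integrable.of_bound ((h.meas_graph t i.1 i.2).mono (F.le _) le_rfl).aestronglyMeasurable N
        (ae_of_all _ fun ω => abs_laplacian_le _ _ _)
    have hfg : ∀ i, Integrable (fun ω => f i ω * g i ω) μ := fun i =>
      (hgi i).bdd_mul ((hfm i).mono (F.le t) le_rfl).aestronglyMeasurable (ae_of_all _ (hfb i))
    have hmono : μ[fun ω => S (t + 1) ω ^ (k + 1) | F t]
        ≤ᵐ[μ] μ[fun ω => A ω + ∑ i, f i ω * g i ω | F t] := by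
      refine condExp_mono (hVi _) (hAi.add (integrable_finsetSum _ fun i _ => hfg i))
        (ae_of_all _ fun ω => ?_)
      refine (consensusStep_add_energy_pow_le (h.nonneg_innovation t ω) (h.innovation_le t ω)
        (h.nonneg_consensus t ω) (h.consensus_le t ω) (hαβ t ω) (G t ω) (Y t ω) (φ t ω)
        (hφρ t ω) hc0 ((hcβ t ω).trans_lt (by norm_num)) k).trans (le_of_eq ?_)
      have : ∑ i, f i ω * g i ω = -(D ω * (β t ω * S t ω ^ k)) * lapForm (G t ω) (Y t ω) := by
        rw [lapForm, Finset.mul_sum, Fintype.sum_prod_type]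
        refine Finset.sum_congr rfl fun n _ => ?_
        rw [Finset.mul_sum]
        exact Finset.sum_congr rfl fun l _ => by simp only [f, g]; ring
      simp only
      rw [this, div_eq_mul_inv]
      simp only [A, R, D, hS, hK]
      ring
    have hLae : ∀ᵐ ω ∂μ, ∀ i : Fin N × Fin N, (μ[g i | F t]) ω = Lbar i.1 i.2 :=
      ae_all_iff.2 fun i => hL t i.1 i.2
    filter_upwards [hmono, condExp_add_sum_mul (F.le t) hAm hAi
      (fun i => (hfm i).stronglyMeasurable) hgi hfg, hLae] with ω h1 h2 h3
    rw [h2] at h1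
    refine h1.trans ?_
    simp only [h3]
    have hform : ∑ i, f i ω * Lbar i.1 i.2
        = -(D ω * (β t ω * S t ω ^ k)) * ∑ n, ∑ l, Lbar n l * (Y t ω n * Y t ω l) := by
      rw [Finset.mul_sum, Fintype.sum_prod_type]
      refine Finset.sum_congr rfl fun n _ => ?_
      rw [Finset.mul_sum]
      exact Finset.sum_congr rfl fun l _ => by simp only [f]; ring
    rw [hform]
    have hq := hgap (Y t ω) (hY0 t ω)
    have hnn : 0 ≤ D ω * (β t ω * S t ω ^ k) :=
      mul_nonneg (hD0 ω) (mul_nonneg (h.nonneg_consensus t ω) (pow_nonneg (hS0 t ω) k))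
    have h4 := mul_le_mul_of_nonneg_left hq hnn
    have h5 : D ω * (1 - κ * β t ω) ≤ 1 - c * β t ω := by
      have hpos : 0 < 1 - c * β t ω := by linarith [hcβ t ω]
      have hb := one_add_mul_le_pow (a := -(c * β t ω)) (by linarith [hcβ t ω]) (2 * k + 2)
      have hb' : 1 - κ * β t ω ≤ (1 - c * β t ω) ^ (2 * k + 2) := by
        rw [← hcκ, sub_eq_add_neg 1 (c * β t ω)]
        refine le_trans (le_of_eq ?_) hb
        push_cast
        ring
      calc D ω * (1 - κ * β t ω) ≤ D ω * (1 - c * β t ω) ^ (2 * k + 2) :=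
            mul_le_mul_of_nonneg_left hb' (hD0 ω)
        _ = 1 - c * β t ω := by
          simp only [D]
          rw [show 2 * k + 2 = (2 * k + 1) + 1 by ring, pow_succ (1 - c * β t ω) (2 * k + 1)]
          field_simp
    have h6 := mul_le_mul_of_nonneg_right h5 (pow_nonneg (hS0 t ω) (k + 1))
    have h7 : D ω * (1 - κ * β t ω) * S t ω ^ (k + 1)
        = D ω * S t ω ^ (k + 1) - D ω * (β t ω * S t ω ^ k) * (κ * ∑ n, Y t ω n ^ 2) := by
      simp only [hS]; ring
    simp only [A, R]
    linarith

end Consensus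

/-! ### Minimization over controls -/

section MinControl

variable {U : Type*} [Fintype U] [Nonempty U]

theorem minControl_le (q : U → ℝ) (v : U) : minControl q ≤ q v :=
  Finset.inf'_le _ (Finset.mem_univ v)

theorem exists_eq_minControl (q : U → ℝ) : ∃ v, q v = minControl q := by
  obtain ⟨v, _, hv⟩ := Finset.exists_mem_eq_inf' (s := Finset.univ) Finset.univ_nonempty q
  exact ⟨v, hv.symm⟩

theorem abs_minControl_sub_le {q q' : U → ℝ} {B : ℝ} (h : ∀ v, |q v - q' v| ≤ B) :
    |minControl q - minControl q'| ≤ B := by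
  obtain ⟨v, hv⟩ := exists_eq_minControl q
  obtain ⟨v', hv'⟩ := exists_eq_minControl q'
  have h1 := abs_le.1 (h v)
  have h2 := abs_le.1 (h v')
  have h3 := minControl_le q v'
  have h4 := minControl_le q' v
  rw [abs_le]
  constructor <;> linarith

theorem abs_minControl_le {q : U → ℝ} {B : ℝ} (h : ∀ v, |q v| ≤ B) : |minControl q| ≤ B := by
  obtain ⟨v, hv⟩ := exists_eq_minControl q
  rw [← hv]
  exact h v

theorem continuous_minControl : Continuous (minControl : (U → ℝ) → ℝ) :=
  Continuous.finset_inf'_apply _ fun v _ => continuous_apply v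

end MinControl

/-! ### Averages under a finite probability vector -/

section PMFSum

variable {X : Type*} [Fintype X]

theorem PMF.sum_toReal (p : PMF X) : ∑ j, (p j).toReal = 1 := by
  rw [← ENNReal.toReal_sum fun j _ => p.apply_ne_top j]
  have := p.tsum_coe
  rw [tsum_fintype] at this
  simp [this]

theorem PMF.abs_sum_toReal_mul_le (p : PMF X) {f : X → ℝ} {B : ℝ} (h : ∀ j, |f j| ≤ B) :
    |∑ j, (p j).toReal * f j| ≤ B := by
  calc _ ≤ ∑ j, |(p j).toReal * f j| := Finset.abs_sum_le_sum_abs _ _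
    _ ≤ ∑ j, (p j).toReal * B := Finset.sum_le_sum fun j _ => by
        rw [abs_mul, abs_of_nonneg ENNReal.toReal_nonneg]
        exact mul_le_mul_of_nonneg_left (h j) ENNReal.toReal_nonneg
    _ = B := by rw [← Finset.sum_mul, p.sum_toReal, one_mul]

end PMFSum

/-! ### The dynamic programming operator -/

section Bellman

variable {X U : Type*} [Fintype X] [Fintype U] [Nonempty U]

/-- The dynamic programming operator on state-action values. -/
noncomputable def bellman (p : X → U → PMF X) (r : X → U → ℝ) (γ : ℝ) (q : X → U → ℝ) :
    X → U → ℝ :=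
  fun i v => r i v + γ * ∑ j, (p i v j).toReal * minControl (q j)

theorem exists_bellman_fixedPoint (p : X → U → PMF X) (r : X → U → ℝ) {γ : ℝ} (hγ₀ : 0 ≤ γ)
    (hγ₁ : γ < 1) : ∃ q, bellman p r γ q = q := by
  have hc : ContractingWith ⟨γ, hγ₀⟩ (bellman p r γ) := by
    refine ⟨by exact_mod_cast hγ₁, LipschitzWith.of_dist_le_mul fun q q' => ?_⟩
    have hnn : 0 ≤ γ * dist q q' := mul_nonneg hγ₀ dist_nonneg
    refine (dist_pi_le_iff hnn).2 fun i => (dist_pi_le_iff hnn).2 fun v => ?_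
    have h1 : ∀ j, |minControl (q j) - minControl (q' j)| ≤ dist q q' := fun j =>
      abs_minControl_sub_le fun w => by
        rw [← Real.dist_eq]
        exact (dist_le_pi_dist (q j) (q' j) w).trans (dist_le_pi_dist q q' j)
    have h2 := (p i v).abs_sum_toReal_mul_le h1
    have h3 : bellman p r γ q i v - bellman p r γ q' i v
        = γ * ∑ j, (p i v j).toReal * (minControl (q j) - minControl (q' j)) := by
      simp only [bellman, mul_sub, Finset.sum_sub_distrib]
      ring
    rw [Real.dist_eq, h3, abs_mul, abs_of_nonneg hγ₀]
    exact mul_le_mul_of_nonneg_left h2 hγ₀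
  exact ⟨_, hc.fixedPoint_isFixedPt⟩

end Bellman

/-! ### Policy evaluation and the optimal cost -/

section PolicyEvaluation

variable {X U : Type*} [Fintype X] [MeasurableSpace X] [DiscreteMeasurableSpace X]

instance chainLaw_isProbabilityMeasure (p : X → U → PMF X) (π : X → U) (i : X) :
    IsProbabilityMeasure (chainLaw p π i) := by
  unfold chainLaw; infer_instance

theorem integrable_comp_eval_chainLaw (p : X → U → PMF X) (π : X → U) (i : X) (f : X → ℝ)
    (t : ℕ) : Integrable (fun s : ℕ → X => f (s t)) (chainLaw p π i) := by
  have hm : Measurable fun s : ℕ → X => f (s t) :=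
    (Measurable.of_discrete (f := f)).comp (measurable_pi_apply t)
  refine Integrable.of_bound hm.aestronglyMeasurable (∑ j, |f j|) (ae_of_all _ fun s => ?_)
  exact Finset.single_le_sum (f := fun j => |f j|) (fun j _ => abs_nonneg _) (Finset.mem_univ _)

theorem integral_chainLaw_zero (p : X → U → PMF X) (π : X → U) (i : X) (f : X → ℝ) :
    ∫ s, f (s 0) ∂(chainLaw p π i) = f i := by
  let g : (∀ _ : Finset.Iic 0, X) → ℝ := fun h => f (h ⟨0, Finset.mem_Iic.2 le_rfl⟩)
  have hg : Measurable g := (Measurable.of_discrete (f := f)).comp (measurable_pi_apply _)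
  have h : ∫ s, f (s 0) ∂(chainLaw p π i)
      = ∫ h, g h ∂((chainLaw p π i).map (Preorder.frestrictLe (π := fun _ : ℕ => X) 0)) := by
    rw [integral_map (by fun_prop) hg.aestronglyMeasurable]
    rfl
  rw [h, chainLaw, Kernel.traj_map_frestrictLe_apply, Kernel.partialTraj_self, Kernel.id_apply,
    integral_dirac' _ _ hg.stronglyMeasurable]

/-- The one-step Markov property: condition on the path up to time `t`; the next coordinate of the
trajectory then follows the kernel at the current state. -/
theorem integral_chainLaw_succ (p : X → U → PMF X) (π : X → U) (i : X) (f : X → ℝ) (t : ℕ) :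
    ∫ s, f (s (t + 1)) ∂(chainLaw p π i)
      = ∫ s, (∑ j, (p (s t) (π (s t)) j).toReal * f j) ∂(chainLaw p π i) := by
  have hf : Measurable f := Measurable.of_discrete
  let P : X → ℝ := fun k => ∑ j, (p k (π k) j).toReal * f j
  let g : (∀ _ : Finset.Iic t, X) → ℝ := fun h => P (h ⟨t, Finset.mem_Iic.2 le_rfl⟩)
  have hg : Measurable g := (Measurable.of_discrete (f := P)).comp (measurable_pi_apply _)
  have h2 : ∫ s, P (s t) ∂(chainLaw p π i)
      = ∫ h, g h ∂((chainLaw p π i).map (Preorder.frestrictLe (π := fun _ : ℕ => X) t)) := by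
    rw [integral_map (by fun_prop) hg.aestronglyMeasurable]
    rfl
  change _ = ∫ s, P (s t) ∂(chainLaw p π i)
  rw [h2]
  have h1 := integrable_comp_eval_chainLaw p π i f (t + 1)
  rw [chainLaw] at h1 ⊢
  rw [Kernel.traj_map_frestrictLe_apply, ← Kernel.integral_traj_partialTraj (Nat.zero_le t) h1]
  refine integral_congr_ae (ae_of_all _ fun h => ?_)
  simp only
  rw [← integral_map (φ := fun y : ℕ → X => y (t + 1)) (f := f) (measurable_pi_apply _).aemeasurable
    hf.aestronglyMeasurable, ← Kernel.map_apply _ (by fun_prop), Kernel.map_traj_succ_self,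
    Kernel.comap_apply]
  change ∫ y, f y ∂(p _ (π _)).toMeasure = _
  rw [PMF.integral_eq_sum]
  rfl

variable {N : ℕ}

/-- Network average of the mean one-stage costs. -/
noncomputable def averageCost (costLaw : Fin N → X → U → ProbabilityMeasure ℝ) (i : X) (v : U) :
    ℝ :=
  (1 / (N : ℝ)) * ∑ n, ∫ c, c ∂(costLaw n i v : Measure ℝ)

/-- Expected costs are bounded on the finite state space, so the series is dominated by a geometric
one and the upper limit in `policyCost` is a genuine limit. -/
theorem tendsto_sum_discounted_averageCost (p : X → U → PMF X)
    (costLaw : Fin N → X → U → ProbabilityMeasure ℝ) {γ : ℝ} (hγ₀ : 0 ≤ γ) (hγ₁ : γ < 1)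
    (π : X → U) (i : X) :
    Tendsto (fun T => ∑ t ∈ Finset.range T,
      γ ^ t * ∫ s, averageCost costLaw (s t) (π (s t)) ∂(chainLaw p π i)) atTop
      (𝓝 (policyCost p costLaw γ π i)) := by
  let r : X → ℝ := fun j => averageCost costLaw j (π j)
  have hsum : Summable fun t : ℕ => γ ^ t * ∫ s, r (s t) ∂(chainLaw p π i) := by
    refine Summable.of_norm_bounded (g := fun t => γ ^ t * ∑ j, |r j|)
      ((summable_geometric_of_lt_one hγ₀ hγ₁).mul_right _) fun t => ?_
    rw [norm_mul, Real.norm_of_nonneg (pow_nonneg hγ₀ t)]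
    refine mul_le_mul_of_nonneg_left ?_ (pow_nonneg hγ₀ t)
    refine (norm_integral_le_of_norm_le_const (C := ∑ j, |r j|) (ae_of_all _ fun s => ?_)).trans
      (by simp)
    exact Finset.single_le_sum (f := fun j => |r j|) (fun j _ => abs_nonneg _) (Finset.mem_univ _)
  have hlim := hsum.hasSum.tendsto_sum_nat
  have hpc : policyCost p costLaw γ π i
      = limsup (fun T : ℕ => ∑ t ∈ Finset.range (T + 1),
          γ ^ t * ∫ s, r (s t) ∂(chainLaw p π i)) atTop := by
    unfold policyCost
    congr 1
    funext T
    rw [← Finset.sum_congr rfl fun t _ => integral_const_mul (γ ^ t) fun s : ℕ → X => r (s t),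
      ← integral_finsetSum _ fun t _ =>
        (integrable_comp_eval_chainLaw p π i r t).const_mul (γ ^ t)]
    congr 1
    funext s
    rw [Finset.sum_comm, Finset.mul_sum]
    refine Finset.sum_congr rfl fun t _ => ?_
    simp only [r, averageCost, ← Finset.mul_sum]
    ring
  rw [hpc, ((tendsto_add_atTop_iff_nat 1).2 hlim).limsup_eq]
  exact hlim

theorem tendsto_pow_mul_integral_chainLaw (p : X → U → PMF X) {γ : ℝ} (hγ₀ : 0 ≤ γ) (hγ₁ : γ < 1)
    (π : X → U) (i : X) (V : X → ℝ) :
    Tendsto (fun T => γ ^ T * ∫ s, V (s T) ∂(chainLaw p π i)) atTop (𝓝 0) := by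
  have h := (tendsto_pow_atTop_nhds_zero_of_lt_one hγ₀ hγ₁).mul_const (∑ j, |V j|)
  rw [zero_mul] at h
  refine squeeze_zero_norm (fun T => ?_) h
  rw [norm_mul, Real.norm_of_nonneg (pow_nonneg hγ₀ T)]
  refine mul_le_mul_of_nonneg_left ?_ (pow_nonneg hγ₀ T)
  refine (norm_integral_le_of_norm_le_const (C := ∑ j, |V j|) (ae_of_all _ fun s => ?_)).trans
    (by simp)
  exact Finset.single_le_sum (f := fun j => |V j|) (fun j _ => abs_nonneg _) (Finset.mem_univ _)

theorem integral_discounted_succ (p : X → U → PMF X) (γ : ℝ) (π : X → U) (i : X) (r V : X → ℝ)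
    (t : ℕ) :
    ∫ s, r (s t) ∂(chainLaw p π i) + γ * ∫ s, V (s (t + 1)) ∂(chainLaw p π i)
      = ∫ s, (r (s t) + γ * ∑ j, (p (s t) (π (s t)) j).toReal * V j) ∂(chainLaw p π i) := by
  rw [integral_chainLaw_succ, ← integral_const_mul, integral_add]
  · exact integrable_comp_eval_chainLaw p π i r t
  · exact integrable_comp_eval_chainLaw p π i
      (fun k => γ * ∑ j, (p k (π k) j).toReal * V j) t

/-- Iterating the subsolution inequality along the chain bounds `V i` by the discounted cost up to
time `T` plus `γ ^ T` times the mean of `V` at time `T`, and this remainder vanishes. -/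
theorem le_policyCost (p : X → U → PMF X) (costLaw : Fin N → X → U → ProbabilityMeasure ℝ)
    {γ : ℝ} (hγ₀ : 0 ≤ γ) (hγ₁ : γ < 1) (π : X → U) {V : X → ℝ}
    (hV : ∀ k, V k ≤ averageCost costLaw k (π k) + γ * ∑ j, (p k (π k) j).toReal * V j) (i : X) :
    V i ≤ policyCost p costLaw γ π i := by
  have hle : ∀ T, V i ≤ ∑ t ∈ Finset.range T,
      γ ^ t * ∫ s, averageCost costLaw (s t) (π (s t)) ∂(chainLaw p π i)
      + γ ^ T * ∫ s, V (s T) ∂(chainLaw p π i) := by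
    intro T
    induction T with
    | zero => simp [integral_chainLaw_zero]
    | succ T ih =>
      refine ih.trans ?_
      rw [Finset.sum_range_succ, add_assoc, add_le_add_iff_left, pow_succ, mul_assoc, ← mul_add,
        integral_discounted_succ p γ π i (fun k => averageCost costLaw k (π k)) V T]
      refine mul_le_mul_of_nonneg_left ?_ (pow_nonneg hγ₀ T)
      exact integral_mono (integrable_comp_eval_chainLaw p π i V T)
        (integrable_comp_eval_chainLaw p π i (fun k => averageCost costLaw k (π k)
          + γ * ∑ j, (p k (π k) j).toReal * V j) T) fun s => hV (s T)
  have h := (tendsto_sum_discounted_averageCost p costLaw hγ₀ hγ₁ π i).add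
    (tendsto_pow_mul_integral_chainLaw p hγ₀ hγ₁ π i V)
  rw [add_zero] at h
  exact ge_of_tendsto' h hle

/-- The same iteration for a supersolution, with the inequalities reversed. -/
theorem policyCost_le (p : X → U → PMF X) (costLaw : Fin N → X → U → ProbabilityMeasure ℝ)
    {γ : ℝ} (hγ₀ : 0 ≤ γ) (hγ₁ : γ < 1) (π : X → U) {V : X → ℝ}
    (hV : ∀ k, averageCost costLaw k (π k) + γ * ∑ j, (p k (π k) j).toReal * V j ≤ V k) (i : X) :
    policyCost p costLaw γ π i ≤ V i := by
  have hle : ∀ T, ∑ t ∈ Finset.range T,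
      γ ^ t * ∫ s, averageCost costLaw (s t) (π (s t)) ∂(chainLaw p π i)
      + γ ^ T * ∫ s, V (s T) ∂(chainLaw p π i) ≤ V i := by
    intro T
    induction T with
    | zero => simp [integral_chainLaw_zero]
    | succ T ih =>
      refine le_trans ?_ ih
      rw [Finset.sum_range_succ, add_assoc, add_le_add_iff_left, pow_succ, mul_assoc, ← mul_add,
        integral_discounted_succ p γ π i (fun k => averageCost costLaw k (π k)) V T]
      refine mul_le_mul_of_nonneg_left ?_ (pow_nonneg hγ₀ T)
      exact integral_mono (integrable_comp_eval_chainLaw p π i (fun k => averageCost costLaw k (π k)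
          + γ * ∑ j, (p k (π k) j).toReal * V j) T)
        (integrable_comp_eval_chainLaw p π i V T) fun s => hV (s T)
  have h := (tendsto_sum_discounted_averageCost p costLaw hγ₀ hγ₁ π i).add
    (tendsto_pow_mul_integral_chainLaw p hγ₀ hγ₁ π i V)
  rw [add_zero] at h
  exact le_of_tendsto' h hle

/-- The minimum over controls of the fixed point of the dynamic programming operator is the
optimal cost. -/
theorem minControl_eq_optimalCost [Fintype U] [Nonempty U] (p : X → U → PMF X)
    (costLaw : Fin N → X → U → ProbabilityMeasure ℝ) {γ : ℝ} (hγ₀ : 0 ≤ γ) (hγ₁ : γ < 1)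
    {q : X → U → ℝ} (hq : bellman p (averageCost costLaw) γ q = q) (i : X) :
    minControl (q i) = optimalCost p costLaw γ i := by
  have hqe : ∀ k v, averageCost costLaw k v + γ * ∑ j, (p k v j).toReal * minControl (q j)
      = q k v := fun k v => congrFun (congrFun hq k) v
  refine le_antisymm (le_ciInf fun π => ?_) ?_
  · exact le_policyCost p costLaw hγ₀ hγ₁ π (V := fun k => minControl (q k))
      (fun k => by rw [hqe]; exact minControl_le _ _) i
  -- For a greedy policy the inequality used for arbitrary policies becomes an equality.
  · choose π hπ using fun k => exists_eq_minControl (q k)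
    refine (ciInf_le (Set.finite_range _).bddBelow π).trans ?_
    exact policyCost_le p costLaw hγ₀ hγ₁ π (V := fun k => minControl (q k))
      (fun k => by rw [hqe, hπ]) i

end PolicyEvaluation

/-! ### Scalar and asynchronous recursions -/

section DeterministicRecursions

theorem tendsto_sum_range_add_left {α : ℕ → ℝ}
    (hdiv : Tendsto (fun T => ∑ t ∈ Finset.range T, α t) atTop atTop) (t₀ : ℕ) :
    Tendsto (fun T => ∑ t ∈ Finset.range T, α (t₀ + t)) atTop atTop := by
  have h : (fun T => ∑ t ∈ Finset.range T, α (t₀ + t))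
      = fun T => -(∑ t ∈ Finset.range t₀, α t) + ∑ t ∈ Finset.range (T + t₀), α t := by
    funext T
    rw [add_comm T t₀, Finset.sum_range_add]
    ring
  rw [h]
  exact tendsto_atTop_add_const_left _ _ ((tendsto_add_atTop_iff_nat t₀).2 hdiv)

theorem tendsto_sum_range_congr {α α' : ℕ → ℝ}
    (hdiv : Tendsto (fun T => ∑ t ∈ Finset.range T, α t) atTop atTop)
    (h : ∀ᶠ t in atTop, α' t = α t) :
    Tendsto (fun T => ∑ t ∈ Finset.range T, α' t) atTop atTop := by
  obtain ⟨t₀, ht₀⟩ := eventually_atTop.1 h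
  rw [← tendsto_add_atTop_iff_nat t₀]
  have h : (fun T => ∑ t ∈ Finset.range (T + t₀), α' t)
      = fun T => (∑ t ∈ Finset.range t₀, α' t) + ∑ t ∈ Finset.range T, α (t₀ + t) := by
    funext T
    rw [add_comm T t₀, Finset.sum_range_add]
    congr 1
    exact Finset.sum_congr rfl fun t _ => ht₀ _ (by omega)
  rw [h]
  exact tendsto_atTop_add_const_left _ _ (tendsto_sum_range_add_left hdiv t₀)

/-- From some time on, `x` plus the accumulated `∑ α x` is nonincreasing and nonnegative, hence
convergent. -/
theorem tendsto_zero_of_le_one_sub_mul {x α : ℕ → ℝ} (hx : ∀ t, 0 ≤ x t) (hα : ∀ t, 0 ≤ α t)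
    (hdiv : Tendsto (fun T => ∑ t ∈ Finset.range T, α t) atTop atTop)
    (h : ∀ᶠ t in atTop, x (t + 1) ≤ (1 - α t) * x t) : Tendsto x atTop (𝓝 0) := by
  obtain ⟨t₀, ht₀⟩ := eventually_atTop.1 h
  have hanti : Antitone fun T => x (t₀ + T)
      + ∑ t ∈ Finset.range T, α (t₀ + t) * x (t₀ + t) := antitone_nat_of_succ_le fun T => by
    rw [Finset.sum_range_succ]
    have := ht₀ (t₀ + T) (by omega)
    change x (t₀ + T + 1) + _ ≤ _
    linarith
  have hbdd : BddBelow (Set.range fun T => x (t₀ + T)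
      + ∑ t ∈ Finset.range T, α (t₀ + t) * x (t₀ + t)) := ⟨0, by
    rintro _ ⟨T, rfl⟩
    exact add_nonneg (hx _) (Finset.sum_nonneg fun t _ => mul_nonneg (hα _) (hx _))⟩
  have h1 := tendsto_zero_of_tendsto_add_sum (v := fun t => x (t₀ + t))
    (c := fun t => α (t₀ + t)) (fun t => hx _) (fun t => hα _)
    (tendsto_sum_range_add_left hdiv t₀) (tendsto_atTop_ciInf hanti hbdd)
  rw [← tendsto_add_atTop_iff_nat t₀]
  simpa only [add_comm] using h1

/-- The positive part of `x - K` satisfies the homogeneous recursion. -/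
theorem eventually_le_of_le_one_sub_mul_add {x α : ℕ → ℝ} {K η : ℝ} (hη : 0 < η)
    (hα : ∀ t, 0 ≤ α t) (hα1 : ∀ᶠ t in atTop, α t ≤ 1)
    (hdiv : Tendsto (fun T => ∑ t ∈ Finset.range T, α t) atTop atTop)
    (h : ∀ᶠ t in atTop, x (t + 1) ≤ (1 - α t) * x t + α t * K) :
    ∀ᶠ t in atTop, x t ≤ K + η := by
  have h0 : Tendsto (fun t => max (x t - K) 0) atTop (𝓝 0) := by
    refine tendsto_zero_of_le_one_sub_mul (fun t => le_max_right _ _) hα hdiv ?_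
    filter_upwards [h, hα1] with t ht ht1
    have h1 : (1 - α t) * (x t - K) ≤ (1 - α t) * max (x t - K) 0 :=
      mul_le_mul_of_nonneg_left (le_max_left _ _) (by linarith)
    exact max_le (by linarith) (mul_nonneg (by linarith) (le_max_right _ _))
  filter_upwards [h0.eventually (gt_mem_nhds hη)] with t ht
  linarith [le_max_left (x t - K) 0]

/-- Asynchronous sup-norm contraction with vanishing perturbations. -/
theorem tendsto_zero_of_asynchronous_contraction {ι : Type*} [Finite ι] {e α : ℕ → ι → ℝ}
    {ε : ℕ → ℝ} {γ B : ℝ} (hγ₀ : 0 ≤ γ) (hγ₁ : γ < 1) (he : ∀ t z, 0 ≤ e t z)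
    (hB : ∀ t z, e t z ≤ B) (hε : Tendsto ε atTop (𝓝 0)) (hα : ∀ t z, 0 ≤ α t z)
    (hα1 : ∀ z, ∀ᶠ t in atTop, α t z ≤ 1)
    (hdiv : ∀ z, Tendsto (fun T => ∑ t ∈ Finset.range T, α t z) atTop atTop)
    (h : ∀ z, ∀ᶠ t in atTop, ∀ K, (∀ z', e t z' ≤ K) →
      e (t + 1) z ≤ (1 - α t z) * e t z + α t z * (γ * (K + ε t))) (z : ι) :
    Tendsto (fun t => e t z) atTop (𝓝 0) := by
  have hstep : ∀ L : ℝ, 0 < L → (∀ᶠ t in atTop, ∀ z, e t z ≤ L) →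
      ∀ᶠ t in atTop, ∀ z, e t z ≤ (1 + γ) / 2 * L := by
    intro L hL hbd
    rw [eventually_all]
    intro z
    -- Any eventual bound `L` improves to `(1 + γ) / 2 * L`: the perturbation and the slack of the
    -- scalar recursion each cost at most `η`, and `γ L + 2 η = (1 + γ) / 2 * L`.
    set η := (1 - γ) / 4 * L with hη
    have hη0 : 0 < η := mul_pos (by linarith) hL
    have hev : ∀ᶠ t in atTop, e (t + 1) z ≤ (1 - α t z) * e t z + α t z * (γ * (L + η)) := by
      filter_upwards [h z, hbd, hε.eventually (gt_mem_nhds hη0)] with t h1 h2 h3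
      refine (h1 L h2).trans ?_
      gcongr
      exact hα t z
    have := eventually_le_of_le_one_sub_mul_add (x := fun t => e t z) hη0
      (fun t => hα t z) (hα1 z) (hdiv z) hev
    filter_upwards [this] with t ht
    refine ht.trans ?_
    have : γ * η ≤ 1 * η := mul_le_mul_of_nonneg_right hγ₁.le hη0.le
    linarith
  have hpow : ∀ n : ℕ, ∀ᶠ t in atTop, ∀ z, e t z ≤ ((1 + γ) / 2) ^ n * (|B| + 1) := by
    intro n
    induction n with
    | zero => exact .of_forall fun t z => by linarith [hB t z, le_abs_self B]
    | succ n ih =>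
      have := hstep _ (by positivity) ih
      filter_upwards [this] with t ht z
      rw [pow_succ']
      linarith [ht z]
  have hlim : Tendsto (fun n : ℕ => ((1 + γ) / 2) ^ n * (|B| + 1)) atTop (𝓝 0) := by
    have := (tendsto_pow_atTop_nhds_zero_of_lt_one (r := (1 + γ) / 2) (by linarith)
      (by linarith)).mul_const (|B| + 1)
    rwa [zero_mul] at this
  rw [tendsto_order]
  refine ⟨fun a ha => .of_forall fun t => ha.trans_le (he t z), fun a ha => ?_⟩
  obtain ⟨n, hn⟩ := (hlim.eventually (gt_mem_nhds ha)).exists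
  filter_upwards [hpow n] with t ht
  exact (ht z).trans_lt hn

/-- Boundedness of a running maximum under a contraction with asymptotically small relative
perturbations. -/
theorem exists_bound_of_running_max {q g ρ w : ℕ → ℝ} {γ D : ℝ} (hγ₀ : 0 ≤ γ) (hγ₁ : γ < 1)
    (hg0 : ∀ t, 0 ≤ g t) (hg : ∀ t, g (t + 1) = max (g t) (q (t + 1)))
    (hq : ∀ t, q t ≤ ρ t + g t * w t) (hw : Tendsto w atTop (𝓝 0))
    (hρ : ∀ᶠ t in atTop, ρ (t + 1) ≤ max (ρ t) (γ * g t + D) + w (t + 1) * (g (t + 1) - g t)) :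
    ∃ B, ∀ t, g t ≤ B := by
  -- One `δ` pays for the telescoping terms `w (g' - g)` in the bound on `ρ`, another for `g w` in
  -- the bound on `q`; `1 - γ - 2 δ` is still positive.
  set δ := (1 - γ) / 3 with hδ
  have hδ0 : 0 < δ := by rw [hδ]; linarith
  have hmono : Monotone g := monotone_nat_of_le_succ fun t => by rw [hg]; exact le_max_left _ _
  obtain ⟨t₁, ht₁⟩ := eventually_atTop.1 (hρ.and (hw.eventually (gt_mem_nhds hδ0)))
  set K := max (ρ t₁) D
  have hρK : ∀ t ≥ t₁, ρ t ≤ K + (γ + δ) * g t := by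
    intro t ht
    induction t, ht using Nat.le_induction with
    | base =>
      have := mul_nonneg (add_nonneg hγ₀ hδ0.le) (hg0 t₁)
      linarith [le_max_left (ρ t₁) D]
    | succ t ht ih =>
      have h1 := (ht₁ t ht).1
      have h2 := (ht₁ (t + 1) (by omega)).2
      have h3 : 0 ≤ g (t + 1) - g t := sub_nonneg.2 (hmono t.le_succ)
      have h4 := mul_le_mul_of_nonneg_right h2.le h3
      have h5 : max (ρ t) (γ * g t + D) ≤ K + (γ + δ) * g t :=
        max_le ih (by linarith [le_max_right (ρ t₁) D, mul_nonneg hδ0.le (hg0 t)])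
      have h6 := mul_nonneg hγ₀ h3
      linarith
  have hpos : 0 < 1 - γ - 2 * δ := by rw [hδ]; linarith
  have hbd : ∀ t ≥ t₁, g t ≤ max (g t₁) (K / (1 - γ - 2 * δ)) := by
    intro t ht
    induction t, ht using Nat.le_induction with
    | base => exact le_max_left _ _
    | succ t ht ih =>
      rcases le_total (q (t + 1)) (g t) with h | h
      · rwa [hg, max_eq_left h]
      -- When the maximum is attained by the new term, `g = q ≤ K + (γ + 2 δ) g`, which can be
      -- solved for `g`.
      · have hgq : g (t + 1) = q (t + 1) := by rw [hg, max_eq_right h]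
        have h1 := hq (t + 1)
        have h2 := hρK (t + 1) (by omega)
        have h3 := mul_le_mul_of_nonneg_left (ht₁ (t + 1) (by omega)).2.le (hg0 (t + 1))
        refine le_max_of_le_right ?_
        rw [le_div_iff₀ hpos]
        rw [← hgq] at h1
        linarith
  exact ⟨_, fun t => (hmono (le_max_left t t₁)).trans (hbd _ (le_max_right _ _))⟩

end DeterministicRecursions

/-! ### Visit counts and sums of the weights -/

section Visits

variable {X U Ω : Type*}

open Classical in
/-- Number of visits to `(i, v)` strictly before time `t`. -/
noncomputable def visitCount (x : ℕ → Ω → X) (u : ℕ → Ω → U) (i : X) (v : U) (t : ℕ) (ω : Ω) : ℕ :=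
  ∑ s ∈ Finset.range t, if (x s ω, u s ω) = (i, v) then 1 else 0

variable {x : ℕ → Ω → X} {u : ℕ → Ω → U} {i : X} {v : U} {ω : Ω}

open Classical in
theorem visitCount_succ (t : ℕ) : visitCount x u i v (t + 1) ω
    = visitCount x u i v t ω + if (x t ω, u t ω) = (i, v) then 1 else 0 :=
  Finset.sum_range_succ _ _

theorem visitCount_mono : Monotone fun t => visitCount x u i v t ω :=
  monotone_nat_of_le_succ fun t => by rw [visitCount_succ]; exact Nat.le_add_right _ _

theorem visitTime_eq (k : ℕ) : visitTime x u i v k ω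
    = sInf ((fun t : ℕ => (t : ℕ∞)) '' {t : ℕ | visitCount x u i v (t + 1) ω = k + 1}) :=
  rfl

/-- At the first time when the count including the present equals `k + 1`, the pair must be visited:
otherwise the count would have had this value one step earlier, or would be zero at time `0`. -/
theorem coe_eq_visitTime_iff (t k : ℕ) : (t : ℕ∞) = visitTime x u i v k ω
    ↔ (x t ω, u t ω) = (i, v) ∧ visitCount x u i v t ω = k := by
  classical
  rw [visitTime_eq]
  set A : Set ℕ := {t : ℕ | visitCount x u i v (t + 1) ω = k + 1} with hA
  constructor
  · intro h
    have hne : ((fun t : ℕ => (t : ℕ∞)) '' A).Nonempty := by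
      by_contra hemp
      rw [Set.not_nonempty_iff_eq_empty] at hemp
      rw [hemp, sInf_empty] at h
      exact ENat.natCast_ne_top t h
    have hmem := csInf_mem hne
    rw [← h] at hmem
    obtain ⟨t', ht', hte⟩ := hmem
    obtain rfl : t' = t := by simpa using hte
    have hmin : ∀ s < t', visitCount x u i v (s + 1) ω ≠ k + 1 := fun s hs hs' => by
      have : ((t' : ℕ) : ℕ∞) ≤ s := h ▸ sInf_le ⟨s, hs', rfl⟩
      exact absurd (ENat.natCast_le_natCast.1 this) (by omega)
    have hcnt : visitCount x u i v (t' + 1) ω = k + 1 := ht'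
    by_cases hv : (x t' ω, u t' ω) = (i, v)
    · refine ⟨hv, ?_⟩
      rw [visitCount_succ, if_pos hv] at hcnt
      omega
    · rw [visitCount_succ, if_neg hv, add_zero] at hcnt
      cases t' with
      | zero => simp [visitCount] at hcnt
      | succ s => exact absurd hcnt (hmin s s.lt_succ_self)
  · rintro ⟨hv, hk⟩
    have htA : t ∈ A := by
      change visitCount x u i v (t + 1) ω = k + 1
      rw [visitCount_succ, if_pos hv, hk]
    refine (IsLeast.csInf_eq ⟨Set.mem_image_of_mem _ htA, ?_⟩).symm
    rintro _ ⟨s, hs, rfl⟩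
    rw [ENat.natCast_le_natCast]
    by_contra hst
    have h1 : visitCount x u i v (s + 1) ω ≤ visitCount x u i v t ω :=
      visitCount_mono (by omega)
    have h2 : visitCount x u i v (s + 1) ω = k + 1 := hs
    omega

-- The index in the weight is the number of strictly earlier visits, which makes the weights
-- adapted.
open Classical in
theorem weight_eq (c τ : ℝ) (t : ℕ) : weight x u c τ i v t ω
    = if (x t ω, u t ω) = (i, v) then c / ((visitCount x u i v t ω : ℝ) + 1) ^ τ else 0 := by
  unfold weight
  by_cases hv : (x t ω, u t ω) = (i, v)
  · have h : ∃ k : ℕ, (t : ℕ∞) = visitTime x u i v k ω :=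
      ⟨_, (coe_eq_visitTime_iff t _).2 ⟨hv, rfl⟩⟩
    rw [dif_pos h, if_pos hv, ← ((coe_eq_visitTime_iff t _).1 (Nat.find_spec h)).2]
  · rw [if_neg hv, dif_neg]
    rintro ⟨k, hk⟩
    exact hv ((coe_eq_visitTime_iff t k).1 hk).1

theorem tendsto_visitCount (h : ∀ k, visitTime x u i v k ω < ⊤) :
    Tendsto (fun t => visitCount x u i v t ω) atTop atTop := by
  classical
  refine tendsto_atTop_atTop_of_monotone visitCount_mono fun k => ?_
  obtain ⟨t, ht⟩ := ENat.ne_top_iff_exists.1 (h k).ne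
  exact ⟨t, ((coe_eq_visitTime_iff t k).1 ht).2.ge⟩

-- Reindexing time by visits turns sums of weights into partial sums of a deterministic series.
-- Convergent series thus yield bounds uniform in the trajectory.
open Classical in
theorem sum_visits_eq (f : ℕ → ℝ) (T : ℕ) :
    ∑ t ∈ Finset.range T, (if (x t ω, u t ω) = (i, v) then f (visitCount x u i v t ω) else 0)
      = ∑ k ∈ Finset.range (visitCount x u i v T ω), f k := by
  induction T with
  | zero => simp [visitCount]
  | succ T ih =>
    rw [Finset.sum_range_succ, ih, visitCount_succ]
    split_ifs
    · rw [Finset.sum_range_succ]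
    · simp

theorem weight_nonneg {c : ℝ} (hc : 0 ≤ c) (τ : ℝ) (t : ℕ) : 0 ≤ weight x u c τ i v t ω := by
  rw [weight_eq]
  split_ifs <;> positivity

theorem weight_eq_zero_of_ne (c τ : ℝ) (t : ℕ) (h : (x t ω, u t ω) ≠ (i, v)) :
    weight x u c τ i v t ω = 0 := by
  rw [weight_eq, if_neg h]

theorem tendsto_weight {c τ : ℝ} (hc : 0 ≤ c) (hτ : 0 < τ)
    (h : Tendsto (fun t => visitCount x u i v t ω) atTop atTop) :
    Tendsto (fun t => weight x u c τ i v t ω) atTop (𝓝 0) := by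
  have h1 : Tendsto (fun t => c / ((visitCount x u i v t ω : ℝ) + 1) ^ τ) atTop (𝓝 0) :=
    tendsto_const_nhds.div_atTop ((tendsto_rpow_atTop hτ).comp
      (tendsto_atTop_add_const_right _ _ (tendsto_natCast_atTop_atTop.comp h)))
  refine squeeze_zero (fun t => weight_nonneg hc τ t) (fun t => ?_) h1
  rw [weight_eq]
  split_ifs
  · exact le_rfl
  · positivity

theorem not_summable_div_rpow {c τ : ℝ} (hc : 0 < c) (hτ : τ ≤ 1) :
    Tendsto (fun n => ∑ k ∈ Finset.range n, c / ((k : ℝ) + 1) ^ τ) atTop atTop := by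
  refine (not_summable_iff_tendsto_nat_atTop_of_nonneg fun k => by positivity).1 fun hs => ?_
  have h1 : Summable fun k : ℕ => 1 / ((k : ℝ) + 1) ^ τ := by
    refine (hs.mul_left c⁻¹).congr fun k => ?_
    field_simp
  have h2 := (summable_nat_add_iff (f := fun n : ℕ => 1 / (n : ℝ) ^ τ) 1).1 (by simpa using h1)
  exact absurd (Real.summable_one_div_nat_rpow.1 h2) (by linarith)

theorem summable_div_rpow (c : ℝ) {τ : ℝ} (hτ : 1 < τ) :
    Summable fun k : ℕ => c / ((k : ℝ) + 1) ^ τ := by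
  have h1 := (summable_nat_add_iff (f := fun n : ℕ => 1 / (n : ℝ) ^ τ) 1).2
    (Real.summable_one_div_nat_rpow.2 hτ)
  refine (h1.mul_left c).congr fun k => ?_
  push_cast
  ring

theorem tendsto_sum_weight {c τ : ℝ} (hc : 0 < c) (hτ : τ ≤ 1)
    (h : Tendsto (fun t => visitCount x u i v t ω) atTop atTop) :
    Tendsto (fun T => ∑ t ∈ Finset.range T, weight x u c τ i v t ω) atTop atTop := by
  classical
  simp_rw [weight_eq]
  simp_rw [sum_visits_eq fun k => c / ((k : ℝ) + 1) ^ τ]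
  exact (not_summable_div_rpow hc hτ).comp h

theorem sum_visits_le_tsum {f : ℕ → ℝ} (hf : Summable f) (hf0 : ∀ k, 0 ≤ f k) {y : ℕ → ℝ}
    (hy : ∀ t, y t ≤ open Classical in
      if (x t ω, u t ω) = (i, v) then f (visitCount x u i v t ω) else 0) (T : ℕ) :
    ∑ t ∈ Finset.range T, y t ≤ ∑' k, f k := by
  classical
  refine (Finset.sum_le_sum fun t _ => hy t).trans ?_
  rw [sum_visits_eq f]
  exact hf.sum_le_tsum _ fun k _ => hf0 k

theorem measurable_visit [MeasurableSpace X] [MeasurableSingletonClass X] [MeasurableSpace U]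
    [MeasurableSingletonClass U] {m : MeasurableSpace Ω} {t : ℕ} (hx : Measurable (x t))
    (hu : Measurable (u t)) (i : X) (v : U) : MeasurableSet {ω | (x t ω, u t ω) = (i, v)} := by
  have : {ω | (x t ω, u t ω) = (i, v)} = x t ⁻¹' {i} ∩ u t ⁻¹' {v} := by
    ext ω; simp [Prod.ext_iff]
  rw [this]
  exact (hx (measurableSet_singleton i)).inter (hu (measurableSet_singleton v))

theorem measurable_weight [MeasurableSpace X] [MeasurableSingletonClass X] [MeasurableSpace U]
    [MeasurableSingletonClass U] {mΩ : MeasurableSpace Ω} {F : Filtration ℕ mΩ}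
    (hx : ∀ t, Measurable[F t] (x t)) (hu : ∀ t, Measurable[F t] (u t)) (c τ : ℝ) (i : X) (v : U)
    (t : ℕ) : Measurable[F t] (weight x u c τ i v t) := by
  classical
  have hvis : ∀ s ≤ t, MeasurableSet[F t] {ω | (x s ω, u s ω) = (i, v)} := fun s hs =>
    measurable_visit (m := F t) ((hx s).mono (F.mono hs) le_rfl)
      ((hu s).mono (F.mono hs) le_rfl) i v
  have hcnt : Measurable[F t] fun ω => (visitCount x u i v t ω : ℝ) := by
    have he : (fun ω => (visitCount x u i v t ω : ℝ)) = fun ω => ∑ s ∈ Finset.range t,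
        if (x s ω, u s ω) = (i, v) then (1 : ℝ) else 0 := by
      funext ω
      simp [visitCount]
    rw [he]
    exact Finset.measurable_fun_sum _ fun s hs =>
      Measurable.ite (hvis s (Finset.mem_range.1 hs).le) measurable_const measurable_const
  have he : weight x u c τ i v t = fun ω => if (x t ω, u t ω) = (i, v)
      then c / ((visitCount x u i v t ω : ℝ) + 1) ^ τ else 0 := funext fun ω => weight_eq c τ t
  rw [he]
  exact Measurable.ite (hvis t le_rfl)
    (measurable_const.div ((hcnt.add_const 1).pow_const τ)) measurable_const

end Visits

/-! ### Network mean and disagreement -/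

section Average

variable {N : ℕ}

/-- Network average. -/
noncomputable def networkMean (y : Fin N → ℝ) : ℝ := (1 / (N : ℝ)) * ∑ n, y n

/-- Deviation from the network average. -/
noncomputable def disagreement (y : Fin N → ℝ) (n : Fin N) : ℝ := y n - networkMean y

theorem networkMean_add_mul (y z : Fin N → ℝ) (c : ℝ) :
    networkMean (fun n => y n + c * z n) = networkMean y + c * networkMean z := by
  simp only [networkMean, Finset.sum_add_distrib, ← Finset.mul_sum]
  ring

theorem networkMean_const (hN : 0 < N) (c : ℝ) : networkMean (fun _ : Fin N => c) = c := by
  have : (N : ℝ) ≠ 0 := by exact_mod_cast hN.ne'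
  simp only [networkMean, Finset.sum_const, Finset.card_univ, Fintype.card_fin, nsmul_eq_mul]
  field_simp

theorem abs_networkMean_le (hN : 0 < N) {y : Fin N → ℝ} {B : ℝ} (h : ∀ n, |y n| ≤ B) :
    |networkMean y| ≤ B := by
  rw [← networkMean_const hN B, networkMean, networkMean, abs_mul, abs_of_nonneg (by positivity)]
  gcongr
  exact (Finset.abs_sum_le_sum_abs _ _).trans (Finset.sum_le_sum fun n _ => h n)

theorem sum_disagreement (hN : 0 < N) (y : Fin N → ℝ) : ∑ n, disagreement y n = 0 := by
  have : (N : ℝ) ≠ 0 := by exact_mod_cast hN.ne'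
  simp only [disagreement, networkMean, Finset.sum_sub_distrib, Finset.sum_const, Finset.card_univ,
    Fintype.card_fin, nsmul_eq_mul]
  field_simp
  ring

theorem networkMean_consensusStep (α β : ℝ) (G : SimpleGraph (Fin N)) (y : Fin N → ℝ) :
    networkMean (fun n => consensusStep α β G y n) = (1 - α) * networkMean y := by
  simp only [networkMean, sum_consensusStep]
  ring

/-- Row and column sums of the Laplacian vanish, so the consensus step commutes with subtracting the
mean. -/
theorem disagreement_consensusStep_add (α β : ℝ) (G : SimpleGraph (Fin N)) (y f : Fin N → ℝ)
    (n : Fin N) : disagreement (fun n => consensusStep α β G y n + α * f n) n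
      = consensusStep α β G (disagreement y) n + α * disagreement f n := by
  rw [disagreement, networkMean_add_mul, networkMean_consensusStep]
  have h : disagreement y = fun n => y n - networkMean y := rfl
  rw [h, consensusStep_sub α β G y (fun _ => networkMean y), consensusStep_const, disagreement]
  ring

end Average

/-! ### Stability and convergence along one trajectory -/

section Pathwise

variable {X U : Type*} [Fintype X] [Fintype U] {N : ℕ}

theorem abs_apply_le_norm (q : Fin N → X → U → ℝ) (n : Fin N) (i : X) (v : U) :
    |q n i v| ≤ ‖q‖ := by
  rw [← Real.norm_eq_abs]
  exact (norm_le_pi_norm _ v).trans ((norm_le_pi_norm _ i).trans (norm_le_pi_norm q n))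

theorem norm_le_of_abs_apply_le {q : Fin N → X → U → ℝ} {B : ℝ} (hB : 0 ≤ B)
    (h : ∀ n i v, |q n i v| ≤ B) : ‖q‖ ≤ B :=
  (pi_norm_le_iff_of_nonneg hB).2 fun n => (pi_norm_le_iff_of_nonneg hB).2 fun i =>
    (pi_norm_le_iff_of_nonneg hB).2 fun v => h n i v

variable {α β : X → U → ℕ → ℝ} {G : ℕ → SimpleGraph (Fin N)} {Q : ℕ → Fin N → X → U → ℝ}
  {f w : ℕ → Fin N → ℝ}

/-- Stability of distributed stochastic approximation: if the noise process scaled by the running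
maximum vanishes, then the running maximum is bounded. -/
theorem exists_bound_of_scaled_noise {γ D : ℝ} (hγ₀ : 0 ≤ γ) (hγ₁ : γ < 1)
    (hα0 : ∀ i v t, 0 ≤ α i v t) (hβ0 : ∀ i v t, 0 ≤ β i v t)
    (hsmall : ∀ i v, ∀ᶠ t in atTop, α i v t ≤ 1 / 4 ∧ N * β i v t ≤ 1 / 4)
    (hQ : ∀ t n i v, Q (t + 1) n i v = consensusStep (α i v t) (β i v t) (G t)
      (fun l => Q t l i v) n + α i v t * (f t n + w t n))
    {g : ℕ → ℝ} (hg0 : ∀ t, 0 < g t) (hg : ∀ t, g (t + 1) = max (g t) ‖Q (t + 1)‖)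
    (hf : ∀ t n, |f t n| ≤ γ * g t + D) {W : X → U → ℕ → Fin N → ℝ}
    (hW : ∀ i v, ∀ᶠ t in atTop, ∀ n, W i v (t + 1) n = consensusStep (α i v t) (β i v t) (G t)
      (W i v t) n + α i v t * ((g t)⁻¹ * w t n))
    (hWlim : ∀ i v n, Tendsto (fun t => W i v t n) atTop (𝓝 0)) : ∃ B, ∀ t, g t ≤ B := by
  let W' : ℕ → Fin N → X → U → ℝ := fun t n i v => W i v t n
  -- Subtracting `g W` cancels the noise, because `W` is driven by the noise divided by `g`.
  let R : ℕ → Fin N → X → U → ℝ := fun t n i v => Q t n i v - g t * W i v t n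
  have hW'lim : Tendsto (fun t => ‖W' t‖) atTop (𝓝 0) := by
    have : Tendsto W' atTop (𝓝 0) := by
      refine tendsto_pi_nhds.2 fun n => tendsto_pi_nhds.2 fun i => tendsto_pi_nhds.2 fun v => ?_
      exact hWlim i v n
    simpa using this.norm
  refine exists_bound_of_running_max (q := fun t => ‖Q t‖) (ρ := fun t => ‖R t‖)
    (w := fun t => ‖W' t‖) (D := D) hγ₀ hγ₁ (fun t => (hg0 t).le) hg (fun t => ?_) hW'lim ?_
  · have he : Q t = R t + g t • W' t := by
      funext n i v
      simp [R, W']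
    calc ‖Q t‖ = ‖R t + g t • W' t‖ := by rw [← he]
      _ ≤ ‖R t‖ + g t * ‖W' t‖ := by
        refine (norm_add_le _ _).trans ?_
        rw [norm_smul, Real.norm_of_nonneg (hg0 t).le]
  · have hW2 : ∀ᶠ t in atTop, ∀ i v, ∀ n, W i v (t + 1) n = consensusStep (α i v t) (β i v t) (G t)
        (W i v t) n + α i v t * ((g t)⁻¹ * w t n) :=
      eventually_all.2 fun i => eventually_all.2 fun v => hW i v
    have hs2 : ∀ᶠ t in atTop, ∀ i v, α i v t ≤ 1 / 4 ∧ N * β i v t ≤ 1 / 4 :=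
      eventually_all.2 fun i => eventually_all.2 fun v => hsmall i v
    filter_upwards [hW2, hs2] with t h1 h2
    have hinc : 0 ≤ g (t + 1) - g t := sub_nonneg.2 (by rw [hg]; exact le_max_left _ _)
    refine norm_le_of_abs_apply_le (add_nonneg (le_max_of_le_left (norm_nonneg _))
      (mul_nonneg (norm_nonneg _) hinc)) fun n i v => ?_
    -- The noise cancels at scale `g t`; passing to scale `g (t + 1)` leaves the increment of `g`
    -- times `W` as the only remainder.
    have hR : R (t + 1) n i v = consensusStep (α i v t) (β i v t) (G t) (fun l => R t l i v) n
        + α i v t * f t n - W' (t + 1) n i v * (g (t + 1) - g t) := by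
      have e1 : consensusStep (α i v t) (β i v t) (G t) (fun l => R t l i v) n
          = consensusStep (α i v t) (β i v t) (G t) (fun l => Q t l i v) n
            - g t * consensusStep (α i v t) (β i v t) (G t) (W i v t) n := by
        rw [← consensusStep_mul, ← consensusStep_sub]
      have e2 : g t * W i v (t + 1) n
          = g t * consensusStep (α i v t) (β i v t) (G t) (W i v t) n + α i v t * w t n := by
        rw [h1 i v n]
        have := (hg0 t).ne'
        field_simp
      simp only [R, W'] at e1 ⊢
      rw [e1, hQ]
      linear_combination (-1 : ℝ) * e2
    have h3 := abs_consensusStep_le (hβ0 i v t)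
      (by linarith [(h2 i v).1, (h2 i v).2] : α i v t + N * β i v t ≤ 1) (G t)
      (y := fun l => R t l i v) (fun l => abs_apply_le_norm (R t) l i v) n
    have h4 : |α i v t * f t n| ≤ α i v t * (γ * g t + D) := by
      rw [abs_mul, abs_of_nonneg (hα0 i v t)]
      exact mul_le_mul_of_nonneg_left (hf t n) (hα0 i v t)
    have h5 : |W' (t + 1) n i v * (g (t + 1) - g t)| ≤ ‖W' (t + 1)‖ * (g (t + 1) - g t) := by
      rw [abs_mul, abs_of_nonneg hinc]
      exact mul_le_mul_of_nonneg_right (abs_apply_le_norm _ n i v) hinc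
    have h6 : (1 - α i v t) * ‖R t‖ + α i v t * (γ * g t + D) ≤ max ‖R t‖ (γ * g t + D) := by
      have := mul_le_mul_of_nonneg_left (le_max_left ‖R t‖ (γ * g t + D))
        (by linarith [(h2 i v).1] : 0 ≤ 1 - α i v t)
      have := mul_le_mul_of_nonneg_left (le_max_right ‖R t‖ (γ * g t + D)) (hα0 i v t)
      linarith
    rw [hR]
    refine (abs_sub _ _).trans ?_
    linarith [abs_add_le (consensusStep (α i v t) (β i v t) (G t) (fun l => R t l i v) n)
      (α i v t * f t n)]

/-- Asymptotic consensus for one component. -/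
theorem tendsto_disagreement_sub_of_recursion {a b : ℕ → ℝ} (ha0 : ∀ t, 0 ≤ a t)
    (hb0 : ∀ t, 0 ≤ b t)
    (hsmall : ∀ᶠ t in atTop, a t ≤ 1 / 4 ∧ N * b t ≤ 1 / 4)
    (hdiv : Tendsto (fun T => ∑ t ∈ Finset.range T, a t) atTop atTop)
    {y z : ℕ → Fin N → ℝ}
    (hy : ∀ᶠ t in atTop, ∀ n, y (t + 1) n = consensusStep (a t) (b t) (G t) (y t) n + a t * f t n)
    (hz : ∀ᶠ t in atTop, ∀ n, z (t + 1) n = consensusStep (a t) (b t) (G t) (z t) n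
      + a t * disagreement (f t) n) (n : Fin N) :
    Tendsto (fun t => disagreement (y t) n - z t n) atTop (𝓝 0) := by
  let d : ℕ → Fin N → ℝ := fun t n => disagreement (y t) n - z t n
  have h0 : Tendsto (fun t => ‖d t‖) atTop (𝓝 0) := by
    refine tendsto_zero_of_le_one_sub_mul (fun t => norm_nonneg _) ha0 hdiv ?_
    filter_upwards [hsmall, hy, hz] with t hs h1 h2
    refine (pi_norm_le_iff_of_nonneg (mul_nonneg (by linarith [hs.1]) (norm_nonneg _))).2
      fun n => ?_
    -- The forcing terms cancel, and what is left is the homogeneous step, a sup-norm contraction by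
    -- `1 - a`.
    have hd : d (t + 1) n = consensusStep (a t) (b t) (G t) (d t) n := by
      have e : y (t + 1) = fun n => consensusStep (a t) (b t) (G t) (y t) n + a t * f t n :=
        funext h1
      simp only [d]
      rw [e, disagreement_consensusStep_add, h2, consensusStep_sub _ _ _ (disagreement (y t)) (z t)]
      ring
    rw [hd, Real.norm_eq_abs]
    exact abs_consensusStep_le (hb0 t) (by linarith [hs.1, hs.2]) (G t)
      (fun n => by rw [← Real.norm_eq_abs]; exact norm_le_pi_norm (d t) n) n
  refine squeeze_zero_norm (fun t => ?_) h0
  exact norm_le_pi_norm (d t) n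

variable [Nonempty U]

/-- Convergence of distributed `Q`-learning along one trajectory, given stability and the
decay of the noise and disagreement processes. -/
theorem tendsto_of_noise_and_disagreement (hN : 0 < N) (p : X → U → PMF X)
    {m : Fin N → X → U → ℝ} {γ : ℝ} (hγ₀ : 0 ≤ γ) (hγ₁ : γ < 1) {xs : ℕ → X} {us : ℕ → U}
    (hα0 : ∀ i v t, 0 ≤ α i v t) (hβ0 : ∀ i v t, 0 ≤ β i v t)
    (hsmall : ∀ i v, ∀ᶠ t in atTop, α i v t ≤ 1 / 4 ∧ N * β i v t ≤ 1 / 4)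
    (hdiv : ∀ i v, Tendsto (fun T => ∑ t ∈ Finset.range T, α i v t) atTop atTop)
    (hvisit : ∀ i v t, (xs t, us t) ≠ (i, v) → α i v t = 0)
    (hf : ∀ t n, f t n = m n (xs t) (us t)
      + γ * ∑ j, (p (xs t) (us t) j).toReal * minControl (Q t n j))
    (hQ : ∀ t n i v, Q (t + 1) n i v = consensusStep (α i v t) (β i v t) (G t)
      (fun l => Q t l i v) n + α i v t * (f t n + w t n))
    {B : ℝ} (hB : ∀ t, ‖Q t‖ ≤ B) {Y Z : X → U → ℕ → Fin N → ℝ}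
    (hY : ∀ i v, ∀ᶠ t in atTop, ∀ n, Y i v (t + 1) n = consensusStep (α i v t) (β i v t) (G t)
      (Y i v t) n + α i v t * w t n)
    (hZ : ∀ i v, ∀ᶠ t in atTop, ∀ n, Z i v (t + 1) n = consensusStep (α i v t) (β i v t) (G t)
      (Z i v t) n + α i v t * disagreement (f t) n)
    (hYlim : ∀ i v n, Tendsto (fun t => Y i v t n) atTop (𝓝 0))
    (hZlim : ∀ i v n, Tendsto (fun t => Z i v t n) atTop (𝓝 0))
    {Qstar : X → U → ℝ}
    (hstar : bellman p (fun i v => networkMean fun n => m n i v) γ Qstar = Qstar) (n : Fin N) :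
    Tendsto (fun t => Q t n) atTop (𝓝 Qstar) := by
  -- `y` follows the recursion of the iterates with the noise removed; the drift `f` is still
  -- evaluated at the iterates themselves.
  let y : X → U → ℕ → Fin N → ℝ := fun i v t n => Q t n i v - Y i v t n
  have hy : ∀ i v, ∀ᶠ t in atTop, ∀ n, y i v (t + 1) n
      = consensusStep (α i v t) (β i v t) (G t) (y i v t) n + α i v t * f t n := by
    intro i v
    filter_upwards [hY i v] with t ht n
    simp only [y]
    rw [consensusStep_sub _ _ _ (fun l => Q t l i v) (Y i v t), hQ, ht]
    ring
  have hdel : ∀ i v n, Tendsto (fun t => disagreement (y i v t) n - Z i v t n) atTop (𝓝 0) :=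
    fun i v n => tendsto_disagreement_sub_of_recursion (hα0 i v) (hβ0 i v) (hsmall i v) (hdiv i v)
      (hy i v) (hZ i v) n
  -- Algebraically this is the iterate minus the network mean of `y`; it is grouped into three
  -- pieces already known to vanish.
  let err : ℕ → Fin N → X → U → ℝ := fun t n i v =>
    Y i v t n + (Z i v t n + (disagreement (y i v t) n - Z i v t n))
  have herr : Tendsto (fun t => ‖err t‖) atTop (𝓝 0) := by
    have : Tendsto err atTop (𝓝 0) := by
      refine tendsto_pi_nhds.2 fun n => tendsto_pi_nhds.2 fun i => tendsto_pi_nhds.2 fun v => ?_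
      have := (hYlim i v n).add ((hZlim i v n).add (hdel i v n))
      rw [add_zero, add_zero] at this
      exact this
    simpa using this.norm
  have hdecomp : ∀ t n i v, Q t n i v = networkMean (y i v t) + err t n i v := by
    intro t n i v
    simp only [err, disagreement, y]
    ring
  let e : ℕ → X × U → ℝ := fun t z => |networkMean (y z.1 z.2 t) - Qstar z.1 z.2|
  have hQe : ∀ t n i v, |Q t n i v - Qstar i v| ≤ e t (i, v) + ‖err t‖ := by
    intro t n i v
    rw [hdecomp]
    have h1 := abs_apply_le_norm (err t) n i v
    have h2 := abs_add_le (networkMean (y i v t) - Qstar i v) (err t n i v)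
    have h3 : networkMean (y i v t) + err t n i v - Qstar i v
      = (networkMean (y i v t) - Qstar i v) + err t n i v := by ring
    rw [h3]
    simp only [e]
    linarith
  obtain ⟨E, hE⟩ := herr.bddAbove_range
  have heB : ∀ t z, e t z ≤ B + E + ∑ i, ∑ v, |Qstar i v| := by
    rintro t ⟨i, v⟩
    have h1 : networkMean (y i v t) - Qstar i v
        = Q t ⟨0, hN⟩ i v - err t ⟨0, hN⟩ i v - Qstar i v := by
      rw [hdecomp]; ring
    have h2 := (abs_apply_le_norm (Q t) ⟨0, hN⟩ i v).trans (hB t)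
    have h3 := (abs_apply_le_norm (err t) ⟨0, hN⟩ i v).trans (hE ⟨t, rfl⟩)
    have h4 : |Qstar i v| ≤ ∑ i, ∑ v, |Qstar i v| :=
      (Finset.single_le_sum (f := fun v => |Qstar i v|) (fun _ _ => abs_nonneg _)
        (Finset.mem_univ v)).trans (Finset.single_le_sum (f := fun i => ∑ v, |Qstar i v|)
          (fun _ _ => Finset.sum_nonneg fun _ _ => abs_nonneg _) (Finset.mem_univ i))
    simp only [e]
    rw [h1]
    linarith [abs_sub (Q t ⟨0, hN⟩ i v - err t ⟨0, hN⟩ i v) (Qstar i v),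
      abs_sub (Q t ⟨0, hN⟩ i v) (err t ⟨0, hN⟩ i v)]
  have hcontr : ∀ z : X × U, ∀ᶠ t in atTop, ∀ K, (∀ z', e t z' ≤ K) →
      e (t + 1) z ≤ (1 - α z.1 z.2 t) * e t z + α z.1 z.2 t * (γ * (K + ‖err t‖)) := by
    rintro ⟨i, v⟩
    filter_upwards [hy i v, hsmall i v] with t ht hs K hK
    have havg : networkMean (y i v (t + 1))
        = (1 - α i v t) * networkMean (y i v t) + α i v t * networkMean (f t) := by
      have e : y i v (t + 1) = fun n => consensusStep (α i v t) (β i v t) (G t) (y i v t) n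
          + α i v t * f t n := funext ht
      rw [e, networkMean_add_mul, networkMean_consensusStep]
    simp only [e]
    rw [havg]
    by_cases hxu : (xs t, us t) = (i, v)
    · have hx : xs t = i := congrArg Prod.fst hxu
      have hu : us t = v := congrArg Prod.snd hxu
      have hfd : |networkMean (f t) - Qstar i v| ≤ γ * (K + ‖err t‖) := by
        have hst : Qstar i v = networkMean (fun n => m n i v
            + γ * ∑ j, (p i v j).toReal * minControl (Qstar j)) := by
          have h1 : networkMean (fun n => m n i v
              + γ * ∑ j, (p i v j).toReal * minControl (Qstar j))
              = networkMean (fun n => m n i v) + γ * networkMean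
                (fun _ : Fin N => ∑ j, (p i v j).toReal * minControl (Qstar j)) :=
            networkMean_add_mul _ _ _
          rw [h1, networkMean_const hN]
          exact (congrFun (congrFun hstar i) v).symm
        -- The difference becomes an average over agents of discounted differences, each estimated
        -- separately, so the minimum never has to be exchanged with the network mean.
        have hdiff : networkMean (f t) - Qstar i v = networkMean (fun n =>
            γ * ∑ j, (p i v j).toReal * (minControl (Q t n j) - minControl (Qstar j))) := by
          have h1 : networkMean (f t) = networkMean (fun n => (m n i v
              + γ * ∑ j, (p i v j).toReal * minControl (Qstar j)) + 1 *
              (γ * ∑ j, (p i v j).toReal * (minControl (Q t n j) - minControl (Qstar j)))) := by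
            congr 1
            funext n
            rw [hf, hx, hu]
            simp only [mul_sub, Finset.sum_sub_distrib]
            ring
          rw [h1, networkMean_add_mul, one_mul, hst]
          ring
        rw [hdiff]
        refine abs_networkMean_le hN fun n => ?_
        rw [abs_mul, abs_of_nonneg hγ₀]
        refine mul_le_mul_of_nonneg_left ((p i v).abs_sum_toReal_mul_le fun j => ?_) hγ₀
        exact abs_minControl_sub_le fun v' => (hQe t n j v').trans (by linarith [hK (j, v')])
      have h1 : (1 - α i v t) * networkMean (y i v t) + α i v t * networkMean (f t) - Qstar i v
          = (1 - α i v t) * (networkMean (y i v t) - Qstar i v)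
            + α i v t * (networkMean (f t) - Qstar i v) := by ring
      rw [h1]
      refine (abs_add_le _ _).trans ?_
      rw [abs_mul, abs_mul, abs_of_nonneg (hα0 i v t), abs_of_nonneg (by linarith [hs.1] :
        0 ≤ 1 - α i v t)]
      linarith [mul_le_mul_of_nonneg_left hfd (hα0 i v t)]
    · rw [hvisit i v t hxu]
      simp
  have he := tendsto_zero_of_asynchronous_contraction (e := e) (α := fun t z => α z.1 z.2 t)
    hγ₀ hγ₁ (fun t z => abs_nonneg _) heB herr (fun t z => hα0 _ _ _)
    (fun z => by
      filter_upwards [hsmall z.1 z.2] with t ht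
      linarith [ht.1]) (fun z => hdiv _ _) hcontr
  refine tendsto_pi_nhds.2 fun i => tendsto_pi_nhds.2 fun v => ?_
  rw [tendsto_iff_norm_sub_tendsto_zero]
  refine squeeze_zero (fun t => norm_nonneg _) (fun t => hQe t n i v) ?_
  simpa using (he (i, v)).add herr

end Pathwise

/-! ### Conditional expectations of costs and Laplacians -/

section ConditionalLaws

variable {X U Ω : Type*} [Fintype X] [MeasurableSpace X] [DiscreteMeasurableSpace X]
  [Fintype U] [MeasurableSpace U] [DiscreteMeasurableSpace U] {N : ℕ} {mΩ : MeasurableSpace Ω}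
  {μ : Measure Ω} [IsProbabilityMeasure μ] {F : Filtration ℕ mΩ}

theorem restrict_eq_sum_restrict_inter {Z : Type*} [Fintype Z] {z : Ω → Z}
    (hz : ∀ c, MeasurableSet {ω | z ω = c}) {A : Set Ω} (hA : MeasurableSet A) :
    μ.restrict A = ∑ c, μ.restrict (A ∩ {ω | z ω = c}) := by
  rw [← Measure.sum_fintype, ← Measure.restrict_iUnion]
  · congr 1
    ext ω
    simp
  · intro c c' hcc'
    refine Set.disjoint_left.2 fun ω h1 h2 => hcc' ?_
    exact h1.2.symm.trans h2.2
  · exact fun c => hA.inter (hz c)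

variable {p : X → U → PMF X} {costLaw : Fin N → X → U → ProbabilityMeasure ℝ} {ε : ℝ}
  {x : ℕ → Ω → X} {u : ℕ → Ω → U} {cost : ℕ → Ω → Fin N → ℝ}

theorem MarkovConsistent.measurableSet_visit (h : MarkovConsistent μ F p costLaw ε x u cost)
    (t : ℕ) (z : X × U) : MeasurableSet[F t] {ω | (x t ω, u t ω) = z} :=
  measurable_visit (m := F t) (h.state_adapted t) (h.control_adapted t) z.1 z.2

theorem MarkovConsistent.measurable_cost (h : MarkovConsistent μ F p costLaw ε x u cost)
    (t : ℕ) (n : Fin N) : Measurable fun ω => cost t ω n :=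
  (h.cost_adapted t n).mono (F.le _) le_rfl

/-- The exceptional null set in the conditional law depends on the Borel set. Integrating over a
past event on which the state-action pair is fixed removes this dependence and gives an identity of
measures. -/
theorem MarkovConsistent.map_cost_restrict (h : MarkovConsistent μ F p costLaw ε x u cost)
    (t : ℕ) (n : Fin N) {A : Set Ω} (hA : MeasurableSet[F t] A) (z : X × U) :
    (μ.restrict (A ∩ {ω | (x t ω, u t ω) = z})).map (fun ω => cost t ω n)
      = μ (A ∩ {ω | (x t ω, u t ω) = z}) • (costLaw n z.1 z.2 : Measure ℝ) := by
  have hc := h.measurable_cost t n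
  set A' := A ∩ {ω | (x t ω, u t ω) = z} with hA'
  have hA'm : MeasurableSet[F t] A' := hA.inter (h.measurableSet_visit t z)
  ext B hB
  rw [Measure.map_apply hc hB, Measure.smul_apply, smul_eq_mul,
    Measure.restrict_apply (hc hB)]
  refine (ENNReal.toReal_eq_toReal_iff' (measure_ne_top _ _)
    (ENNReal.mul_ne_top (measure_ne_top _ _) (measure_ne_top _ _))).1 ?_
  have h1 : ∫ ω in A', (μ⟦(fun ω => cost t ω n) ⁻¹' B | F t⟧) ω ∂μ
      = ∫ ω in A', ((fun ω => cost t ω n) ⁻¹' B).indicator (fun _ => (1 : ℝ)) ω ∂μ :=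
    setIntegral_condExp (F.le t) ((integrable_const _).indicator (hc hB)) hA'm
  have h2 : ∫ ω in A', (μ⟦(fun ω => cost t ω n) ⁻¹' B | F t⟧) ω ∂μ
      = ∫ ω in A', (costLaw n z.1 z.2 : Measure ℝ).real B ∂μ := by
    refine setIntegral_congr_ae (F.le t _ hA'm) ?_
    filter_upwards [h.cost_law t n B hB] with ω hω hωA
    have hz : (x t ω, u t ω) = z := hωA.2
    rw [hω, ← hz]
  rw [h2, integral_indicator (hc hB), Measure.restrict_restrict (hc hB)] at h1
  simp only [integral_const, smul_eq_mul, mul_one, measureReal_restrict_apply_univ] at h1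
  rw [ENNReal.toReal_mul]
  exact h1.symm

theorem MarkovConsistent.integrable_cost (h : MarkovConsistent μ F p costLaw ε x u cost)
    (t : ℕ) (n : Fin N) {φ : ℝ → ℝ} (hφ : ∀ i v, Integrable φ (costLaw n i v : Measure ℝ))
    (hφm : Measurable φ) : Integrable (fun ω => φ (cost t ω n)) μ := by
  have hdec := restrict_eq_sum_restrict_inter (μ := μ) (z := fun ω => (x t ω, u t ω))
    (fun z => F.le t _ (h.measurableSet_visit t z)) MeasurableSet.univ
  rw [Measure.restrict_univ] at hdec
  rw [hdec, integrable_finsetSum_measure]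
  intro z _
  change Integrable (φ ∘ fun ω => cost t ω n) _
  rw [← integrable_map_measure hφm.aestronglyMeasurable (h.measurable_cost t n).aemeasurable,
    h.map_cost_restrict t n MeasurableSet.univ z]
  exact (hφ z.1 z.2).smul_measure (measure_ne_top _ _)

/-- There are finitely many state-action pairs, so the defining integrals split into pieces where
the law of the cost is constant. -/
theorem MarkovConsistent.condExp_cost (h : MarkovConsistent μ F p costLaw ε x u cost)
    (t : ℕ) (n : Fin N) {φ : ℝ → ℝ} (hφ : ∀ i v, Integrable φ (costLaw n i v : Measure ℝ))
    (hφm : Measurable φ) : μ[fun ω => φ (cost t ω n) | F t]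
      =ᵐ[μ] fun ω => ∫ c, φ c ∂(costLaw n (x t ω) (u t ω) : Measure ℝ) := by
  let D : X × U → ℝ := fun z => ∫ c, φ c ∂(costLaw n z.1 z.2 : Measure ℝ)
  have hxu : Measurable[F t] fun ω => (x t ω, u t ω) :=
    (h.state_adapted t).prodMk (h.control_adapted t)
  have hDm : Measurable[F t] fun ω => D (x t ω, u t ω) := by
    have : Measurable D := measurable_of_countable _
    exact this.comp hxu
  have hDi : Integrable (fun ω => D (x t ω, u t ω)) μ :=
    Integrable.of_bound (hDm.mono (F.le t) le_rfl).aestronglyMeasurable (∑ z, |D z|)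
      (ae_of_all _ fun ω => Finset.single_le_sum (f := fun z => |D z|) (fun _ _ => abs_nonneg _)
        (Finset.mem_univ _))
  have hci := h.integrable_cost t n hφ hφm
  refine (ae_eq_condExp_of_forall_setIntegral_eq (F.le t) hci (fun s _ _ => hDi.integrableOn)
    (fun A hA _ => ?_) hDm.stronglyMeasurable.aestronglyMeasurable).symm
  have hdec := restrict_eq_sum_restrict_inter (μ := μ) (z := fun ω => (x t ω, u t ω))
    (fun z => F.le t _ (h.measurableSet_visit t z)) (F.le t _ hA)
  rw [hdec, integral_finsetSum_measure fun z _ => hDi.mono_measure Measure.restrict_le_self,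
    integral_finsetSum_measure fun z _ => hci.mono_measure Measure.restrict_le_self]
  refine Finset.sum_congr rfl fun z _ => ?_
  have h1 : ∫ ω in A ∩ {ω | (x t ω, u t ω) = z}, D (x t ω, u t ω) ∂μ
      = ∫ ω in A ∩ {ω | (x t ω, u t ω) = z}, D z ∂μ := by
    refine setIntegral_congr_fun ((F.le t _ hA).inter (F.le t _ (h.measurableSet_visit t z)))
      fun ω hω => ?_
    have hz : (x t ω, u t ω) = z := hω.2
    simp only [hz]
  have h2 := integral_map (μ := μ.restrict (A ∩ {ω | (x t ω, u t ω) = z}))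
    (h.measurable_cost t n).aemeasurable (f := φ) hφm.aestronglyMeasurable
  rw [h1, ← h2, h.map_cost_restrict t n hA z, integral_smul_measure]
  simp [D, Measure.real]

theorem MarkovConsistent.integrable_sq (h : MarkovConsistent μ F p costLaw ε x u cost)
    (n : Fin N) (i : X) (v : U) : Integrable (fun c : ℝ => c ^ 2) (costLaw n i v : Measure ℝ) := by
  refine ((integrable_const 1).add (h.moment n i v)).mono'
    (measurable_id.pow_const 2).aestronglyMeasurable (ae_of_all _ fun c => ?_)
  simp only [Pi.add_apply, norm_pow, Real.norm_eq_abs]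
  have hε := h.eps_pos
  rcases le_total |c| 1 with hc | hc
  · have := Real.rpow_nonneg (abs_nonneg c) (2 + ε)
    have := pow_le_one₀ (n := 2) (abs_nonneg c) hc
    linarith
  · have : |c| ^ (2 : ℝ) ≤ |c| ^ (2 + ε) := Real.rpow_le_rpow_of_exponent_le hc (by linarith)
    rw [Real.rpow_two] at this
    linarith

theorem MarkovConsistent.integrable_id (h : MarkovConsistent μ F p costLaw ε x u cost)
    (n : Fin N) (i : X) (v : U) : Integrable (fun c : ℝ => c) (costLaw n i v : Measure ℝ) :=
  ((memLp_two_iff_integrable_sq measurable_id.aestronglyMeasurable).2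
    (h.integrable_sq n i v)).integrable one_le_two

theorem RandomNetwork.condExp_laplacian {hN : 2 ≤ N} {G : ℕ → Ω → SimpleGraph (Fin N)}
    (h : RandomNetwork hN μ F G) (t : ℕ) (n l : Fin N) :
    μ[fun ω => laplacian (G t ω) n l | F t] =ᵐ[μ] fun _ => meanLaplacian μ (G 0) n l := by
  have hev : Measurable fun L : Fin N → Fin N → ℝ => L n l := by fun_prop
  have hle : MeasurableSpace.comap (fun ω => laplacian (G t ω)) inferInstance ≤ mΩ :=
    ((h.adapted t).mono (F.le _) le_rfl).comap_le
  have h1 := condExp_indep_eq hle (F.le t) (f := fun ω => laplacian (G t ω) n l)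
    (Measurable.stronglyMeasurable (hev.comp (comap_measurable _))) (h.indep_past t)
  have h2 := ((h.identDistrib t).comp hev).integral_eq
  refine h1.trans (ae_of_all _ fun ω => ?_)
  exact h2

theorem RandomNetwork.measurable_laplacian {hN : 2 ≤ N} {G : ℕ → Ω → SimpleGraph (Fin N)}
    (h : RandomNetwork hN μ F G) (t : ℕ) (n l : Fin N) :
    Measurable[F (t + 1)] fun ω => laplacian (G t ω) n l := by
  have hev : Measurable fun L : Fin N → Fin N → ℝ => L n l := by fun_prop
  exact hev.comp (h.adapted t)

/-- Taking the minimum of `λ₂` and `1` is harmless and keeps later contraction factors positive. -/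
theorem RandomNetwork.exists_spectral_gap {hN : 2 ≤ N} {G : ℕ → Ω → SimpleGraph (Fin N)}
    (h : RandomNetwork hN μ F G) : ∃ κ : ℝ, 0 < κ ∧ κ ≤ 1 ∧ ∀ y : Fin N → ℝ, ∑ n, y n = 0 →
      κ * ∑ n, y n ^ 2 ≤ ∑ n, ∑ l, meanLaplacian μ (G 0) n l * (y n * y l) := by
  have hint : ∀ n l, Integrable (fun ω => laplacian (G 0 ω) n l) μ := fun n l =>
    Integrable.of_bound ((h.measurable_laplacian 0 n l).mono (F.le _) le_rfl).aestronglyMeasurable N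
      (ae_of_all _ fun ω => abs_laplacian_le _ _ _)
  have hker : (meanLaplacian μ (G 0)).mulVec (fun _ => 1) = 0 := by
    funext n
    simp only [Matrix.mulVec, dotProduct, mul_one, meanLaplacian, Matrix.of_apply, Pi.zero_apply]
    rw [← integral_finsetSum _ fun l _ => hint n l]
    simp [sum_laplacian_right]
  refine ⟨_, lt_min h.connected_on_average one_pos, min_le_right _ _, fun y hy => ?_⟩
  have h1 := secondEigenvalue_mul_sum_sq_le hN (meanLaplacian_isHermitian μ (G 0)) hker
    h.connected_on_average y hy
  have h0 : 0 ≤ ∑ n, y n ^ 2 := Finset.sum_nonneg fun n _ => sq_nonneg _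
  refine (mul_le_mul_of_nonneg_right (min_le_left _ _) h0).trans (h1.trans (le_of_eq ?_))
  simp only [dotProduct, Matrix.mulVec, Finset.mul_sum]
  exact Finset.sum_congr rfl fun n _ => Finset.sum_congr rfl fun l _ => by ring

end ConditionalLaws

/-! ### Drift, noise and running maximum -/

section Innovation

variable {X U Ω : Type*} [Fintype X] [MeasurableSpace X] [DiscreteMeasurableSpace X]
  [Fintype U] [Nonempty U] [MeasurableSpace U] [DiscreteMeasurableSpace U] {N : ℕ}
  {mΩ : MeasurableSpace Ω} {μ : Measure Ω} [IsProbabilityMeasure μ] {F : Filtration ℕ mΩ}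
  {p : X → U → PMF X} {costLaw : Fin N → X → U → ProbabilityMeasure ℝ} {ε γ : ℝ}
  {x : ℕ → Ω → X} {u : ℕ → Ω → U} {cost : ℕ → Ω → Fin N → ℝ}
  {Q : ℕ → Ω → Fin N → X → U → ℝ}

/-- Conditional mean of the innovation of agent `n` given the past. -/
noncomputable def drift (p : X → U → PMF X) (costLaw : Fin N → X → U → ProbabilityMeasure ℝ)
    (γ : ℝ) (x : ℕ → Ω → X) (u : ℕ → Ω → U) (Q : ℕ → Ω → Fin N → X → U → ℝ) (t : ℕ) (ω : Ω)
    (n : Fin N) : ℝ :=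
  ∫ c, c ∂(costLaw n (x t ω) (u t ω) : Measure ℝ)
    + γ * ∑ j, (p (x t ω) (u t ω) j).toReal * minControl (Q t ω n j)

/-- Deviation of the innovation of agent `n` from its conditional mean. -/
noncomputable def innovationNoise (p : X → U → PMF X)
    (costLaw : Fin N → X → U → ProbabilityMeasure ℝ) (γ : ℝ) (x : ℕ → Ω → X) (u : ℕ → Ω → U)
    (cost : ℕ → Ω → Fin N → ℝ) (Q : ℕ → Ω → Fin N → X → U → ℝ) (t : ℕ) (ω : Ω) (n : Fin N) : ℝ :=
  cost t ω n + γ * minControl (Q t ω n (x (t + 1) ω)) - drift p costLaw γ x u Q t ω n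

/-- A bound on the means of the one-stage costs. -/
noncomputable def meanCostBound (costLaw : Fin N → X → U → ProbabilityMeasure ℝ) : ℝ :=
  ∑ n, ∑ z : X × U, |∫ c, c ∂(costLaw n z.1 z.2 : Measure ℝ)|

theorem meanCostBound_nonneg (costLaw : Fin N → X → U → ProbabilityMeasure ℝ) :
    0 ≤ meanCostBound costLaw :=
  Finset.sum_nonneg fun _ _ => Finset.sum_nonneg fun _ _ => abs_nonneg _

theorem le_sum_sum {f : Fin N → X × U → ℝ} (hf : ∀ n z, 0 ≤ f n z) (n : Fin N) (z : X × U) :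
    f n z ≤ ∑ n, ∑ z, f n z :=
  (Finset.single_le_sum (f := f n) (fun _ _ => hf n _) (Finset.mem_univ z)).trans
    (Finset.single_le_sum (f := fun n => ∑ z, f n z)
      (fun _ _ => Finset.sum_nonneg fun _ _ => hf _ _) (Finset.mem_univ n))

theorem abs_minControl_le_norm (q : Fin N → X → U → ℝ) (n : Fin N) (j : X) :
    |minControl (q n j)| ≤ ‖q‖ :=
  abs_minControl_le fun v => abs_apply_le_norm q n j v

theorem abs_drift_le (hγ₀ : 0 ≤ γ) (t : ℕ) (ω : Ω) (n : Fin N) :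
    |drift p costLaw γ x u Q t ω n| ≤ γ * ‖Q t ω‖ + meanCostBound costLaw := by
  have h1 : |∫ c, c ∂(costLaw n (x t ω) (u t ω) : Measure ℝ)| ≤ meanCostBound costLaw :=
    le_sum_sum (f := fun n z => |∫ c, c ∂(costLaw n z.1 z.2 : Measure ℝ)|)
      (fun _ _ => abs_nonneg _) n (x t ω, u t ω)
  have h2 := mul_le_mul_of_nonneg_left ((p (x t ω) (u t ω)).abs_sum_toReal_mul_le
    fun j => abs_minControl_le_norm (Q t ω) n j) hγ₀
  refine (abs_add_le _ _).trans ?_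
  rw [abs_mul, abs_of_nonneg hγ₀]
  linarith

theorem measurable_minControl_apply {m : MeasurableSpace Ω} {q : Ω → Fin N → X → U → ℝ}
    (hq : ∀ n i v, Measurable fun ω => q ω n i v) (n : Fin N) (j : X) :
    Measurable fun ω => minControl (q ω n j) :=
  continuous_minControl.measurable.comp (measurable_pi_iff.2 fun v => hq n j v)

theorem measurable_minControl_comp {m : MeasurableSpace Ω} {q : Ω → Fin N → X → U → ℝ}
    (hq : ∀ n i v, Measurable fun ω => q ω n i v) {y : Ω → X} (hy : Measurable y) (n : Fin N) :
    Measurable fun ω => minControl (q ω n (y ω)) := by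
  classical
  have he : (fun ω => minControl (q ω n (y ω)))
      = fun ω => ∑ j, if y ω = j then minControl (q ω n j) else 0 := by
    funext ω
    simp
  rw [he]
  exact Finset.measurable_fun_sum _ fun j _ => Measurable.ite (hy (measurableSet_singleton j))
    (measurable_minControl_apply hq n j) measurable_const

theorem measurable_drift (hx : ∀ t, Measurable[F t] (x t)) (hu : ∀ t, Measurable[F t] (u t))
    (hQ : ∀ t n i v, Measurable[F t] fun ω => Q t ω n i v) (t : ℕ) (n : Fin N) :
    Measurable[F t] fun ω => drift p costLaw γ x u Q t ω n := by
  have hxu : Measurable[F t] fun ω => (x t ω, u t ω) := (hx t).prodMk (hu t)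
  have h : ∀ D : X × U → ℝ, Measurable[F t] fun ω => D (x t ω, u t ω) := fun D =>
    (measurable_of_countable D).comp hxu
  exact (h fun z => ∫ c, c ∂(costLaw n z.1 z.2 : Measure ℝ)).add
    ((Finset.measurable_fun_sum _ fun j _ => (h fun z => (p z.1 z.2 j).toReal).mul
      (measurable_minControl_apply (hQ t) n j)).const_mul γ)

/-- Scaled by a bounded predictable factor that dominates the iterates, the innovation noise is a
martingale difference sequence with bounded conditional variances. -/
theorem MarkovConsistent.scaled_innovationNoise
    (h : MarkovConsistent μ F p costLaw ε x u cost) (hγ₀ : 0 ≤ γ) (hγ₁ : γ ≤ 1)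
    (hQ : ∀ t n i v, Measurable[F t] fun ω => Q t ω n i v) {s : ℕ → Ω → ℝ} {C : ℝ} (hC : 0 ≤ C)
    (hs : ∀ t, Measurable[F t] (s t)) (hs1 : ∀ t ω, |s t ω| ≤ 1)
    (hsQ : ∀ t ω, |s t ω| * ‖Q t ω‖ ≤ C) :
    (∀ t n, Measurable[F (t + 1)]
      fun ω => s t ω * innovationNoise p costLaw γ x u cost Q t ω n) ∧
    (∀ t n, Integrable (fun ω => (s t ω * innovationNoise p costLaw γ x u cost Q t ω n) ^ 2) μ) ∧
    (∀ t n, μ[fun ω => s t ω * innovationNoise p costLaw γ x u cost Q t ω n | F t] =ᵐ[μ] 0) ∧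
    ∃ K, 0 ≤ K ∧ ∀ t n,
      μ[fun ω => (s t ω * innovationNoise p costLaw γ x u cost Q t ω n) ^ 2 | F t]
        ≤ᵐ[μ] fun _ => K := by
  set M := meanCostBound costLaw
  have hM : 0 ≤ M := meanCostBound_nonneg costLaw
  have hmeas : ∀ t n, Measurable[F (t + 1)]
      fun ω => s t ω * innovationNoise p costLaw γ x u cost Q t ω n := fun t n => by
    have hst := F.mono t.le_succ
    exact ((hs t).mono hst le_rfl).mul (((h.cost_adapted t n).add
      ((measurable_minControl_comp (fun n i v => (hQ t n i v).mono hst le_rfl)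
        (h.state_adapted (t + 1)) n).const_mul γ)).sub
      ((measurable_drift h.state_adapted h.control_adapted hQ t n).mono hst le_rfl))
  have hmin : ∀ t ω n j, |s t ω * (γ * minControl (Q t ω n j))| ≤ C := fun t ω n j => by
    rw [abs_mul, abs_mul, abs_of_nonneg hγ₀]
    refine le_trans ?_ (hsQ t ω)
    refine mul_le_mul_of_nonneg_left ?_ (abs_nonneg _)
    calc γ * |minControl (Q t ω n j)| ≤ 1 * ‖Q t ω‖ :=
          mul_le_mul hγ₁ (abs_minControl_le_norm _ n j) (abs_nonneg _) zero_le_one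
      _ = ‖Q t ω‖ := one_mul _
  have hdrift : ∀ t ω n, |s t ω * drift p costLaw γ x u Q t ω n| ≤ C + M := fun t ω n => by
    rw [abs_mul]
    have h1 := mul_le_mul_of_nonneg_left
      (abs_drift_le (p := p) (costLaw := costLaw) (x := x) (u := u) (Q := Q) hγ₀ t ω n)
      (abs_nonneg (s t ω))
    have h2 : γ * (|s t ω| * ‖Q t ω‖) ≤ 1 * C :=
      mul_le_mul hγ₁ (hsQ t ω) (mul_nonneg (abs_nonneg _) (norm_nonneg _)) zero_le_one
    have h3 := mul_le_mul_of_nonneg_right (hs1 t ω) hM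
    change _ ≤ |s t ω| * (γ * ‖Q t ω‖ + M) at h1
    linarith
  have hsq : ∀ t ω n, (s t ω * innovationNoise p costLaw γ x u cost Q t ω n) ^ 2
      ≤ 2 * cost t ω n ^ 2 + 2 * (2 * C + M) ^ 2 := fun t ω n => by
    -- Apart from the cost itself every term of the scaled noise is bounded, by `C` and `C + M`.
    set r := s t ω * (γ * minControl (Q t ω n (x (t + 1) ω)))
      - s t ω * drift p costLaw γ x u Q t ω n with hr
    have hrb : |r| ≤ 2 * C + M := by
      refine (abs_sub _ _).trans ?_
      linarith [hmin t ω n (x (t + 1) ω), hdrift t ω n]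
    have h1 : s t ω * innovationNoise p costLaw γ x u cost Q t ω n = s t ω * cost t ω n + r := by
      rw [innovationNoise, hr]; ring
    have h2 : r ^ 2 ≤ (2 * C + M) ^ 2 := sq_le_sq.2 (hrb.trans (le_abs_self _))
    have h3 : (s t ω * cost t ω n) ^ 2 ≤ cost t ω n ^ 2 := by
      rw [mul_pow]
      exact mul_le_of_le_one_left (sq_nonneg _) ((sq_le_one_iff_abs_le_one _).2 (hs1 t ω))
    rw [h1]
    linarith [sq_nonneg (s t ω * cost t ω n - r)]
  have hφ : ∀ n i v, Integrable (fun c : ℝ => 2 * c ^ 2 + 2 * (2 * C + M) ^ 2)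
      (costLaw n i v : Measure ℝ) := fun n i v =>
    ((h.integrable_sq n i v).const_mul 2).add (integrable_const _)
  have hφm : Measurable fun c : ℝ => 2 * c ^ 2 + 2 * (2 * C + M) ^ 2 := by fun_prop
  have hdom : ∀ t n, Integrable (fun ω => 2 * cost t ω n ^ 2 + 2 * (2 * C + M) ^ 2) μ :=
    fun t n => h.integrable_cost t n (hφ n) hφm
  have hint : ∀ t n, Integrable
      (fun ω => (s t ω * innovationNoise p costLaw γ x u cost Q t ω n) ^ 2) μ := fun t n =>
    (hdom t n).mono' (((hmeas t n).pow_const 2).mono (F.le _) le_rfl).aestronglyMeasurable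
      (ae_of_all _ fun ω => by
        rw [Real.norm_of_nonneg (sq_nonneg _)]
        exact hsq t ω n)
  refine ⟨hmeas, hint, fun t n => ?_, ?_⟩
  · let A : Ω → ℝ := fun ω => -(s t ω * drift p costLaw γ x u Q t ω n)
    -- `none` stands for the cost, `some j` for the event that the next state is `j`. The minimum at
    -- the random next state becomes a finite sum of known values times indicators.
    let f : Option X → Ω → ℝ := fun o ω =>
      o.elim (s t ω) fun j => s t ω * (γ * minControl (Q t ω n j))
    let g : Option X → Ω → ℝ := fun o =>
      o.elim (fun ω => cost t ω n) fun j => (x (t + 1) ⁻¹' {j}).indicator fun _ => (1 : ℝ)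
    have hx' : Measurable (x (t + 1)) := (h.state_adapted (t + 1)).mono (F.le _) le_rfl
    have hAm : Measurable[F t] A :=
      ((hs t).mul (measurable_drift h.state_adapted h.control_adapted hQ t n)).neg
    have hAi : Integrable A μ :=
      Integrable.of_bound (hAm.mono (F.le t) le_rfl).aestronglyMeasurable (C + M)
        (ae_of_all _ fun ω => by
          simp only [A, norm_neg, Real.norm_eq_abs]
          exact hdrift t ω n)
    have hfm : ∀ o, Measurable[F t] (f o) := by
      rintro (_ | j)
      · exact hs t
      · exact (hs t).mul ((measurable_minControl_apply (hQ t) n j).const_mul γ)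
    have hfb : ∀ o ω, ‖f o ω‖ ≤ 1 + C := by
      rintro (_ | j) ω
      · exact (hs1 t ω).trans (by linarith)
      · exact (hmin t ω n j).trans (by linarith)
    have hg : ∀ o, Integrable (g o) μ := by
      rintro (_ | j)
      · exact h.integrable_cost t n (φ := fun c => c) (h.integrable_id n) measurable_id
      · exact (integrable_const _).indicator (hx' (measurableSet_singleton j))
    have hfg : ∀ o, Integrable (fun ω => f o ω * g o ω) μ := fun o =>
      (hg o).bdd_mul ((hfm o).mono (F.le t) le_rfl).aestronglyMeasurable (ae_of_all _ (hfb o))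
    have he : (fun ω => s t ω * innovationNoise p costLaw γ x u cost Q t ω n)
        = fun ω => A ω + ∑ o, f o ω * g o ω := by
      funext ω
      rw [Fintype.sum_option]
      have h1 : ∑ j, f (some j) ω * g (some j) ω
          = s t ω * (γ * minControl (Q t ω n (x (t + 1) ω))) := by
        rw [Finset.sum_eq_single (x (t + 1) ω)]
        · simp [f, g]
        · intro j _ hj
          have : x (t + 1) ω ∉ ({j} : Set X) := fun hmem => hj (Set.mem_singleton_iff.1 hmem).symm
          simp [g, Set.indicator, Ne.symm hj]
        · simp
      rw [h1]
      simp only [A, f, g, Option.elim, innovationNoise]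
      ring
    rw [he]
    have h2 := h.condExp_cost t n (φ := fun c => c) (h.integrable_id n) measurable_id
    have h3 : ∀ᵐ ω ∂μ, ∀ j, (μ⟦x (t + 1) ⁻¹' {j} | F t⟧) ω = (p (x t ω) (u t ω) j).toReal :=
      ae_all_iff.2 fun j => h.transition t j
    filter_upwards [condExp_add_sum_mul (F.le t) hAm.stronglyMeasurable hAi
      (fun o => (hfm o).stronglyMeasurable) hg hfg, h2, h3] with ω h4 h5 h6
    rw [h4, Fintype.sum_option]
    simp only [f, g, Option.elim, A, h5, h6, drift, Pi.zero_apply]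
    have h7 : ∑ j, s t ω * (γ * minControl (Q t ω n j)) * (p (x t ω) (u t ω) j).toReal
        = s t ω * (γ * ∑ j, (p (x t ω) (u t ω) j).toReal * minControl (Q t ω n j)) := by
      simp only [Finset.mul_sum]
      exact Finset.sum_congr rfl fun j _ => by ring
    rw [h7]
    ring
  · have hI0 : ∀ n (z : X × U), 0 ≤ ∫ c, (2 * c ^ 2 + 2 * (2 * C + M) ^ 2)
        ∂(costLaw n z.1 z.2 : Measure ℝ) := fun n z =>
      integral_nonneg fun c => by positivity
    refine ⟨∑ n, ∑ z : X × U, ∫ c, (2 * c ^ 2 + 2 * (2 * C + M) ^ 2)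
      ∂(costLaw n z.1 z.2 : Measure ℝ), Finset.sum_nonneg fun n _ => Finset.sum_nonneg fun z _ =>
        hI0 n z, fun t n => ?_⟩
    filter_upwards [condExp_mono (m := F t) (hint t n) (hdom t n)
      (ae_of_all _ fun ω => hsq t ω n), h.condExp_cost t n (hφ n) hφm] with ω h1 h2
    refine h1.trans ?_
    rw [h2]
    exact le_sum_sum (f := fun n z => ∫ c, (2 * c ^ 2 + 2 * (2 * C + M) ^ 2)
      ∂(costLaw n z.1 z.2 : Measure ℝ)) hI0 n (x t ω, u t ω)

theorem measurable_norm_of_apply {m : MeasurableSpace Ω} {q : Ω → Fin N → X → U → ℝ}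
    (hq : ∀ n i v, Measurable fun ω => q ω n i v) : Measurable fun ω => ‖q ω‖ :=
  measurable_norm.comp (measurable_pi_iff.2 fun n => measurable_pi_iff.2 fun i =>
    measurable_pi_iff.2 fun v => hq n i v)

/-- Running maximum of the norms of the iterates, at least one. -/
noncomputable def runningMax (Q : ℕ → Ω → Fin N → X → U → ℝ) : ℕ → Ω → ℝ
  | 0 => fun ω => max 1 ‖Q 0 ω‖
  | t + 1 => fun ω => max (runningMax Q t ω) ‖Q (t + 1) ω‖

theorem one_le_runningMax (t : ℕ) (ω : Ω) : 1 ≤ runningMax Q t ω := by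
  induction t with
  | zero => exact le_max_left _ _
  | succ t ih => exact ih.trans (le_max_left _ _)

theorem norm_le_runningMax (t : ℕ) (ω : Ω) : ‖Q t ω‖ ≤ runningMax Q t ω := by
  cases t with
  | zero => exact le_max_right _ _
  | succ t => exact le_max_right _ _

theorem measurable_runningMax (hQ : ∀ t n i v, Measurable[F t] fun ω => Q t ω n i v) (t : ℕ) :
    Measurable[F t] (runningMax Q t) := by
  have hn : ∀ t, Measurable[F t] fun ω => ‖Q t ω‖ := fun t =>
    measurable_norm_of_apply (hQ t)
  induction t with
  | zero => exact measurable_const.max (hn 0)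
  | succ t ih => exact (ih.mono (F.mono t.le_succ) le_rfl).max (hn (t + 1))

end Innovation

/-! ### Weights cut to the small regime -/

section CutWeights

variable {Ω : Type*}

/-- Innovation weights, set to zero while the weights are not small. -/
noncomputable def cutInnovation (N : ℕ) (α β : ℕ → Ω → ℝ) (t : ℕ) (ω : Ω) : ℝ :=
  open Classical in if α t ω ≤ 1 / 4 ∧ N * β t ω ≤ 1 / 4 then α t ω else 0

/-- Consensus weights, set to zero while the weights are not small. -/
noncomputable def cutConsensus (N : ℕ) (α β : ℕ → Ω → ℝ) (t : ℕ) (ω : Ω) : ℝ :=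
  open Classical in if α t ω ≤ 1 / 4 ∧ N * β t ω ≤ 1 / 4 then β t ω else 0

/-- The energy inequalities need small weights, while `a` and `b` are arbitrary. Whether the weights
are small is known at time `t`, so the cut keeps them adapted. -/
theorem adaptedWeights_cut {mΩ : MeasurableSpace Ω} {F : Filtration ℕ mΩ} {N : ℕ}
    {α β : ℕ → Ω → ℝ} {G : ℕ → Ω → SimpleGraph (Fin N)}
    (hα : ∀ t, Measurable[F t] (α t)) (hβ : ∀ t, Measurable[F t] (β t)) (hα0 : ∀ t ω, 0 ≤ α t ω)
    (hβ0 : ∀ t ω, 0 ≤ β t ω)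
    (hG : ∀ t n l, Measurable[F (t + 1)] (fun ω => laplacian (G t ω) n l)) :
    AdaptedWeights F (cutInnovation N α β) (cutConsensus N α β) G := by
  classical
  have hset : ∀ t, MeasurableSet[F t] {ω | α t ω ≤ 1 / 4 ∧ N * β t ω ≤ 1 / 4} := fun t =>
    (measurableSet_le (hα t) measurable_const).inter
      (measurableSet_le ((hβ t).const_mul _) measurable_const)
  refine ⟨fun t => Measurable.ite (hset t) (hα t) measurable_const,
    fun t => Measurable.ite (hset t) (hβ t) measurable_const, ?_, ?_, ?_, ?_, hG⟩ <;>
  intro t ω <;> simp only [cutInnovation, cutConsensus] <;> split_ifs with hc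
  · exact hα0 t ω
  · exact le_rfl
  · exact hβ0 t ω
  · exact le_rfl
  · exact hc.1
  · norm_num
  · exact hc.2
  · norm_num

theorem cutInnovation_eq {N : ℕ} {α β : ℕ → Ω → ℝ} {t : ℕ} {ω : Ω}
    (h : α t ω ≤ 1 / 4 ∧ N * β t ω ≤ 1 / 4) : cutInnovation N α β t ω = α t ω := if_pos h

theorem cutConsensus_eq {N : ℕ} {α β : ℕ → Ω → ℝ} {t : ℕ} {ω : Ω}
    (h : α t ω ≤ 1 / 4 ∧ N * β t ω ≤ 1 / 4) : cutConsensus N α β t ω = β t ω := if_pos h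

theorem cut_eq_or_eq_zero (N : ℕ) (α β : ℕ → Ω → ℝ) (t : ℕ) (ω : Ω) :
    (cutInnovation N α β t ω = α t ω ∧ cutConsensus N α β t ω = β t ω) ∨
    (cutInnovation N α β t ω = 0 ∧ cutConsensus N α β t ω = 0) := by
  by_cases h : α t ω ≤ 1 / 4 ∧ N * β t ω ≤ 1 / 4
  · exact .inl ⟨if_pos h, if_pos h⟩
  · exact .inr ⟨if_neg h, if_neg h⟩

end CutWeights

/-! ### Summability of the cut weights -/

section WeightSums

variable {X U Ω : Type*} {x : ℕ → Ω → X} {u : ℕ → Ω → U} {i : X} {v : U} {a b τ₁ τ₂ : ℝ}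

theorem sum_cutInnovation_sq_le (N : ℕ) (hτ₁ : 1 / 2 < τ₁) (T : ℕ) (ω : Ω) :
    ∑ t ∈ Finset.range T, cutInnovation N (weight x u a τ₁ i v) (weight x u b τ₂ i v) t ω ^ 2
      ≤ ∑' k : ℕ, a ^ 2 / ((k : ℝ) + 1) ^ (2 * τ₁) := by
  classical
  refine sum_visits_le_tsum (x := x) (u := u) (i := i) (v := v) (ω := ω)
    (summable_div_rpow _ (by linarith)) (fun k => by positivity) (fun t => ?_) T
  have hle : cutInnovation N (weight x u a τ₁ i v) (weight x u b τ₂ i v) t ω ^ 2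
      ≤ weight x u a τ₁ i v t ω ^ 2 := by
    rcases cut_eq_or_eq_zero N (weight x u a τ₁ i v) (weight x u b τ₂ i v) t ω with h | h
    · rw [h.1]
    · rw [h.1, zero_pow two_ne_zero]; exact sq_nonneg _
  refine hle.trans (le_of_eq ?_)
  rw [weight_eq]
  split_ifs
  · rw [div_pow, ← Real.rpow_natCast (_ ^ τ₁), ← Real.rpow_mul (by positivity)]
    congr 2
    push_cast
    ring
  · simp

/-- At a visit preceded by `j` others the ratio of the weights is `(a / b) (j + 1) ^ (τ₂ - τ₁)`. A
large `k` thus makes the term decay faster than `1 / j`, however slowly the ratio itself decays. -/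
theorem sum_cutConsensus_mul_ratio_le (N : ℕ) (ha : 0 < a) (hb : 0 < b) {k : ℕ}
    (hk : 1 < τ₂ + (2 * k + 2) * (τ₁ - τ₂)) (T : ℕ) (ω : Ω) :
    ∑ t ∈ Finset.range T, cutConsensus N (weight x u a τ₁ i v) (weight x u b τ₂ i v) t ω
      * (cutInnovation N (weight x u a τ₁ i v) (weight x u b τ₂ i v) t ω
        / cutConsensus N (weight x u a τ₁ i v) (weight x u b τ₂ i v) t ω) ^ (2 * k + 2)
      ≤ ∑' j : ℕ, b * (a / b) ^ (2 * k + 2)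
        / ((j : ℝ) + 1) ^ (τ₂ + (2 * k + 2) * (τ₁ - τ₂)) := by
  classical
  refine sum_visits_le_tsum (x := x) (u := u) (i := i) (v := v) (ω := ω)
    (summable_div_rpow _ hk) (fun k => by positivity) (fun t => ?_) T
  have hnn : 0 ≤ if (x t ω, u t ω) = (i, v) then b * (a / b) ^ (2 * k + 2)
      / ((visitCount x u i v t ω : ℝ) + 1) ^ (τ₂ + (2 * k + 2) * (τ₁ - τ₂)) else 0 := by
    split_ifs <;> positivity
  rcases cut_eq_or_eq_zero N (weight x u a τ₁ i v) (weight x u b τ₂ i v) t ω with h | h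
  · rw [h.1, h.2, weight_eq, weight_eq]
    split_ifs with hv
    · set y : ℝ := (visitCount x u i v t ω : ℝ) + 1
      have hy : 0 < y := by positivity
      refine le_of_eq ?_
      have h1 : y ^ τ₁ = y ^ τ₂ * y ^ (τ₁ - τ₂) := by
        rw [← Real.rpow_add hy]; congr 1; ring
      have h2 : y ^ (τ₂ + (2 * k + 2) * (τ₁ - τ₂)) = y ^ τ₂ * (y ^ (τ₁ - τ₂)) ^ (2 * k + 2) := by
        rw [Real.rpow_add hy, ← Real.rpow_natCast (y ^ (τ₁ - τ₂)), ← Real.rpow_mul hy.le]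
        congr 2
        push_cast
        ring
      have p1 : 0 < y ^ τ₂ := Real.rpow_pos_of_pos hy _
      have p2 : 0 < y ^ (τ₁ - τ₂) := Real.rpow_pos_of_pos hy _
      have h3 : a / y ^ τ₁ / (b / y ^ τ₂) = (a / b) / y ^ (τ₁ - τ₂) := by
        rw [h1]; field_simp
      rw [h3, h2, div_pow]
      field_simp
    · simp
  · rw [h.1, h.2]
    simpa using hnn

theorem cutInnovation_eq_zero_of_cutConsensus_eq_zero (N : ℕ) (hb : 0 < b) (t : ℕ) (ω : Ω)
    (h : cutConsensus N (weight x u a τ₁ i v) (weight x u b τ₂ i v) t ω = 0) :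
    cutInnovation N (weight x u a τ₁ i v) (weight x u b τ₂ i v) t ω = 0 := by
  classical
  rcases cut_eq_or_eq_zero N (weight x u a τ₁ i v) (weight x u b τ₂ i v) t ω with h' | h'
  · rw [h'.2, weight_eq] at h
    split_ifs at h with hv
    · have : 0 < b / ((visitCount x u i v t ω : ℝ) + 1) ^ τ₂ := by positivity
      exact absurd h this.ne'
    · rw [h'.1, weight_eq_zero_of_ne _ _ _ hv]
  · exact h'.1

end WeightSums

/-! ### Proof of convergence and optimality -/

section Assembly

variable {X U Ω : Type*} [Fintype X] [MeasurableSpace X] [DiscreteMeasurableSpace X]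
  [Fintype U] [Nonempty U] [MeasurableSpace U] [DiscreteMeasurableSpace U] {N : ℕ}
  {mΩ : MeasurableSpace Ω} {μ : Measure Ω} [IsProbabilityMeasure μ] {F : Filtration ℕ mΩ}
  {p : X → U → PMF X} {costLaw : Fin N → X → U → ProbabilityMeasure ℝ}
  {x : ℕ → Ω → X} {u : ℕ → Ω → U} {cost : ℕ → Ω → Fin N → ℝ} {G : ℕ → Ω → SimpleGraph (Fin N)}
  {γ a b τ₁ τ₂ ε : ℝ} {Q₀ : Ω → Fin N → X → U → ℝ}

theorem qdIterate_succ (t : ℕ) (ω : Ω) (n : Fin N) (i : X) (v : U) :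
    qdIterate γ a b τ₁ τ₂ x u cost G Q₀ (t + 1) ω n i v
      = consensusStep (weight x u a τ₁ i v t ω) (weight x u b τ₂ i v t ω) (G t ω)
          (fun l => qdIterate γ a b τ₁ τ₂ x u cost G Q₀ t ω l i v) n
        + weight x u a τ₁ i v t ω * (cost t ω n
          + γ * minControl (qdIterate γ a b τ₁ τ₂ x u cost G Q₀ t ω n (x (t + 1) ω))) := by
  rw [consensusStep, sum_laplacian_mul_eq_sum_filter]
  simp only [qdIterate]
  ring

theorem measurable_qdIterate (hx : ∀ t, Measurable[F t] (x t)) (hu : ∀ t, Measurable[F t] (u t))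
    (hc : ∀ t n, Measurable[F (t + 1)] fun ω => cost t ω n)
    (hG : ∀ t n l, Measurable[F (t + 1)] fun ω => laplacian (G t ω) n l)
    (hQ₀ : ∀ n i v, Measurable[F 0] fun ω => Q₀ ω n i v) (t : ℕ) (n : Fin N) (i : X) (v : U) :
    Measurable[F t] fun ω => qdIterate γ a b τ₁ τ₂ x u cost G Q₀ t ω n i v := by
  induction t generalizing n i v with
  | zero => exact hQ₀ n i v
  | succ t ih =>
    have hst := F.mono t.le_succ
    have hα := (measurable_weight hx hu a τ₁ i v t).mono hst le_rfl
    have hβ := (measurable_weight hx hu b τ₂ i v t).mono hst le_rfl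
    simp only [qdIterate_succ]
    exact (measurable_consensusStep hα hβ (hG t) (fun l => (ih l i v).mono hst le_rfl) n).add
      (hα.mul ((hc t n).add ((measurable_minControl_comp
        (fun n i v => (ih n i v).mono hst le_rfl) (hx (t + 1)) n).const_mul γ)))

theorem ae_tendsto_qdIterate (hN : 2 ≤ N) (hγ₀ : 0 ≤ γ) (hγ₁ : γ < 1) (ha : 0 < a) (hb : 0 < b)
    (hM1 : MarkovConsistent μ F p costLaw ε x u cost) (hM2 : RandomNetwork hN μ F G)
    (hM4 : VisitedInfinitelyOften μ x u) (hτ₁ : 1 / 2 < τ₁) (hτ₁' : τ₁ ≤ 1) (hτ₂ : 0 < τ₂)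
    (hττ : τ₂ < τ₁) (hQ₀ : ∀ n i v, Measurable[F 0] (fun ω => Q₀ ω n i v)) {Qstar : X → U → ℝ}
    (hstar : bellman p (averageCost costLaw) γ Qstar = Qstar) :
    ∀ᵐ ω ∂μ, ∀ n, Tendsto (fun t => qdIterate γ a b τ₁ τ₂ x u cost G Q₀ t ω n) atTop
      (𝓝 Qstar) := by
  classical
  have hN0 : 0 < N := by omega
  set Q := qdIterate γ a b τ₁ τ₂ x u cost G Q₀ with hQdef
  set α : X → U → ℕ → Ω → ℝ := fun i v => weight x u a τ₁ i v with hα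
  set β : X → U → ℕ → Ω → ℝ := fun i v => weight x u b τ₂ i v with hβ
  set α' : X → U → ℕ → Ω → ℝ := fun i v => cutInnovation N (α i v) (β i v) with hα'
  set β' : X → U → ℕ → Ω → ℝ := fun i v => cutConsensus N (α i v) (β i v) with hβ'
  set f := drift p costLaw γ x u Q with hf
  set w := innovationNoise p costLaw γ x u cost Q with hw
  set g := runningMax Q with hg
  set M := meanCostBound costLaw with hM
  have hM0 : 0 ≤ M := meanCostBound_nonneg costLaw
  have hα0 : ∀ i v t ω, 0 ≤ α i v t ω := fun i v t ω => weight_nonneg ha.le τ₁ t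
  have hβ0 : ∀ i v t ω, 0 ≤ β i v t ω := fun i v t ω => weight_nonneg hb.le τ₂ t
  have hQm : ∀ t n i v, Measurable[F t] fun ω => Q t ω n i v :=
    measurable_qdIterate hM1.state_adapted hM1.control_adapted hM1.cost_adapted
      hM2.measurable_laplacian hQ₀
  have hgm : ∀ t, Measurable[F t] (g t) := measurable_runningMax hQm
  have hg1 : ∀ t ω, 1 ≤ g t ω := one_le_runningMax
  have hQg : ∀ t ω, ‖Q t ω‖ ≤ g t ω := norm_le_runningMax
  have hAW : ∀ i v, AdaptedWeights F (α' i v) (β' i v) G := fun i v =>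
    adaptedWeights_cut (measurable_weight hM1.state_adapted hM1.control_adapted a τ₁ i v)
      (measurable_weight hM1.state_adapted hM1.control_adapted b τ₂ i v) (hα0 i v) (hβ0 i v)
      hM2.measurable_laplacian
  have hcount : ∀ᵐ ω ∂μ, ∀ i v, Tendsto (fun t => visitCount x u i v t ω) atTop atTop := by
    refine ae_all_iff.2 fun i => ae_all_iff.2 fun v => ?_
    filter_upwards [ae_all_iff.2 (hM4 i v)] with ω hω
    exact tendsto_visitCount hω
  have hsmall : ∀ᵐ ω ∂μ, ∀ i v, ∀ᶠ t in atTop, α i v t ω ≤ 1 / 4 ∧ N * β i v t ω ≤ 1 / 4 := by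
    filter_upwards [hcount] with ω hω i v
    have h1 := tendsto_weight (x := x) (u := u) ha.le (by linarith : 0 < τ₁) (hω i v)
    have h2 := (tendsto_weight (x := x) (u := u) hb.le hτ₂ (hω i v)).const_mul (N : ℝ)
    rw [mul_zero] at h2
    filter_upwards [h1.eventually (gt_mem_nhds (by norm_num : (0 : ℝ) < 1 / 4)),
      h2.eventually (gt_mem_nhds (by norm_num : (0 : ℝ) < 1 / 4))] with t h3 h4
    exact ⟨h3.le, h4.le⟩
  have hdivα : ∀ᵐ ω ∂μ, ∀ i v, Tendsto (fun T => ∑ t ∈ Finset.range T, α i v t ω) atTop atTop := by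
    filter_upwards [hcount] with ω hω i v
    exact tendsto_sum_weight ha hτ₁' (hω i v)
  have hdivα' : ∀ i v, ∀ᵐ ω ∂μ,
      Tendsto (fun T => ∑ t ∈ Finset.range T, α' i v t ω) atTop atTop := by
    intro i v
    filter_upwards [hdivα, hsmall] with ω h1 h2
    exact tendsto_sum_range_congr (h1 i v) ((h2 i v).mono fun t ht => cutInnovation_eq ht)
  have hdivβ' : ∀ i v, ∀ᵐ ω ∂μ,
      Tendsto (fun T => ∑ t ∈ Finset.range T, β' i v t ω) atTop atTop := by
    intro i v
    filter_upwards [hcount, hsmall] with ω h1 h2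
    exact tendsto_sum_range_congr (tendsto_sum_weight hb (hττ.le.trans hτ₁') (h1 i v))
      ((h2 i v).mono fun t ht => cutConsensus_eq ht)
  have hnoise : ∀ (s : ℕ → Ω → ℝ) (C : ℝ), 0 ≤ C → (∀ t, Measurable[F t] (s t)) →
      (∀ t ω, |s t ω| ≤ 1) → (∀ t ω, |s t ω| * ‖Q t ω‖ ≤ C) →
      ∀ᵐ ω ∂μ, ∀ i v n, Tendsto (fun t =>
        drivenSequence (α' i v) (β' i v) G (fun t ω n => s t ω * w t ω n) t ω n) atTop (𝓝 0) := by
    intro s C hC hs hs1 hsQ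
    obtain ⟨h1, h2, h3, K, hK, h4⟩ := hM1.scaled_innovationNoise hγ₀ hγ₁.le hQm hC hs hs1 hsQ
    exact ae_all_iff.2 fun i => ae_all_iff.2 fun v =>
      (hAW i v).tendsto_drivenSequence_of_martingale_difference
        (sum_cutInnovation_sq_le N hτ₁) (hdivα' i v) h1 h2 h3 hK h4
  -- Dividing by the running maximum makes the noise admissible before stability is known.
  have hW := hnoise (fun t ω => (g t ω)⁻¹) 1 zero_le_one (fun t => (hgm t).inv)
    (fun t ω => by
      rw [abs_of_nonneg (inv_nonneg.2 (zero_le_one.trans (hg1 t ω)))]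
      exact inv_le_one_of_one_le₀ (hg1 t ω))
    (fun t ω => by
      rw [abs_of_nonneg (inv_nonneg.2 (zero_le_one.trans (hg1 t ω))),
        inv_mul_le_iff₀ (zero_lt_one.trans_le (hg1 t ω)), mul_one]
      exact hQg t ω)
  -- Truncation by a factor known at time `t` preserves the martingale difference property.
  let s : ℕ → ℕ → Ω → ℝ := fun R t ω => if g t ω ≤ R then 1 else 0
  have hsm : ∀ R t, Measurable[F t] (s R t) := fun R t =>
    Measurable.ite (measurableSet_le (hgm t) measurable_const) measurable_const measurable_const
  have hs1 : ∀ R t ω, |s R t ω| ≤ 1 := fun R t ω => by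
    simp only [s]; split_ifs <;> norm_num
  have hsQ : ∀ R t ω, |s R t ω| * ‖Q t ω‖ ≤ R := fun R t ω => by
    simp only [s]
    split_ifs with h
    · rw [abs_one, one_mul]; exact (hQg t ω).trans h
    · simp
  have hY : ∀ᵐ ω ∂μ, ∀ R i v n, Tendsto (fun t =>
      drivenSequence (α' i v) (β' i v) G (fun t ω n => s R t ω * w t ω n) t ω n) atTop (𝓝 0) :=
    ae_all_iff.2 fun R => hnoise (s R) R (Nat.cast_nonneg R) (hsm R) (hs1 R) (hsQ R)
  -- Any `k > 1 / (τ₁ - τ₂)` makes the error of the power `k + 1` of the disagreement energy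
  -- summable.
  obtain ⟨k, hk⟩ : ∃ k : ℕ, 1 < τ₂ + (2 * k + 2) * (τ₁ - τ₂) := by
    obtain ⟨k, hk⟩ := exists_nat_gt (1 / (τ₁ - τ₂))
    have hpos : 0 < τ₁ - τ₂ := by linarith
    rw [div_lt_iff₀ hpos] at hk
    refine ⟨k, ?_⟩
    have : (0 : ℝ) ≤ (k + 2) * (τ₁ - τ₂) := by positivity
    linarith
  obtain ⟨κ, hκ0, hκ1, hgap⟩ := hM2.exists_spectral_gap
  let φ : ℕ → ℕ → Ω → Fin N → ℝ := fun R t ω => disagreement fun n => s R t ω * f t ω n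
  have hZ : ∀ᵐ ω ∂μ, ∀ (R : ℕ) i v n, Tendsto (fun t =>
      drivenSequence (α' i v) (β' i v) G (φ R) t ω n) atTop (𝓝 0) := by
    refine ae_all_iff.2 fun R => ae_all_iff.2 fun i => ae_all_iff.2 fun v => ?_
    have hsf : ∀ t ω n, |s R t ω * f t ω n| ≤ R + M := fun t ω n => by
      rw [abs_mul]
      have h1 := mul_le_mul_of_nonneg_left (abs_drift_le (p := p) (costLaw := costLaw) (x := x)
        (u := u) (Q := Q) hγ₀ t ω n) (abs_nonneg (s R t ω))
      have h2 : γ * (|s R t ω| * ‖Q t ω‖) ≤ 1 * R :=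
        mul_le_mul hγ₁.le (hsQ R t ω) (mul_nonneg (abs_nonneg _) (norm_nonneg _)) zero_le_one
      have h3 := mul_le_mul_of_nonneg_right (hs1 R t ω) hM0
      change _ ≤ |s R t ω| * (γ * ‖Q t ω‖ + M) at h1
      linarith
    have hfm : ∀ t n, Measurable[F t] fun ω => s R t ω * f t ω n := fun t n =>
      (hsm R t).mul (measurable_drift hM1.state_adapted hM1.control_adapted hQm t n)
    refine (hAW i v).tendsto_drivenSequence_of_sum_eq_zero
      (cutInnovation_eq_zero_of_cutConsensus_eq_zero N hb) k
      (sum_cutConsensus_mul_ratio_le N ha hb hk) (hdivβ' i v) hN0 hκ0 hκ1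
      hM2.condExp_laplacian hgap (ρ := (R + M) + (R + M)) (by positivity) (fun t n => ?_)
      (fun t ω n => ?_) (fun t ω => sum_disagreement hN0 _)
    · exact (hfm t n).sub ((Finset.measurable_fun_sum _ fun n _ => hfm t n).const_mul _)
    · exact (abs_sub _ _).trans (add_le_add (hsf t ω n) (abs_networkMean_le hN0 (hsf t ω)))
  filter_upwards [hsmall, hdivα, hW, hY, hZ] with ω hsmall hdiv hW hY hZ n
  have hQrec : ∀ t n i v, Q (t + 1) ω n i v = consensusStep (α i v t ω) (β i v t ω) (G t ω)
      (fun l => Q t ω l i v) n + α i v t ω * (f t ω n + w t ω n) := fun t n i v => by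
    rw [hQdef, qdIterate_succ]
    simp only [hw, hf, innovationNoise, hα, hβ, hQdef]
    ring
  have hdriven : ∀ (φ : ℕ → Ω → Fin N → ℝ) i v, ∀ᶠ t in atTop, ∀ n,
      drivenSequence (α' i v) (β' i v) G φ (t + 1) ω n = consensusStep (α i v t ω) (β i v t ω)
        (G t ω) (drivenSequence (α' i v) (β' i v) G φ t ω) n + α i v t ω * φ t ω n := by
    intro φ i v
    filter_upwards [hsmall i v] with t ht n
    have h1 : α' i v t ω = α i v t ω := cutInnovation_eq ht
    have h2 : β' i v t ω = β i v t ω := cutConsensus_eq ht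
    simp only [drivenSequence, h1, h2]
  obtain ⟨B, hB⟩ := exists_bound_of_scaled_noise (α := fun i v t => α i v t ω)
    (β := fun i v t => β i v t ω) (G := fun t => G t ω) (Q := fun t => Q t ω)
    (f := fun t => f t ω) (w := fun t => w t ω) (g := fun t => g t ω) (D := M) hγ₀ hγ₁
    (fun i v t => hα0 i v t ω) (fun i v t => hβ0 i v t ω) hsmall hQrec
    (fun t => zero_lt_one.trans_le (hg1 t ω)) (fun t => rfl)
    (fun t n => (abs_drift_le hγ₀ t ω n).trans
      (add_le_add_left (mul_le_mul_of_nonneg_left (hQg t ω) hγ₀) _))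
    (W := fun i v t => drivenSequence (α' i v) (β' i v) G
      (fun t ω n => (g t ω)⁻¹ * w t ω n) t ω) (fun i v => hdriven _ i v) hW
  -- The level depends on the trajectory, but the limits hold almost surely for all natural levels
  -- at once. At this level the truncation is inactive at every time.
  obtain ⟨R, hR⟩ := exists_nat_ge B
  have hsR : ∀ t, s R t ω = 1 := fun t => if_pos ((hB t).trans hR)
  refine tendsto_of_noise_and_disagreement (α := fun i v t => α i v t ω)
    (β := fun i v t => β i v t ω) (G := fun t => G t ω) (Q := fun t => Q t ω)
    (f := fun t => f t ω) (w := fun t => w t ω) hN0 p (xs := fun t => x t ω)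
    (us := fun t => u t ω) hγ₀ hγ₁ (fun i v t => hα0 i v t ω) (fun i v t => hβ0 i v t ω) hsmall
    hdiv (fun i v t h => weight_eq_zero_of_ne a τ₁ t h) (fun t n => rfl) hQrec
    (fun t => (hQg t ω).trans (hB t)) (fun i v => ?_) (fun i v => ?_) (hY R) (hZ R) hstar n
  · filter_upwards [hdriven (fun t ω n => s R t ω * w t ω n) i v] with t ht n
    rw [ht n, hsR, one_mul]
  · filter_upwards [hdriven (φ R) i v] with t ht n
    rw [ht n]
    simp only [φ, hsR, one_mul]

end Assembly

theorem theorem1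
    {X U Ω : Type*} [Fintype X] [MeasurableSpace X] [DiscreteMeasurableSpace X]
    [Fintype U] [Nonempty U] [MeasurableSpace U] [DiscreteMeasurableSpace U]
    {mΩ : MeasurableSpace Ω} (μ : Measure Ω) [IsProbabilityMeasure μ] (F : Filtration ℕ mΩ)
    {N : ℕ} (hN : 2 ≤ N)
    (p : X → U → PMF X) (costLaw : Fin N → X → U → ProbabilityMeasure ℝ)
    (γ : ℝ) (hγ₀ : 0 < γ) (hγ₁ : γ < 1)
    (x : ℕ → Ω → X) (u : ℕ → Ω → U) (cost : ℕ → Ω → Fin N → ℝ)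
    (G : ℕ → Ω → SimpleGraph (Fin N))
    (ε τ₁ τ₂ a b : ℝ) (ha : 0 < a) (hb : 0 < b)
    (hM1 : MarkovConsistent μ F p costLaw ε x u cost)
    (hM2 : RandomNetwork hN μ F G)
    (hM3 : NetworkCostCondIndep μ x u cost G)
    (hM4 : VisitedInfinitelyOften μ x u)
    (hM5 : StepExponents ε τ₁ τ₂)
    (Q₀ : Ω → Fin N → X → U → ℝ)
    (hQ₀ : ∀ n i v, Measurable[F 0] (fun ω => Q₀ ω n i v)) :
    ∃ Qstar : X → U → ℝ,
      (∀ n, ∀ᵐ ω ∂μ,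
        Tendsto (fun t => qdIterate γ a b τ₁ τ₂ x u cost G Q₀ t ω n) atTop (𝓝 Qstar)) ∧
      (∀ i, minControl (Qstar i) = optimalCost p costLaw γ i) ∧
      (∀ n, ∀ᵐ ω ∂μ,
        Tendsto (fun t i => minControl (qdIterate γ a b τ₁ τ₂ x u cost G Q₀ t ω n i)) atTop
          (𝓝 (optimalCost p costLaw γ))) := by
  obtain ⟨Qstar, hstar⟩ := exists_bellman_fixedPoint p (averageCost costLaw) hγ₀.le hγ₁
  have hττ : τ₂ < τ₁ := by
    have h1 := hM5.lt
    have h2 : 0 < 1 / (2 + ε) := by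
      have := hM1.eps_pos
      positivity
    linarith
  have hconv := ae_tendsto_qdIterate (Q₀ := Q₀) hN hγ₀.le hγ₁ ha hb hM1 hM2 hM4 hM5.one_half_lt
    hM5.le_one hM5.pos hττ hQ₀ hstar
  have hopt := minControl_eq_optimalCost p costLaw hγ₀.le hγ₁ hstar
  refine ⟨Qstar, ae_all_iff.1 hconv, hopt, fun n => ?_⟩
  filter_upwards [hconv] with ω hω
  refine tendsto_pi_nhds.2 fun i => ?_
  rw [← hopt i]
  exact (continuous_minControl.tendsto (Qstar i)).comp (tendsto_pi_nhds.1 (hω n) i)
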